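/- Let $G$ be a Lie group with Lie algebra $\mathfrak g$, acting smoothly, freely and properly from the right on two manifolds $P$ and $Q$ (finite-dimensional, smooth, Hausdorff, second countable), with $P$ connected, and let $\epsilon:P\to Q$ be a smooth $G$-equivariant map (for instance the projection of a fibre bundle on which $G$ acts by bundle automorphisms). Write $\Psi^P_g(p)=pg$, $\Psi^Q_g(q)=qg$, let $\xi_P,\xi_Q$ be the fundamental vector fields of $\xi\in\mathfrak g$, and let $\mathrm{Ad}_g^*:\mathfrak g^*\to\mathfrak g^*$ be the dual map of $\mathrm{Ad}_g$. Let $\mathcal B$ be a closed $G$-invariant 2-form on $P$ and $\delta:P\to\mathfrak g^*$ a smooth $\mathcal B\mathfrak g$-potential, i.e. $i_{\xi_P}\mathcal B=d\langle\delta,\xi\rangle$ for all $\xi\in\mathfrak g$. On the fibred product $T^*_PQ=T^*Q\times_QP$, with points $(\alpha_q,p)$, $q=\epsilon(p)$, consider the lifted action $(\alpha_q,p)g=(T^*\Psi^Q_{g^{-1}}(\alpha_q),pg)$ and the momentum map $J_\delta:T^*_PQ\to\mathfrak g^*$, $\langle J_\delta(\alpha_q,p),\xi\rangle=\langle\alpha_q,\xi_Q(q)\rangle-\langle\delta(p),\xi\rangle$.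 The map $\sigma_\delta(g)=\delta(pg^{-1})-\mathrm{Ad}^*_{g^{-1}}\delta(p)$ does not depend on $p\in P$; let $G_\mu$ denote the isotropy group of $\mu\in\mathfrak g^*$ for the affine action $(g,\nu)\mapsto\mathrm{Ad}_g^*\nu-\sigma_\delta(g^{-1})$ of $G$ on $\mathfrak g^*$. Fix a principal connection $\mathcal A^Q$ on $\pi^Q:Q\to Q/G$ (a smooth $\mathfrak g$-valued 1-form with $(\Psi^Q_g)^*\mathcal A^Q=\mathrm{Ad}_{g^{-1}}\cdot\mathcal A^Q$ and $\mathcal A^Q(\xi_Q)=\xi$) and a regular value $\mu$ of $J_\delta$. Then: 1. For all $g\in G$ and $p\in P$: $g\in G_\mu$ if and only if $\mu+\delta(pg)=\mathrm{Ad}_g^*(\mu+\delta(p))$. 2. $\mathcal A^P=\epsilon^*\mathcal A^Q$ is a principal connection on $\pi^P:P\to P/G$. 3. The 1-form $\langle\mu+\delta,\mathcal A^P\rangle$ on $P$ is $G_\mu$-invariant. 4. The 2-form $\mathcal B+d\langle\mu+\delta,\mathcal A^P\rangle$ is $G_\mu$-invariant, and it is the pullback of a unique smooth 2-form on the quotient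 manifold $P/G_\mu$. 5. The orbit spaces $Q/G$ and $P/G_\mu$ are quotient manifolds, $J_\delta^{-1}(\mu)$ is an embedded submanifold of $T^*_PQ$, and $J_\delta^{-1}(\mu)/G_\mu$ is a quotient manifold. The shift map $\phi(\alpha_q,p)=(\alpha_q-\langle\mu+\delta(p),\mathcal A^Q(q)\rangle,p)$ on $J_\delta^{-1}(\mu)$ induces a diffeomorphism $$J_\delta^{-1}(\mu)/G_\mu\;\cong\;T^*_{P/G_\mu}(Q/G)=T^*(Q/G)\times_{Q/G}P/G_\mu,$$ namely $[(\alpha_q,p)]\mapsto(\bar\beta,[p])$, where $\bar\beta\in T^*_{[q]}(Q/G)$ is determined by $\langle\bar\beta,T\pi^Q(v)\rangle=\langle\alpha_q,v\rangle-\langle\mu+\delta(p),\mathcal A^Q(q)(v)\rangle$ for all $v\in T_qQ$. Here a quotient manifold is the orbit space with its quotient topology and a smooth structure for which the projection is a submersion; such structures are shown to exist (including on $P/G_\mu$ in 4), and 4 and 5 hold for any choice of them. -/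

import Mathlib

open scoped Manifold ContDiff Bundle Topology
open MulOpposite Bundle

noncomputable section

namespace MagneticReduction

section Forms

variable {E M E' M' : Type*} [NormedAddCommGroup E] [NormedSpace ℝ E] [TopologicalSpace M]
  [ChartedSpace E M] [NormedAddCommGroup E'] [NormedSpace ℝ E'] [TopologicalSpace M']
  [ChartedSpace E' M'] {k : ℕ} {F : Type*} [NormedAddCommGroup F] [NormedSpace ℝ F]

/-- An `F`-valued differential `k`-form (no regularity yet) on a manifold `M` modelled on `E`. -/
abbrev DiffForm (E M : Type*) [NormedAddCommGroup E] [NormedSpace ℝ E] [TopologicalSpace M]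
    [ChartedSpace E M] (k : ℕ) (F : Type*) [NormedAddCommGroup F] [NormedSpace ℝ F] :=
  ∀ x : M, TangentSpace 𝓘(ℝ, E) x [⋀^Fin k]→L[ℝ] F

/-- The expression of a form in the preferred chart at `x₀`: its pullback under the inverse chart. -/
def formInChart (η : DiffForm E M k F) (x₀ : M) : E → E [⋀^Fin k]→L[ℝ] F := fun y =>
  (η ((extChartAt 𝓘(ℝ, E) x₀).symm y)).compContinuousLinearMap
    (mfderiv 𝓘(ℝ, E) 𝓘(ℝ, E) (extChartAt 𝓘(ℝ, E) x₀).symm y)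

/-- A form is smooth if all its expressions in charts are. -/
def IsSmoothForm (η : DiffForm E M k F) : Prop :=
  ∀ x₀ : M, ContDiffOn ℝ ∞ (formInChart η x₀) (extChartAt 𝓘(ℝ, E) x₀).target

/-- The exterior derivative, computed at `x` in the preferred chart at `x`. -/
def extD (η : DiffForm E M k F) : DiffForm E M (k + 1) F := fun x =>
  (extDeriv (formInChart η x) (extChartAt 𝓘(ℝ, E) x x)).compContinuousLinearMap
    (mfderiv 𝓘(ℝ, E) 𝓘(ℝ, E) (extChartAt 𝓘(ℝ, E) x) x)

/-- The pullback `f^*η`. -/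
def pullbackForm (f : M → M') (η : DiffForm E' M' k F) : DiffForm E M k F := fun x =>
  (η (f x)).compContinuousLinearMap (mfderiv 𝓘(ℝ, E) 𝓘(ℝ, E') f x)

/-- The real-valued form `⟨f, A⟩` for a function `f` with values in the dual of `F` and an
`F`-valued form `A`. -/
def pairing (f : M → (F →L[ℝ] ℝ)) (A : DiffForm E M k F) : DiffForm E M k ℝ := fun x =>
  (f x).compContinuousAlternatingMap (A x)

/-- A function on a connected manifold whose differential vanishes is constant. -/
theorem const_of_mfderiv_eq_zero [ConnectedSpace M] [IsManifold 𝓘(ℝ, E) ∞ M] {f : M → ℝ}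
    (hf : ContMDiff 𝓘(ℝ, E) 𝓘(ℝ, ℝ) ∞ f)
    (h0 : ∀ x v, mfderiv 𝓘(ℝ, E) 𝓘(ℝ, ℝ) f x v = 0) (x y : M) : f x = f y := by
  have hloc : IsLocallyConstant f := by
    rw [IsLocallyConstant.iff_eventually_eq]
    intro x
    have ht : IsOpen (extChartAt 𝓘(ℝ, E) x).target := isOpen_extChartAt_target x
    obtain ⟨r, hr, hball⟩ := Metric.isOpen_iff.1 ht _ (mem_extChartAt_target (I := 𝓘(ℝ, E)) x)
    have hd : ∀ y ∈ (extChartAt 𝓘(ℝ, E) x).target,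
        HasFDerivAt (f ∘ (extChartAt 𝓘(ℝ, E) x).symm) (0 : E →L[ℝ] ℝ) y := by
      intro y hy
      have h1 : MDifferentiableAt 𝓘(ℝ, E) 𝓘(ℝ, E) (extChartAt 𝓘(ℝ, E) x).symm y :=
        ((contMDiffOn_extChartAt_symm (n := ∞) x).contMDiffAt
          (ht.mem_nhds hy)).mdifferentiableAt (by simp)
      have h2 : MDifferentiableAt 𝓘(ℝ, E) 𝓘(ℝ, ℝ) f ((extChartAt 𝓘(ℝ, E) x).symm y) :=
        (hf _).mdifferentiableAt (by simp)
      have h3 := (h2.hasMFDerivAt.comp y h1.hasMFDerivAt)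
      have h4 : HasMFDerivAt 𝓘(ℝ, E) 𝓘(ℝ, ℝ) (f ∘ (extChartAt 𝓘(ℝ, E) x).symm) y
          (0 : E →L[ℝ] ℝ) := by
        refine h3.congr_mfderiv ?_
        refine ContinuousLinearMap.ext fun v => ?_
        exact h0 _ _
      exact h4.hasFDerivAt
    have hconst : ∀ y ∈ Metric.ball (extChartAt 𝓘(ℝ, E) x x) r,
        f ((extChartAt 𝓘(ℝ, E) x).symm y) = f x := by
      intro y hy
      have := Metric.isOpen_ball.is_const_of_fderiv_eq_zero (𝕜 := ℝ)
        (convex_ball (extChartAt 𝓘(ℝ, E) x x) r).isPreconnected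
        (f := f ∘ (extChartAt 𝓘(ℝ, E) x).symm)
        (fun z hz => (hd z (hball hz)).differentiableAt.differentiableWithinAt)
        (fun z hz => (hd z (hball hz)).fderiv) hy (Metric.mem_ball_self hr)
      simpa using this
    have hcont : ContinuousAt (extChartAt 𝓘(ℝ, E) x) x := continuousAt_extChartAt x
    filter_upwards [hcont.preimage_mem_nhds (Metric.ball_mem_nhds _ hr),
      extChartAt_source_mem_nhds (I := 𝓘(ℝ, E)) x] with y hy hys
    have := hconst _ hy
    rwa [(extChartAt 𝓘(ℝ, E) x).left_inv hys] at this
  exact hloc.apply_eq_of_isPreconnected isPreconnected_univ (Set.mem_univ x) (Set.mem_univ y)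

end Forms

section Actions

variable {EG G EM M : Type*} [NormedAddCommGroup EG] [NormedSpace ℝ EG] [TopologicalSpace G]
  [ChartedSpace EG G] [Group G] [NormedAddCommGroup EM] [NormedSpace ℝ EM] [TopologicalSpace M]
  [ChartedSpace EM M] [MulAction Gᵐᵒᵖ M]

/-- `Ad_g` on the Lie algebra `𝔤 = T₁G` (in Mathlib, `T₁G` is the model space `EG`):
the derivative at `1` of `x ↦ g x g⁻¹`. -/
def Ad (g : G) : EG →L[ℝ] EG :=
  mfderiv 𝓘(ℝ, EG) 𝓘(ℝ, EG) (fun x : G => g * x * g⁻¹) 1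

/-- `Ad_g^* : 𝔤^* → 𝔤^*`, the dual map of `Ad_g`. -/
def coAd (g : G) (ν : EG →L[ℝ] ℝ) : EG →L[ℝ] ℝ := ν.comp (Ad g)

/-- The affine action `(g, ν) ↦ Ad_g^* ν + σ(g⁻¹)` of `G` on `𝔤^*` with 1-cocycle `σ`. -/
def affineAct (σ : G → (EG →L[ℝ] ℝ)) (g : G) (ν : EG →L[ℝ] ℝ) :
    EG →L[ℝ] ℝ :=
  coAd g ν + σ g⁻¹

/-- The infinitesimal action `𝔤 → T_m M`, `ξ ↦ ξ_M(m)`, of a right action: the derivative at `1` of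
`g ↦ m g`. Right actions of `G` are actions of `Gᵐᵒᵖ`, so `m g` is `op g • m`. -/
def infAct (G : Type*) [TopologicalSpace G] [ChartedSpace EG G] [Group G] [MulAction Gᵐᵒᵖ M]
    (m : M) : EG →L[ℝ] TangentSpace 𝓘(ℝ, EM) m :=
  mfderiv 𝓘(ℝ, EG) 𝓘(ℝ, EM) (fun g : G => op g • m) 1

variable (EG G EM M) in
/-- A smooth, free and proper right action of the Lie group `G` on the manifold `M`. -/
structure IsFreeProperAction : Prop where
  smooth : ContMDiff (𝓘(ℝ, EM).prod 𝓘(ℝ, EG)) 𝓘(ℝ, EM) ∞ (fun x : M × G => op x.2 • x.1)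
  free : ∀ (m : M) (g : G), op g • m = m → g = 1
  proper : ProperSMul Gᵐᵒᵖ M

/-- A principal connection on `M`, with respect to a right action of `G` on `M`: a smooth
`𝔤`-valued 1-form `A` with `Ψ_g^* A = Ad_{g⁻¹} ∘ A` and `A(ξ_M) = ξ`. -/
structure IsPrincipalConnection (G : Type*) [TopologicalSpace G] [ChartedSpace EG G] [Group G]
    [MulAction Gᵐᵒᵖ M] (A : DiffForm EM M 1 EG) : Prop where
  smooth : IsSmoothForm A
  equivariant : ∀ g : G, pullbackForm (fun m : M => op g • m) A =
    fun m => (Ad g⁻¹ : EG →L[ℝ] EG).compContinuousAlternatingMap (A m)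
  reproduces : ∀ (m : M) (ξ : EG), A m ![infAct G m ξ] = ξ

/-- Two points that are equal have equal derivatives, in model fibres. -/
theorem mfderiv_congr_pt {E M E' M' : Type*} [NormedAddCommGroup E] [NormedSpace ℝ E]
    [TopologicalSpace M] [ChartedSpace E M] [NormedAddCommGroup E'] [NormedSpace ℝ E']
    [TopologicalSpace M'] [ChartedSpace E' M'] (f : M → M') {x y : M} (h : x = y) :
    (mfderiv 𝓘(ℝ, E) 𝓘(ℝ, E') f x : E →L[ℝ] E') = mfderiv 𝓘(ℝ, E) 𝓘(ℝ, E') f y := by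
  subst h; rfl

theorem IsFreeProperAction.mdiff_act (h : IsFreeProperAction EG G EM M) (g : G) (m : M) :
    MDifferentiableAt 𝓘(ℝ, EM) 𝓘(ℝ, EM) (fun m : M => op g • m) m := by
  have h1 : ContMDiff 𝓘(ℝ, EM) (𝓘(ℝ, EM).prod 𝓘(ℝ, EG)) ∞ (fun m : M => (m, g)) :=
    contMDiff_id.prodMk contMDiff_const
  exact ((h.smooth.comp h1) m).mdifferentiableAt (by simp)

theorem IsFreeProperAction.mdiff_orbit (h : IsFreeProperAction EG G EM M) (g : G) (m : M) :
    MDifferentiableAt 𝓘(ℝ, EG) 𝓘(ℝ, EM) (fun g : G => op g • m) g := by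
  have h1 : ContMDiff 𝓘(ℝ, EG) (𝓘(ℝ, EM).prod 𝓘(ℝ, EG)) ∞ (fun g : G => (m, g)) :=
    contMDiff_const.prodMk contMDiff_id
  exact ((h.smooth.comp h1) g).mdifferentiableAt (by simp)

theorem mdiff_conj [LieGroup 𝓘(ℝ, EG) ∞ G] (g x : G) :
    MDifferentiableAt 𝓘(ℝ, EG) 𝓘(ℝ, EG) (fun x : G => g * x * g⁻¹) x := by
  have h1 : ContMDiff 𝓘(ℝ, EG) 𝓘(ℝ, EG) ∞ (fun x : G => g * x * g⁻¹) :=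
    (contMDiff_const.mul contMDiff_id).mul contMDiff_const
  exact (h1 x).mdifferentiableAt (by simp)

/-- `Ad_{gh} = Ad_g ∘ Ad_h`. -/
theorem Ad_mul [LieGroup 𝓘(ℝ, EG) ∞ G] (g h : G) :
    (Ad (g * h) : EG →L[ℝ] EG) = (Ad g).comp (Ad h) := by
  have h1 : (fun x : G => g * h * x * (g * h)⁻¹) =
      (fun x : G => g * x * g⁻¹) ∘ (fun x : G => h * x * h⁻¹) := by
    funext x; simp [mul_assoc]
  have h2 := mfderiv_comp (1 : G) (mdiff_conj (EG := EG) g (h * 1 * h⁻¹)) (mdiff_conj h 1)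
  unfold Ad
  rw [h1]
  refine h2.trans ?_
  rw [mfderiv_congr_pt (E := EG) (E' := EG) (fun x : G => g * x * g⁻¹)
    (show h * 1 * h⁻¹ = 1 by simp)]
  rfl

theorem Ad_one : (Ad (1 : G) : EG →L[ℝ] EG) = ContinuousLinearMap.id ℝ EG := by
  have h1 : (fun x : G => 1 * x * 1⁻¹) = id := by funext x; simp
  unfold Ad
  rw [h1]
  exact mfderiv_id

/-- `TΨ_g ((Ad_g ξ)_M (m)) = ξ_M (m g)`. -/
theorem mfderiv_act_infAct [LieGroup 𝓘(ℝ, EG) ∞ G] (h : IsFreeProperAction EG G EM M)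
    (g : G) (m : M) (ξ : EG) :
    mfderiv 𝓘(ℝ, EM) 𝓘(ℝ, EM) (fun m : M => op g • m) m (infAct G m (Ad g ξ)) =
      infAct G (op g • m) ξ := by
  have h1 : (fun x : G => op x • (op g • m)) =
      (fun m : M => op g • m) ∘ (fun x : G => op x • m) ∘ (fun x : G => g * x * g⁻¹) := by
    funext x
    simp [← mul_smul, ← op_mul, mul_assoc]
  have a1 := (h.mdiff_orbit (g * 1 * g⁻¹) m).hasMFDerivAt.comp (1 : G)
    (mdiff_conj (EG := EG) g 1).hasMFDerivAt
  have a2 := (h.mdiff_act g (op (g * 1 * g⁻¹) • m)).hasMFDerivAt.comp (1 : G) a1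
  have a3 := a2.mfderiv
  have a4 := congrArg (fun L : EG →L[ℝ] EM => L ξ) (a3)
  have e1 := mfderiv_congr_pt (E := EM) (E' := EM) (fun m : M => op g • m)
    (show op (g * 1 * g⁻¹) • m = m by simp)
  have e2 := mfderiv_congr_pt (E := EG) (E' := EM) (fun x : G => op x • m)
    (show g * 1 * g⁻¹ = 1 by simp)
  unfold infAct Ad
  rw [h1]
  refine Eq.trans ?_ a4.symm
  exact congrArg₂ (fun (L : EM →L[ℝ] EM) (L' : EG →L[ℝ] EM) =>
    L (L' (mfderiv 𝓘(ℝ, EG) 𝓘(ℝ, EG) (fun x : G => g * x * g⁻¹) 1 ξ))) e1.symm e2.symm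

end Actions


section Quotients

variable {E H M : Type*} [NormedAddCommGroup E] [NormedSpace ℝ E] [TopologicalSpace H]
  [TopologicalSpace M] [ChartedSpace H M]

/-- A quotient manifold structure on the topological quotient of a manifold `M` by an equivalence
relation: a smooth structure for which the projection is a submersion. -/
structure QuotientManifold (I : ModelWithCorners ℝ E H) (s : Setoid M) where
  dim : ℕ
  charted : ChartedSpace (EuclideanSpace ℝ (Fin dim)) (Quotient s)
  isManifold : IsManifold (𝓡 dim) ∞ (Quotient s)
  isSubmersion : Manifold.IsSubmersion I (𝓡 dim) ∞ (Quotient.mk s)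

attribute [instance] QuotientManifold.charted QuotientManifold.isManifold

/-- An embedded submanifold structure on a subset `S` of a manifold, with its induced topology. -/
structure SubmanifoldStructure (I : ModelWithCorners ℝ E H) (S : Set M) where
  dim : ℕ
  charted : ChartedSpace (EuclideanSpace ℝ (Fin dim)) S
  isManifold : IsManifold (𝓡 dim) ∞ S
  isSmoothEmbedding : Manifold.IsSmoothEmbedding (𝓡 dim) I ∞ (Subtype.val : S → M)

attribute [instance] SubmanifoldStructure.charted SubmanifoldStructure.isManifold

end Quotients

section PullbackCotangent

/-- The pullback `T^*_N B = T^*B ×_B N` of the cotangent bundle of `B` along `f : N → B`; its points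
`x` consist of `x.proj : N` and a covector `x.snd` at `f x.proj`. -/
abbrev PullbackCotangent (EB : Type*) {B N K : Type*} [NormedAddCommGroup EB] [NormedSpace ℝ EB]
    [TopologicalSpace B] [ChartedSpace EB B] [FunLike K N B] (f : K) : Type _ :=
  TotalSpace (EB →L[ℝ] ℝ)
    ((f : N → B) *ᵖ (fun b : B => TangentSpace 𝓘(ℝ, EB) b →L[ℝ] Trivial B ℝ b))

variable {EB B N K : Type*} [NormedAddCommGroup EB] [NormedSpace ℝ EB] [TopologicalSpace B]
  [ChartedSpace EB B] [FunLike K N B] {f : K}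

/-- The covector part of a point of `T^*_N B`. -/
def PullbackCotangent.covector (x : PullbackCotangent EB f) :
    TangentSpace 𝓘(ℝ, EB) (f x.proj) →L[ℝ] ℝ := x.snd

/-- The point `(α, n)` of `T^*_N B`. -/
def PullbackCotangent.mk (n : N) (α : TangentSpace 𝓘(ℝ, EB) (f n) →L[ℝ] ℝ) :
    PullbackCotangent EB f := ⟨n, α⟩

theorem PullbackCotangent.mk_congr {n n' : N} (h : n = n')
    {α : TangentSpace 𝓘(ℝ, EB) (f n) →L[ℝ] ℝ} {α' : TangentSpace 𝓘(ℝ, EB) (f n') →L[ℝ] ℝ}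
    (hα : @Eq (EB →L[ℝ] ℝ) α α') : PullbackCotangent.mk n α = PullbackCotangent.mk n' α' := by
  subst h
  exact congrArg (PullbackCotangent.mk n) hα

end PullbackCotangent

/-- The magnetic data of an invariant system: the Lie group `G` acts freely and properly from the
right on `P` and `Q`, `ε : P → Q` is smooth and equivariant, `B` is a smooth closed `G`-invariant
2-form on `P` (the magnetic form), and `δ : P → 𝔤^*` is a smooth `B𝔤`-potential:
`i_{ξ_P} B = d⟨δ, ξ⟩` for all `ξ ∈ 𝔤`.
Neither a Lagrangian nor the local triviality of `ε` nor the nondegeneracy of `B` along the fibres of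
`ε` is required. -/
structure MagneticSystem (EG G EP P EQ Q : Type*)
    [NormedAddCommGroup EG] [NormedSpace ℝ EG] [TopologicalSpace G] [ChartedSpace EG G] [Group G]
    [NormedAddCommGroup EP] [NormedSpace ℝ EP] [TopologicalSpace P] [ChartedSpace EP P]
    [NormedAddCommGroup EQ] [NormedSpace ℝ EQ] [TopologicalSpace Q] [ChartedSpace EQ Q]
    [MulAction Gᵐᵒᵖ P] [MulAction Gᵐᵒᵖ Q] where
  actP : IsFreeProperAction EG G EP P
  actQ : IsFreeProperAction EG G EQ Q
  ε : C^∞⟮𝓘(ℝ, EP), P; 𝓘(ℝ, EQ), Q⟯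
  ε_equivariant : ∀ (g : G) (p : P), ε (op g • p) = op g • ε p
  B : DiffForm EP P 2 ℝ
  B_smooth : IsSmoothForm B
  B_closed : extD B = 0
  B_invariant : ∀ g : G, pullbackForm (fun p : P => op g • p) B = B
  δ : P → (EG →L[ℝ] ℝ)
  δ_smooth : ContMDiff 𝓘(ℝ, EP) 𝓘(ℝ, EG →L[ℝ] ℝ) ∞ δ
  δ_potential : ∀ (ξ : EG) (p : P) (v : TangentSpace 𝓘(ℝ, EP) p),
    B p ![infAct G p ξ, v] = mfderiv 𝓘(ℝ, EP) 𝓘(ℝ, ℝ) (fun p' => δ p' ξ) p v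

namespace MagneticSystem

variable {EG G EP P EQ Q : Type*}
    [NormedAddCommGroup EG] [NormedSpace ℝ EG] [TopologicalSpace G] [ChartedSpace EG G] [Group G]
    [NormedAddCommGroup EP] [NormedSpace ℝ EP] [TopologicalSpace P] [ChartedSpace EP P]
    [NormedAddCommGroup EQ] [NormedSpace ℝ EQ] [TopologicalSpace Q] [ChartedSpace EQ Q]
    [MulAction Gᵐᵒᵖ P] [MulAction Gᵐᵒᵖ Q] (S : MagneticSystem EG G EP P EQ Q)

/-- The fibred product `T^*_P Q = T^*Q ×_Q P`, with points `(α_q, p)`, `q = ε(p)`. -/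
abbrev TPQ : Type _ := PullbackCotangent EQ S.ε

/-- The momentum map `J_δ : T^*_P Q → 𝔤^*`, `⟨J_δ(α_q, p), ξ⟩ = ⟨α_q, ξ_Q(q)⟩ - ⟨δ(p), ξ⟩`. -/
def J (x : S.TPQ) : EG →L[ℝ] ℝ :=
  (PullbackCotangent.covector x).comp (infAct G (S.ε x.proj)) - S.δ x.proj

/-- For fixed `g`, the element `δ(pg) - Ad_g^* δ(p)` of `𝔤^*` does not depend on `p`. -/
theorem potential_const [ConnectedSpace P] [IsManifold 𝓘(ℝ, EP) ∞ P] [LieGroup 𝓘(ℝ, EG) ∞ G]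
    (g : G) (p p' : P) :
    S.δ (op g • p) - coAd g (S.δ p) = S.δ (op g • p') - coAd g (S.δ p') := by
  refine ContinuousLinearMap.ext fun ξ => ?_
  have hact : ContMDiff 𝓘(ℝ, EP) 𝓘(ℝ, EP) ∞ (fun p : P => op g • p) := by
    have h1 : ContMDiff 𝓘(ℝ, EP) (𝓘(ℝ, EP).prod 𝓘(ℝ, EG)) ∞ (fun m : P => (m, g)) :=
      contMDiff_id.prodMk contMDiff_const
    exact S.actP.smooth.comp h1
  have hδ : ∀ ζ : EG, ContMDiff 𝓘(ℝ, EP) 𝓘(ℝ, ℝ) ∞ (fun p => S.δ p ζ) := fun ζ =>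
    S.δ_smooth.clm_apply contMDiff_const
  have hF : ContMDiff 𝓘(ℝ, EP) 𝓘(ℝ, ℝ) ∞
      (fun p => S.δ (op g • p) ξ - S.δ p (Ad g ξ)) :=
    ((hδ ξ).comp hact).sub (hδ (Ad g ξ))
  refine const_of_mfderiv_eq_zero hF (fun x v => ?_) p p'
  have d1 := ((hδ ξ (op g • x)).mdifferentiableAt (by simp)).hasMFDerivAt.comp x
    (S.actP.mdiff_act g x).hasMFDerivAt
  have d2 := ((hδ (Ad g ξ) x).mdifferentiableAt (by simp)).hasMFDerivAt
  have d3 := (d1.sub d2).mfderiv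
  have d4 := congrArg (fun L : EP →L[ℝ] ℝ => L v) d3
  refine d4.trans ?_
  have b1 := S.δ_potential ξ (op g • x)
    (mfderiv 𝓘(ℝ, EP) 𝓘(ℝ, EP) (fun p : P => op g • p) x v)
  have b2 := S.δ_potential (Ad g ξ) x v
  have b3 := congrArg (fun L : EP [⋀^Fin 2]→L[ℝ] ℝ => L ![infAct G x (Ad g ξ), v])
    (congrFun (S.B_invariant g) x)
  have b4 : S.B (op g • x) ![infAct G (op g • x) ξ,
      mfderiv 𝓘(ℝ, EP) 𝓘(ℝ, EP) (fun p : P => op g • p) x v] =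
      S.B x ![infAct G x (Ad g ξ), v] := by
    refine Eq.trans ?_ b3
    refine congrArg (S.B (op g • x)) ?_
    funext i
    fin_cases i
    · exact (mfderiv_act_infAct S.actP g x ξ).symm
    · rfl
  exact sub_eq_zero.2 (b1.symm.trans (b4.trans b2))

/-- The 1-cocycle `σ_δ : G → 𝔤^*`, `g ↦ δ(p g⁻¹) - Ad_{g⁻¹}^* δ(p)` with `p ∈ P` arbitrary. -/
def cocycle [Nonempty P] (g : G) : EG →L[ℝ] ℝ :=
  S.δ (op g⁻¹ • Classical.arbitrary P) - coAd g⁻¹ (S.δ (Classical.arbitrary P))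

theorem affineAct_eq_iff [ConnectedSpace P] [IsManifold 𝓘(ℝ, EP) ∞ P] [LieGroup 𝓘(ℝ, EG) ∞ G]
    (μ : EG →L[ℝ] ℝ) (g : G) (p : P) :
    affineAct (-S.cocycle) g μ = μ ↔ μ + S.δ (op g • p) = coAd g (μ + S.δ p) := by
  have h := S.potential_const g (Classical.arbitrary P) p
  have hadd : coAd g (μ + S.δ p) = coAd g μ + coAd g (S.δ p) :=
    ContinuousLinearMap.add_comp _ _ _
  have : affineAct (-S.cocycle) g μ = coAd g μ - (S.δ (op g • p) - coAd g (S.δ p)) := by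
    rw [← h]
    simp [affineAct, cocycle, sub_eq_add_neg]
  rw [this, hadd]
  constructor
  · intro h'
    nth_rewrite 1 [← h']
    abel
  · intro h'
    refine Eq.trans ?_ (eq_sub_of_add_eq h').symm
    abel

/-- The isotropy group `G_μ` of `μ` for the affine action with 1-cocycle `-σ_δ`, the
non-equivariance cocycle of the momentum map `J_δ`. -/
def isotropy [ConnectedSpace P] [IsManifold 𝓘(ℝ, EP) ∞ P] [LieGroup 𝓘(ℝ, EG) ∞ G]
    (μ : EG →L[ℝ] ℝ) : Subgroup G where
  carrier := {g | affineAct (-S.cocycle) g μ = μ}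
  one_mem' := by
    refine (S.affineAct_eq_iff μ 1 (Classical.arbitrary P)).2 ?_
    simp [coAd, Ad_one]
  mul_mem' := by
    intro g h hg hh
    have p : P := Classical.arbitrary P
    refine (S.affineAct_eq_iff μ _ p).2 ?_
    have hg' := (S.affineAct_eq_iff μ g p).1 hg
    have hh' := (S.affineAct_eq_iff μ h (op g • p)).1 hh
    rw [op_mul, mul_smul, hh', hg']
    simp only [coAd]
    rw [Ad_mul]
    rfl
  inv_mem' := by
    intro g hg
    have p : P := Classical.arbitrary P
    refine (S.affineAct_eq_iff μ _ p).2 ?_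
    have hg' := (S.affineAct_eq_iff μ g (op g⁻¹ • p)).1 hg
    rw [← mul_smul, ← op_mul, inv_mul_cancel, op_one, one_smul] at hg'
    rw [hg']
    simp only [coAd]
    rw [ContinuousLinearMap.comp_assoc, ← Ad_mul, mul_inv_cancel, Ad_one,
      ContinuousLinearMap.comp_id]

/-- The lifted right action on `T^*_P Q`: `(α_q, p) g = (T^*Ψ_{g⁻¹}(α_q), p g)`. -/
def lift (g : G) (x : S.TPQ) : S.TPQ :=
  PullbackCotangent.mk (op g • x.proj)
    (ContinuousLinearMap.comp (PullbackCotangent.covector x : EQ →L[ℝ] ℝ)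
      (mfderiv 𝓘(ℝ, EQ) 𝓘(ℝ, EQ) (fun q : Q => op g⁻¹ • q) (S.ε (op g • x.proj))))

theorem lift_one (x : S.TPQ) : S.lift 1 x = x := by
  refine PullbackCotangent.mk_congr (by simp) ?_ (α' := PullbackCotangent.covector x)
  have h1 : (fun q : Q => op (1 : G)⁻¹ • q) = id := by funext q; simp
  rw [h1]
  have h2 := mfderiv_id (I := 𝓘(ℝ, EQ)) (x := S.ε (op (1 : G) • x.proj))
  exact congrArg (fun L : EQ →L[ℝ] EQ => (PullbackCotangent.covector x : EQ →L[ℝ] ℝ).comp L) h2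

theorem lift_mul (g h : G) (x : S.TPQ) : S.lift h (S.lift g x) = S.lift (g * h) x := by
  refine PullbackCotangent.mk_congr (by simp [lift, PullbackCotangent.mk, mul_smul]) ?_
  have h1 : (fun q : Q => op (g * h)⁻¹ • q) =
      (fun q : Q => op g⁻¹ • q) ∘ (fun q : Q => op h⁻¹ • q) := by
    funext q; simp [mul_smul]
  have e1 : op h⁻¹ • S.ε (op (g * h) • x.proj) = S.ε (op g • x.proj) := by
    rw [op_mul, mul_smul, S.ε_equivariant, ← mul_smul, ← op_mul, mul_inv_cancel, op_one, one_smul]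
  have a := ((S.actQ.mdiff_act g⁻¹ _).hasMFDerivAt.comp (S.ε (op (g * h) • x.proj))
    (S.actQ.mdiff_act h⁻¹ _).hasMFDerivAt).mfderiv
  have e2 := mfderiv_congr_pt (E := EQ) (E' := EQ) (fun q : Q => op g⁻¹ • q) e1
  have e3 := mfderiv_congr_pt (E := EQ) (E' := EQ) (fun q : Q => op h⁻¹ • q)
    (show S.ε (op h • op g • x.proj) = S.ε (op (g * h) • x.proj) by rw [op_mul, mul_smul])
  rw [h1]
  refine Eq.trans ?_ (congrArg (fun L : EQ →L[ℝ] EQ => (PullbackCotangent.covector x : EQ →L[ℝ] ℝ).comp L) a).symm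
  exact congrArg₂ (fun L L' : EQ →L[ℝ] EQ => ((PullbackCotangent.covector x : EQ →L[ℝ] ℝ).comp L).comp L')
    e2.symm e3

/-- The level set `J_δ⁻¹(μ)`. -/
def level (μ : EG →L[ℝ] ℝ) : Set S.TPQ := {x | S.J x = μ}

section

variable [ConnectedSpace P] [IsManifold 𝓘(ℝ, EP) ∞ P] [LieGroup 𝓘(ℝ, EG) ∞ G]

/-- The orbit relation of `G_μ` on `J_δ⁻¹(μ)`. -/
def levelOrbits (μ : EG →L[ℝ] ℝ) : Setoid (S.level μ) where
  r x y := ∃ g ∈ S.isotropy μ, S.lift g x = y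
  iseqv :=
    { refl := fun x => ⟨1, one_mem _, S.lift_one x⟩
      symm := by
        rintro x y ⟨g, hg, hxy⟩
        exact ⟨g⁻¹, inv_mem hg, by rw [← hxy, lift_mul, mul_inv_cancel, lift_one]⟩
      trans := by
        rintro x y z ⟨g, hg, hxy⟩ ⟨h, hh, hyz⟩
        exact ⟨g * h, mul_mem hg hh, by rw [← hyz, ← hxy, lift_mul]⟩ }

/-- The orbit relation of `G_μ` on `P`. -/
abbrev orbitsP (μ : EG →L[ℝ] ℝ) : Setoid P := MulAction.orbitRel (S.isotropy μ).op P

/-- The map `P/G_μ → Q/G` induced by `ε`. -/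
def reducedε (μ : EG →L[ℝ] ℝ) :
    C(Quotient (S.orbitsP μ), Quotient (MulAction.orbitRel Gᵐᵒᵖ Q)) where
  toFun := Quotient.map S.ε (by
    rintro _ p ⟨⟨g, hg⟩, rfl⟩
    exact ⟨g, (S.ε_equivariant g.unop p).symm⟩)
  continuous_toFun := S.ε.contMDiff.continuous.quotient_map' _

end

/-- The 1-form `⟨μ + δ, ε^*A⟩` on `P`, for a `𝔤`-valued 1-form `A` on `Q`. -/
def potentialForm (A : DiffForm EQ Q 1 EG) (μ : EG →L[ℝ] ℝ) : DiffForm EP P 1 ℝ :=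
  pairing (fun p => μ + S.δ p) (pullbackForm S.ε A)

/-- The shift map `(α_q, p) ↦ (α_q - ⟨μ + δ(p), A(q)⟩, p)`. -/
def shift (A : DiffForm EQ Q 1 EG) (μ : EG →L[ℝ] ℝ) (x : S.TPQ) : S.TPQ :=
  PullbackCotangent.mk x.proj
    (PullbackCotangent.covector x - (μ + S.δ x.proj).comp
      ((ContinuousAlternatingMap.ofSubsingleton ℝ _ EG (0 : Fin 1)).symm (A (S.ε x.proj))))

end MagneticSystem

end MagneticReduction

end

open MagneticReduction

/-! Everything about `G_μ` is governed by one map, `orbitMap`: κ(g) = Ad*_{g⁻¹}(μ + δ(pg)) − δ(p).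
Since B is invariant and i_{ξ_P}B = d⟨δ,ξ⟩, the difference δ(pg) − Ad*_g δ(p) has zero differential
in p, hence is constant on the connected manifold P. So κ does not depend on p, its fibre over κ(1)
= μ is `G_μ`, and κ(gh) = Ad*_{g⁻¹}κ(h) + c(g). The pullback of ⟨μ + δ, A^P⟩ by Ψ_g is the same form
with μ replaced by κ(g) (`pullbackForm_potentialForm`); this gives 3 and the invariance in 4.

Quotients. No manifold structure on `G_μ` is used. The affine equivariance makes κ a map of constant
rank, so locally its fibres are the fibres of a submersion. A free proper action has local slices,
with a transversal coordinate and a group coordinate g on which the group acts by right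
multiplication. The transversal coordinate, together with a suitable projection of κ(g), is then a
submersion that separates the `G_μ`-orbits (`exists_separating_submersion`). This yields the
manifold P/G_μ, with vertical vectors ξ_P for T₁κ(ξ) = 0. Constant κ gives Q/G.

Descent of the magnetic form. On G × P the two partial derivatives of the pulled back potential form
give i_{ξ_P} d⟨μ + δ, A^P⟩ = ⟨T₁κ(ξ), A^P⟩ − i_{ξ_P}B (`extD_potentialForm_infActL`). Hence B + d⟨μ
+ δ, A^P⟩ annihilates ξ_P whenever T₁κ(ξ) = 0. Being also invariant, it is basic, and local sections
show that the descended form is smooth.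

Reduction. The equation J_δ(α, p) = μ says that α − ⟨μ + δ(p), A⟩ vanishes on the vertical space of
Q → Q/G, so that it comes from a unique covector on Q/G. The shift is `G_μ`-equivariant by 1 and the
equivariance of A; therefore the induced map from the level set to T*(Q/G) ×_{Q/G} P/G_μ has exactly
the `G_μ`-orbits as fibres. Its local sections are explicit: pull the covector back to Q and add ⟨μ
+ δ(p), A⟩, with p given by a local section of P → P/G_μ. A smooth surjection with smooth local
sections turns the orbit space into a manifold and induces a diffeomorphism from it. -/

noncomputable section

namespace MagneticReduction

/-! ### The inverse function theorem. -/

section InverseFunction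

variable {E E' F : Type*} [NormedAddCommGroup E] [NormedSpace ℝ E] [NormedAddCommGroup E']
  [NormedSpace ℝ E'] [NormedAddCommGroup F] [NormedSpace ℝ F]

/-- The inverse function theorem, with smoothness of the inverse on its whole domain. -/
theorem exists_openPartialHomeomorph_of_fderiv [FiniteDimensional ℝ E] [FiniteDimensional ℝ E']
    {g : E → E'} {a : E} (hg : ∀ᶠ z in 𝓝 a, ContDiffAt ℝ ∞ g z)
    (hb : Function.Bijective (fderiv ℝ g a)) :
    ∃ e : OpenPartialHomeomorph E E', a ∈ e.source ∧ (∀ z, e z = g z) ∧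
      (∀ z ∈ e.source, ContDiffAt ℝ ∞ g z ∧ Function.Bijective (fderiv ℝ g z)) ∧
      ∀ w ∈ e.target, ContDiffAt ℝ ∞ e.symm w := by
  have : CompleteSpace E := FiniteDimensional.complete ℝ E
  let L : E ≃L[ℝ] E' := (LinearEquiv.ofBijective (fderiv ℝ g a).toLinearMap hb).toContinuousLinearEquiv
  have hL : (L : E →L[ℝ] E') = fderiv ℝ g a := by ext v; rfl
  have ha := hg.self_of_nhds
  have hd : HasFDerivAt g (L : E →L[ℝ] E') a := by
    rw [hL]; exact (ha.differentiableAt (by simp)).hasFDerivAt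
  have hc : ContinuousAt (fderiv ℝ g) a :=
    (ha.fderiv_right (m := 0) (by simp)).continuousAt
  -- Smoothness and invertibility of the derivative hold on an open set around `a`; restricting the
  -- local inverse to it makes the inverse smooth at every point of its domain, not only at `g a`.
  have hinv : ∀ᶠ z in 𝓝 a, ContDiffAt ℝ ∞ g z ∧ ∃ L' : E ≃L[ℝ] E', (L' : E →L[ℝ] E') = fderiv ℝ g z := by
    refine hg.and ?_
    have := ContinuousLinearEquiv.nhds L
    rw [hL] at this
    exact hc this
  obtain ⟨O, hO, hOo, haO⟩ := eventually_nhds_iff.1 hinv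
  let e := (ha.toOpenPartialHomeomorph g hd (by simp)).restrOpen O hOo
  have hcoe : ∀ z, e z = g z := fun z => rfl
  refine ⟨e, ⟨ha.mem_toOpenPartialHomeomorph_source hd (by simp), haO⟩, hcoe, fun z hz => ?_, fun w hw => ?_⟩
  · obtain ⟨h1, L', h2⟩ := hO z hz.2
    exact ⟨h1, h2 ▸ L'.bijective⟩
  · obtain ⟨h1, L', h2⟩ := hO (e.symm w) (e.map_target hw).2
    refine e.contDiffAt_symm (f₀' := L') hw ?_ h1
    rw [h2]
    exact (h1.differentiableAt (by simp)).hasFDerivAt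

end InverseFunction

/-! ### Derivatives in model spaces, and charts from maps with invertible derivative. -/

section ManifoldDerivative

variable {E H M E' H' M' E'' H'' M'' : Type*} [NormedAddCommGroup E] [NormedSpace ℝ E]
  [TopologicalSpace H] [TopologicalSpace M] [ChartedSpace H M] [NormedAddCommGroup E']
  [NormedSpace ℝ E'] [TopologicalSpace H'] [TopologicalSpace M'] [ChartedSpace H' M']
  [NormedAddCommGroup E''] [NormedSpace ℝ E''] [TopologicalSpace H''] [TopologicalSpace M'']
  [ChartedSpace H'' M'']
  {I : ModelWithCorners ℝ E H} {I' : ModelWithCorners ℝ E' H'} {I'' : ModelWithCorners ℝ E'' H''}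

variable (I I') in
/-- The derivative of a map between manifolds, as a linear map between the model spaces. -/
def mder (f : M → M') (x : M) : E →L[ℝ] E' := mfderiv I I' f x

theorem mder_comp {g : M' → M''} {f : M → M'} {x : M} (hg : MDifferentiableAt I' I'' g (f x))
    (hf : MDifferentiableAt I I' f x) :
    mder I I'' (g ∘ f) x = (mder I' I'' g (f x)).comp (mder I I' f x) :=
  mfderiv_comp x hg hf

theorem mder_congr {f f' : M → M'} {x : M} (h : f =ᶠ[𝓝 x] f') :
    mder I I' f x = mder I I' f' x :=
  h.mfderiv_eq

theorem mder_id (x : M) : mder I I (id : M → M) x = ContinuousLinearMap.id ℝ E := mfderiv_id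

theorem mder_const (c : M') (x : M) : mder I I' (fun _ : M => c) x = 0 := mfderiv_const

theorem mder_eq_fderiv {f : E → E'} {x : E} : mder 𝓘(ℝ, E) 𝓘(ℝ, E') f x = fderiv ℝ f x :=
  mfderiv_eq_fderiv

theorem mder_extChartAt_self [IsManifold I ∞ M] (x : M) :
    mder I 𝓘(ℝ, E) (extChartAt I x) x = ContinuousLinearMap.id ℝ E := by
  have : IsManifold I 1 M := .of_le (n := ∞) (by simp)
  exact mfderiv_extChartAt_self

theorem mder_extChartAt_symm_self [IsManifold I ∞ M] [I.Boundaryless] (x : M) :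
    mder 𝓘(ℝ, E) I (extChartAt I x).symm (extChartAt I x x) = ContinuousLinearMap.id ℝ E := by
  have : IsManifold I 1 M := .of_le (n := ∞) (by simp)
  have := mfderivWithin_range_extChartAt_symm (I := I) (x := x)
  rwa [I.range_eq_univ, mfderivWithin_univ] at this

theorem contMDiffAt_extChartAt_symm_of_mem [IsManifold I ∞ M] [I.Boundaryless] (x : M) {y : E}
    (hy : y ∈ (extChartAt I x).target) : ContMDiffAt 𝓘(ℝ, E) I ∞ (extChartAt I x).symm y :=
  (contMDiffOn_extChartAt_symm x).contMDiffAt ((isOpen_extChartAt_target x).mem_nhds hy)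

theorem contMDiffAt_extChartAt_of_mem [IsManifold I ∞ M] (x : M) {y : M}
    (hy : y ∈ (extChartAt I x).source) : ContMDiffAt I 𝓘(ℝ, E) ∞ (extChartAt I x) y := by
  rw [extChartAt_source] at hy
  exact contMDiffAt_extChartAt' hy

theorem mder_symm_comp_mder_extChartAt [IsManifold I ∞ M] [I.Boundaryless] (x : M) {y : M}
    (hy : y ∈ (extChartAt I x).source) :
    (mder 𝓘(ℝ, E) I (extChartAt I x).symm (extChartAt I x y)).comp
      (mder I 𝓘(ℝ, E) (extChartAt I x) y) = ContinuousLinearMap.id ℝ E := by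
  rw [← mder_id (I := I) y, ← mder_comp]
  · refine mder_congr ?_
    filter_upwards [(isOpen_extChartAt_source (I := I) x).mem_nhds hy] with z hz
    exact (extChartAt I x).left_inv hz
  · exact (contMDiffAt_extChartAt_symm_of_mem x ((extChartAt I x).map_source hy)).mdifferentiableAt
      (by simp)
  · exact (contMDiffAt_extChartAt_of_mem x hy).mdifferentiableAt (by simp)

/-- The preferred chart of a manifold without boundary, with values in the model vector space. -/
def vectorChart (I : ModelWithCorners ℝ E H) [I.Boundaryless] (x : M) :
    OpenPartialHomeomorph M E :=
  (chartAt H x).trans I.toHomeomorph.toOpenPartialHomeomorph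

theorem vectorChart_toPartialEquiv [I.Boundaryless] (x : M) :
    (vectorChart I x).toPartialEquiv = extChartAt I x := by
  ext y
  · rfl
  · rfl
  · simp [vectorChart]

theorem vectorChart_source [I.Boundaryless] (x : M) :
    (vectorChart I x).source = (extChartAt I x).source :=
  congrArg PartialEquiv.source (vectorChart_toPartialEquiv x)

theorem vectorChart_target [I.Boundaryless] (x : M) :
    (vectorChart I x).target = (extChartAt I x).target :=
  congrArg PartialEquiv.target (vectorChart_toPartialEquiv x)

theorem mem_vectorChart_source [I.Boundaryless] (x : M) : x ∈ (vectorChart I x).source := by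
  rw [vectorChart_source]; exact mem_extChartAt_source x

/-- A smooth map to a vector space with bijective derivative is locally a chart. -/
theorem exists_openPartialHomeomorph_of_mder [FiniteDimensional ℝ E] [FiniteDimensional ℝ E']
    [IsManifold I ∞ M] [I.Boundaryless] {f : M → E'} {x : M}
    (hf : ∀ᶠ y in 𝓝 x, ContMDiffAt I 𝓘(ℝ, E') ∞ f y)
    (hb : Function.Bijective (mder I 𝓘(ℝ, E') f x)) :
    ∃ e : OpenPartialHomeomorph M E', x ∈ e.source ∧ (∀ y, y ∈ e.source → e y = f y) ∧
      ContMDiffOn I 𝓘(ℝ, E') ∞ e e.source ∧ ContMDiffOn 𝓘(ℝ, E') I ∞ e.symm e.target := by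
  set a := extChartAt I x x with ha
  set g : E → E' := f ∘ (extChartAt I x).symm with hgdef
  have hsa : (extChartAt I x).symm a = x := extChartAt_to_inv x
  have hat : a ∈ (extChartAt I x).target := mem_extChartAt_target x
  have hcs := contMDiffAt_extChartAt_symm_of_mem x hat
  have hg : ∀ᶠ z in 𝓝 a, ContDiffAt ℝ ∞ g z := by
    have h1 : ∀ᶠ z in 𝓝 a, ContMDiffAt I 𝓘(ℝ, E') ∞ f ((extChartAt I x).symm z) := by
      refine hcs.continuousAt.eventually ?_
      rw [hsa]; exact hf
    filter_upwards [h1, (isOpen_extChartAt_target (I := I) x).mem_nhds hat] with z hz1 hz2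
    exact (hz1.comp z (contMDiffAt_extChartAt_symm_of_mem x hz2)).contDiffAt
  have hd : fderiv ℝ g a = mder I 𝓘(ℝ, E') f x := by
    have hfa : MDifferentiableAt I 𝓘(ℝ, E') f ((extChartAt I x).symm a) := by
      rw [hsa]; exact hf.self_of_nhds.mdifferentiableAt (by simp)
    rw [← mder_eq_fderiv, hgdef, mder_comp hfa (hcs.mdifferentiableAt (by simp)),
      mder_extChartAt_symm_self, hsa]
    rfl
  obtain ⟨e0, h0, hcoe, hs, ht⟩ := exists_openPartialHomeomorph_of_fderiv hg (hd ▸ hb)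
  let e := (vectorChart I x).trans e0
  have hes : ∀ y ∈ e.source, y ∈ (extChartAt I x).source ∧ extChartAt I x y ∈ e0.source := by
    intro y hy
    have : y ∈ (vectorChart I x).source ∧ vectorChart I x y ∈ e0.source := by
      simpa [e, OpenPartialHomeomorph.trans_source] using hy
    rw [vectorChart_source] at this
    exact this
  have hey : ∀ y, e y = e0 (extChartAt I x y) := fun y => rfl
  refine ⟨e, ?_, ?_, ?_, ?_⟩
  · have : x ∈ (vectorChart I x).source ∧ vectorChart I x x ∈ e0.source :=
      ⟨mem_vectorChart_source x, h0⟩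
    simpa [e, OpenPartialHomeomorph.trans_source] using this
  · intro y hy
    rw [hey, hcoe, hgdef]
    exact congrArg f ((extChartAt I x).left_inv (hes y hy).1)
  · intro y hy
    refine ContMDiffAt.contMDiffWithinAt ?_
    have : (e : M → E') = g ∘ extChartAt I x := by funext y; rw [hey, hcoe]; rfl
    rw [this]
    exact ((hs _ (hes y hy).2).1.contMDiffAt).comp y (contMDiffAt_extChartAt_of_mem x (hes y hy).1)
  · intro w hw
    refine ContMDiffAt.contMDiffWithinAt ?_
    have hw' : w ∈ e0.target ∧ e0.symm w ∈ (extChartAt I x).target := by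
      rw [← vectorChart_target]
      simpa [e, OpenPartialHomeomorph.trans_target] using hw
    have : (e.symm : E' → M) = (extChartAt I x).symm ∘ e0.symm := by funext w; rfl
    rw [this]
    exact (contMDiffAt_extChartAt_symm_of_mem x hw'.2).comp w (ht w hw'.1).contMDiffAt

/-- A smooth chart with values in a vector space isomorphic to the model space belongs, after
identification, to the maximal atlas. -/
theorem trans_mem_maximalAtlas [IsManifold I ∞ M] [I.Boundaryless] (e : OpenPartialHomeomorph M E')
    (he : ContMDiffOn I 𝓘(ℝ, E') ∞ e e.source) (he' : ContMDiffOn 𝓘(ℝ, E') I ∞ e.symm e.target)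
    (L : E' ≃L[ℝ] E) :
    (e.trans (L.toHomeomorph.trans I.toHomeomorph.symm).toOpenPartialHomeomorph) ∈
      IsManifold.maximalAtlas I ∞ M := by
  have hIs : ContMDiff 𝓘(ℝ, E) I ∞ I.symm := by
    have := I.contMDiffOn_symm (n := ∞)
    rwa [I.range_eq_univ, contMDiffOn_univ] at this
  refine OpenPartialHomeomorph.mem_maximalAtlas_of_contMDiffOn _ ?_ ?_
  · refine ((hIs.comp L.contDiff.contMDiff).comp_contMDiffOn he).mono ?_
    intro y hy
    simpa using hy
  · refine he'.comp (t := e.target) (L.symm.contDiff.contMDiff.comp I.contMDiff).contMDiffOn ?_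
    intro w hw
    simpa [OpenPartialHomeomorph.trans_target] using hw

end ManifoldDerivative

/-! ### The constant rank theorem. -/

section ConstantRank

variable {E V : Type*} [NormedAddCommGroup E] [NormedSpace ℝ E] [FiniteDimensional ℝ E]
  [NormedAddCommGroup V] [NormedSpace ℝ V] [FiniteDimensional ℝ V]

/-- `L` maps the range of `T` onto a space of the same dimension, hence is injective there. In the
constant rank theorem this is what transfers information from the projection `L ∘ f` back to `f` at
nearby points. -/
theorem injOn_range_of_surjective_comp {E V W : Type*} [NormedAddCommGroup E] [NormedSpace ℝ E]
    [NormedAddCommGroup V] [NormedSpace ℝ V] [FiniteDimensional ℝ E] [NormedAddCommGroup W]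
    [NormedSpace ℝ W] [FiniteDimensional ℝ W] (L : V →L[ℝ] W) (T : E →L[ℝ] V)
    (hs : Function.Surjective (L.comp T))
    (hr : Module.finrank ℝ (LinearMap.range T.toLinearMap) = Module.finrank ℝ W) (v : E)
    (hv : L (T v) = 0) : T v = 0 := by
  let L' : LinearMap.range T.toLinearMap →ₗ[ℝ] W :=
    L.toLinearMap.comp (LinearMap.range T.toLinearMap).subtype
  have h1 : Function.Surjective L' := fun w => by
    obtain ⟨u, hu⟩ := hs w
    exact ⟨⟨T u, u, rfl⟩, hu⟩
  have h2 : Function.Injective L' := (LinearMap.injective_iff_surjective_of_finrank_eq_finrank hr).2 h1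
  have h3 : (⟨T v, v, rfl⟩ : LinearMap.range T.toLinearMap) = 0 := h2 (by rw [map_zero]; exact hv)
  exact congrArg Subtype.val h3

/-- The constant rank theorem: locally, the fibres of a map of constant rank are the fibres of a
submersion, obtained by projecting to the range of the derivative. -/
theorem exists_projection_of_finrank_range_eq {f : E → V} {x : E}
    (hf : ∀ᶠ y in 𝓝 x, ContDiffAt ℝ ∞ f y)
    (hr : ∀ᶠ y in 𝓝 x, Module.finrank ℝ (LinearMap.range (fderiv ℝ f y).toLinearMap) =
      Module.finrank ℝ (LinearMap.range (fderiv ℝ f x).toLinearMap)) :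
    ∃ L : V →L[ℝ] EuclideanSpace ℝ (Fin (Module.finrank ℝ (LinearMap.range (fderiv ℝ f x).toLinearMap))),
      Function.Surjective (L.comp (fderiv ℝ f x)) ∧
      (∀ v, L (fderiv ℝ f x v) = 0 → fderiv ℝ f x v = 0) ∧
      ∃ U ∈ 𝓝 x, ∀ y ∈ U, ∀ z ∈ U, L (f y) = L (f z) → f y = f z := by
  set R := LinearMap.range (fderiv ℝ f x).toLinearMap with hR
  set r := Module.finrank ℝ R with hrdef
  obtain ⟨P, hP⟩ := R.subtype.exists_leftInverse_of_injective R.ker_subtype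
  have hdim : Module.finrank ℝ R = Module.finrank ℝ (EuclideanSpace ℝ (Fin r)) := by simp [r]
  let ι : R ≃ₗ[ℝ] EuclideanSpace ℝ (Fin r) := LinearEquiv.ofFinrankEq _ _ hdim
  let L : V →L[ℝ] EuclideanSpace ℝ (Fin r) := LinearMap.toContinuousLinearMap (ι.toLinearMap.comp P)
  have hLR : ∀ w : R, L w = ι w := fun w => congrArg ι (LinearMap.congr_fun hP w)
  have hLf : ∀ v, L (fderiv ℝ f x v) = ι ⟨fderiv ℝ f x v, v, rfl⟩ := fun v => hLR ⟨_, v, rfl⟩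
  have hLker : ∀ v, L (fderiv ℝ f x v) = 0 → fderiv ℝ f x v = 0 := by
    intro v hv
    rw [hLf] at hv
    exact congrArg Subtype.val (ι.map_eq_zero_iff.1 hv)
  have hLs : Function.Surjective (L.comp (fderiv ℝ f x)) := by
    intro w
    obtain ⟨⟨_, u, rfl⟩, hu⟩ := ι.surjective w
    exact ⟨u, (hLf u).trans hu⟩
  refine ⟨L, hLs, hLker, ?_⟩
  set K := LinearMap.ker (fderiv ℝ f x).toLinearMap with hK
  obtain ⟨p, hp⟩ := K.subtype.exists_leftInverse_of_injective K.ker_subtype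
  let p' : E →L[ℝ] K := LinearMap.toContinuousLinearMap p
  -- Coordinates adapted to `f`: the projected values of `f`, completed by a projection to the
  -- kernel of its derivative at `x`. The aim is that in these coordinates `f` depends on the first
  -- component alone.
  let Φ : E → EuclideanSpace ℝ (Fin r) × K := fun y => (L (f y), p' y)
  have hΦ : ∀ y, ContDiffAt ℝ ∞ f y → ContDiffAt ℝ ∞ Φ y := fun y hy =>
    (L.contDiff.contDiffAt.comp y hy).prodMk p'.contDiff.contDiffAt
  have hΦd : ∀ y, ContDiffAt ℝ ∞ f y → fderiv ℝ Φ y = (L.comp (fderiv ℝ f y)).prod p' := fun y hy =>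
    ((L.hasFDerivAt.comp y (hy.differentiableAt (by simp)).hasFDerivAt).prodMk p'.hasFDerivAt).fderiv
  have hinj : Function.Injective (fderiv ℝ Φ x) := by
    rw [hΦd x hf.self_of_nhds]
    refine (injective_iff_map_eq_zero _).2 fun v hv => ?_
    have h1 := hLker v (congrArg Prod.fst hv)
    have h2 : p v = 0 := congrArg Prod.snd hv
    have h3 : p v = ⟨v, h1⟩ := LinearMap.congr_fun hp ⟨v, h1⟩
    exact congrArg Subtype.val (h3.symm.trans h2)
  have hfr : Module.finrank ℝ E = Module.finrank ℝ (EuclideanSpace ℝ (Fin r) × K) := by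
    rw [Module.finrank_prod, ← hdim, hR, hK]
    exact (LinearMap.finrank_range_add_finrank_ker _).symm
  have hbij : Function.Bijective (fderiv ℝ Φ x) :=
    ⟨hinj, (LinearMap.injective_iff_surjective_of_finrank_eq_finrank hfr
      (f := (fderiv ℝ Φ x).toLinearMap)).1 hinj⟩
  obtain ⟨e, hxe, hcoe, hs, ht⟩ := exists_openPartialHomeomorph_of_fderiv
    (hf.mono fun y hy => hΦ y hy) hbij
  have hxt : Φ x ∈ e.target := hcoe x ▸ e.map_source hxe
  have hsx : e.symm (Φ x) = x := by rw [← hcoe]; exact e.left_inv hxe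
  have hev : ∀ᶠ w in 𝓝 (Φ x), w ∈ e.target ∧ ContDiffAt ℝ ∞ f (e.symm w) ∧
      Module.finrank ℝ (LinearMap.range (fderiv ℝ f (e.symm w)).toLinearMap) = r := by
    have hc : ContinuousAt e.symm (Φ x) := e.symm.continuousAt hxt
    have h1 : ∀ᶠ w in 𝓝 (Φ x), ContDiffAt ℝ ∞ f (e.symm w) :=
      hc.eventually (by rw [hsx]; exact hf)
    have h2 : ∀ᶠ w in 𝓝 (Φ x), Module.finrank ℝ (LinearMap.range (fderiv ℝ f (e.symm w)).toLinearMap) = r :=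
      hc.eventually (p := fun y => Module.finrank ℝ (LinearMap.range (fderiv ℝ f y).toLinearMap) = r)
        (by rw [hsx]; exact hr)
    exact Filter.Eventually.and (e.open_target.mem_nhds hxt) (h1.and h2)
  obtain ⟨ε, hε, hball⟩ := Metric.eventually_nhds_iff_ball.1 hev
  have hΦc : ContinuousAt Φ x := (hΦ x hf.self_of_nhds).continuousAt
  refine ⟨e.source ∩ Φ ⁻¹' Metric.ball (Φ x) ε,
    Filter.inter_mem (e.open_source.mem_nhds hxe) (hΦc (Metric.ball_mem_nhds _ hε)), ?_⟩
  rintro y ⟨hy, hyb⟩ z ⟨hz, hzb⟩ hyz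
  have hmem : ∀ b ∈ Metric.ball (p' x) ε, (L (f y), b) ∈ Metric.ball (Φ x) ε := by
    intro b hb
    rw [← ball_prod_same]
    have : Φ y ∈ Metric.ball (L (f x)) ε ×ˢ Metric.ball (p' x) ε := by rw [ball_prod_same]; exact hyb
    exact ⟨this.1, hb⟩
  have hyb' : p' y ∈ Metric.ball (p' x) ε := by
    have : Φ y ∈ Metric.ball (L (f x)) ε ×ˢ Metric.ball (p' x) ε := by rw [ball_prod_same]; exact hyb
    exact this.2
  have hzb' : p' z ∈ Metric.ball (p' x) ε := by
    have : Φ z ∈ Metric.ball (L (f x)) ε ×ˢ Metric.ball (p' x) ε := by rw [ball_prod_same]; exact hzb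
    exact this.2
  -- Along the second factor `L ∘ f` is constant, being the first coordinate. So the partial
  -- derivative of `f` lies in the kernel of `L` on the range of the derivative of `f`, which is
  -- zero because the rank is still `r`.
  have hder : ∀ b ∈ Metric.ball (p' x) ε, HasFDerivAt (fun b => f (e.symm (L (f y), b))) (0 : K →L[ℝ] V) b := by
    intro b hb
    obtain ⟨hw, hfw, hrw⟩ := hball _ (hmem b hb)
    set w := (L (f y), b)
    have hi : HasFDerivAt (fun b : K => (L (f y), b)) (ContinuousLinearMap.inr ℝ _ K) b :=
      hasFDerivAt_prodMk_right _ _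
    have hes : HasFDerivAt e.symm (fderiv ℝ e.symm w) w :=
      ((ht w hw).differentiableAt (by simp)).hasFDerivAt
    have hfs : HasFDerivAt f (fderiv ℝ f (e.symm w)) (e.symm w) :=
      (hfw.differentiableAt (by simp)).hasFDerivAt
    have hall := hfs.comp w hes
    have hLall : HasFDerivAt (fun w => L (f (e.symm w)))
        (L.comp ((fderiv ℝ f (e.symm w)).comp (fderiv ℝ e.symm w))) w := L.hasFDerivAt.comp w hall
    have hfst : (fun w => L (f (e.symm w))) =ᶠ[𝓝 w] Prod.fst := by
      filter_upwards [e.open_target.mem_nhds hw] with u hu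
      have : Φ (e.symm u) = u := by rw [← hcoe]; exact e.right_inv hu
      exact congrArg Prod.fst this
    have hLeq := (hLall.congr_of_eventuallyEq hfst.symm).unique hasFDerivAt_fst
    refine (hall.comp b hi).congr_fderiv ?_
    ext v
    refine injOn_range_of_surjective_comp L (fderiv ℝ f (e.symm w)) ?_ (by rw [hrw]; simp)
      (fderiv ℝ e.symm w (0, v)) ?_
    · intro u
      have hb := (hs _ (e.map_target hw)).2
      rw [hΦd _ hfw] at hb
      obtain ⟨q, hq⟩ := hb.2 (u, 0)
      exact ⟨q, congrArg Prod.fst hq⟩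
    · exact congrArg (fun T : _ →L[ℝ] EuclideanSpace ℝ (Fin r) => T (0, v)) hLeq
  have hconst := Metric.isOpen_ball.is_const_of_fderiv_eq_zero (𝕜 := ℝ)
    (convex_ball (p' x) ε).isPreconnected
    (fun b hb => (hder b hb).differentiableAt.differentiableWithinAt)
    (fun b hb => (hder b hb).fderiv) hyb' hzb'
  have ey : e.symm (L (f y), p' y) = y := by
    have : (L (f y), p' y) = e y := (hcoe y).symm
    rw [this]; exact e.left_inv hy
  have ez : e.symm (L (f y), p' z) = z := by
    have : (L (f y), p' z) = e z := by rw [hyz]; exact (hcoe z).symm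
    rw [this]; exact e.left_inv hz
  simpa only [ey, ez] using hconst

end ConstantRank

/-! ### Charts in which the classes of an equivalence relation are slices. -/

section AdaptedCharts

variable {E H M V F : Type*} [NormedAddCommGroup E] [NormedSpace ℝ E] [TopologicalSpace H]
  [TopologicalSpace M] [ChartedSpace H M] [NormedAddCommGroup V] [NormedSpace ℝ V]
  [NormedAddCommGroup F] [NormedSpace ℝ F] {I : ModelWithCorners ℝ E H}

variable (I V F) in
/-- A chart of `M` around `base` with values in `V × F`, in which the classes of an equivalence
relation are the fibres of the first projection. -/
structure AdaptedChart (s : Setoid M) where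
  chart : OpenPartialHomeomorph M (V × F)
  base : M
  base_mem : base ∈ chart.source
  smooth : ContMDiffOn I 𝓘(ℝ, V × F) ∞ chart chart.source
  smooth_symm : ContMDiffOn 𝓘(ℝ, V × F) I ∞ chart.symm chart.target
  left : Set V
  right : Set F
  target_eq : chart.target = left ×ˢ right
  rel_iff : ∀ y ∈ chart.source, ∀ z ∈ chart.source, s.r y z ↔ (chart y).1 = (chart z).1

theorem mder_prodMk {f : M → V} {g : M → F} {x : M} (hf : MDifferentiableAt I 𝓘(ℝ, V) f x)
    (hg : MDifferentiableAt I 𝓘(ℝ, F) g x) :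
    mder I 𝓘(ℝ, V × F) (fun y => (f y, g y)) x = (mder I 𝓘(ℝ, V) f x).prod (mder I 𝓘(ℝ, F) g x) := by
  have h := hf.prodMk_space hg
  have h1 := mder_comp (g := (Prod.fst : V × F → V)) (I'' := 𝓘(ℝ, V))
    (differentiable_fst.differentiableAt.mdifferentiableAt) h
  have h2 := mder_comp (g := (Prod.snd : V × F → F)) (I'' := 𝓘(ℝ, F))
    (differentiable_snd.differentiableAt.mdifferentiableAt) h
  rw [mder_eq_fderiv, fderiv_fst] at h1
  rw [mder_eq_fderiv, fderiv_snd] at h2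
  ext v
  · exact (congrArg (fun T : E →L[ℝ] V => T v) h1).symm
  · exact (congrArg (fun T : E →L[ℝ] F => T v) h2).symm

/-- A submersion to a vector space is, in a suitable chart, the first projection of a product. -/
theorem exists_chart_of_mder_surjective [FiniteDimensional ℝ E] [FiniteDimensional ℝ V]
    [FiniteDimensional ℝ F] [IsManifold I ∞ M] [I.Boundaryless] {h : M → V} {x : M}
    (hh : ∀ᶠ y in 𝓝 x, ContMDiffAt I 𝓘(ℝ, V) ∞ h y)
    (hs : Function.Surjective (mder I 𝓘(ℝ, V) h x))
    (hd : Module.finrank ℝ E = Module.finrank ℝ V + Module.finrank ℝ F) {U : Set M} (hU : U ∈ 𝓝 x) :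
    ∃ (e : OpenPartialHomeomorph M (V × F)) (A : Set V) (B : Set F),
      x ∈ e.source ∧ e.source ⊆ U ∧ ContMDiffOn I 𝓘(ℝ, V × F) ∞ e e.source ∧
      ContMDiffOn 𝓘(ℝ, V × F) I ∞ e.symm e.target ∧ IsOpen A ∧ IsOpen B ∧ e.target = A ×ˢ B ∧
      ∀ y ∈ e.source, (e y).1 = h y := by
  set T := mder I 𝓘(ℝ, V) h x
  set K := LinearMap.ker T.toLinearMap with hK
  obtain ⟨p, hp⟩ := K.subtype.exists_leftInverse_of_injective K.ker_subtype
  have hKF : Module.finrank ℝ K = Module.finrank ℝ F := by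
    have h1 := LinearMap.finrank_range_add_finrank_ker T.toLinearMap
    rw [LinearMap.range_eq_top.2 hs, finrank_top] at h1
    change _ + Module.finrank ℝ K = _ at h1
    omega
  let ι : K ≃ₗ[ℝ] F := LinearEquiv.ofFinrankEq _ _ hKF
  let q : E →L[ℝ] F := LinearMap.toContinuousLinearMap (ι.toLinearMap.comp p)
  -- The submersion is completed to a local diffeomorphism by a linear coordinate on the kernel of
  -- its derivative.
  let f : M → V × F := fun y => (h y, q (extChartAt I x y))
  have hcs : ∀ᶠ y in 𝓝 x, y ∈ (extChartAt I x).source := extChartAt_source_mem_nhds x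
  have hq : ∀ y ∈ (extChartAt I x).source, ContMDiffAt I 𝓘(ℝ, F) ∞ (q ∘ extChartAt I x) y :=
    fun y hy => q.contDiff.contMDiff.contMDiffAt.comp y (contMDiffAt_extChartAt_of_mem x hy)
  have hf : ∀ᶠ y in 𝓝 x, ContMDiffAt I 𝓘(ℝ, V × F) ∞ f y := by
    filter_upwards [hh, hcs] with y hy hy'
    exact hy.prodMk_space (hq y hy')
  have hder : mder I 𝓘(ℝ, V × F) f x = T.prod q := by
    refine (mder_prodMk (hh.self_of_nhds.mdifferentiableAt (by simp))
      ((hq x (mem_extChartAt_source x)).mdifferentiableAt (by simp))).trans ?_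
    have h1 := mder_comp (g := q) (f := extChartAt I x) (x := x) (I := I) (I' := 𝓘(ℝ, E))
      (I'' := 𝓘(ℝ, F)) (q.contDiff.contMDiff.contMDiffAt.mdifferentiableAt (n := ∞) (by simp))
      ((contMDiffAt_extChartAt_of_mem x (mem_extChartAt_source x)).mdifferentiableAt (by simp))
    rw [mder_extChartAt_self, mder_eq_fderiv, ContinuousLinearMap.fderiv] at h1
    exact congrArg (T.prod) h1
  have hinj : Function.Injective (T.prod q) := by
    refine (injective_iff_map_eq_zero _).2 fun v hv => ?_
    have h1 : T v = 0 := congrArg Prod.fst hv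
    have h2 : ι (p v) = 0 := congrArg Prod.snd hv
    have h3 : p v = ⟨v, h1⟩ := LinearMap.congr_fun hp ⟨v, h1⟩
    exact congrArg Subtype.val (h3.symm.trans (ι.map_eq_zero_iff.1 h2))
  have hbij : Function.Bijective (T.prod q) :=
    ⟨hinj, (LinearMap.injective_iff_surjective_of_finrank_eq_finrank
      (by rw [hd, Module.finrank_prod]) (f := (T.prod q).toLinearMap)).1 hinj⟩
  obtain ⟨e, hxe, hcoe, hse, hte⟩ := exists_openPartialHomeomorph_of_mder hf (hder ▸ hbij)
  have hxt := e.map_source hxe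
  have hW : e.target ∩ e.symm ⁻¹' U ∈ 𝓝 (e x) := by
    refine Filter.inter_mem (e.open_target.mem_nhds hxt) ((e.symm.continuousAt hxt) ?_)
    rwa [e.left_inv hxe]
  obtain ⟨A, B, hA, hxA, hB, hxB, hAB⟩ := mem_nhds_prod_iff'.1 hW
  -- Shrinking the target to a box makes each fibre of the first coordinate a full copy of `B`;
  -- local sections of the quotient projection then exist over all of `A`.
  let e' := (e.symm.restrOpen (A ×ˢ B) (hA.prod hB)).symm
  have hsrc1 : ∀ y ∈ e'.source, y ∈ e.source ∩ e ⁻¹' (A ×ˢ B) := fun y hy => by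
    simpa [e'] using hy
  have hsrc : e'.source ⊆ e.source := fun y hy => (hsrc1 y hy).1
  have hsrc2 : ∀ y ∈ e'.source, e y ∈ A ×ˢ B := fun y hy => (hsrc1 y hy).2
  have htgt : e'.target = A ×ˢ B := by
    have : e'.target = e.target ∩ A ×ˢ B := by simp [e']
    rw [this, Set.inter_eq_right]
    exact fun w hw => (hAB hw).1
  refine ⟨e', A, B, ?_, ?_, hse.mono hsrc, hte.mono ?_, hA, hB, htgt, ?_⟩
  · have : x ∈ e.source ∩ e ⁻¹' (A ×ˢ B) := ⟨hxe, hxA, hxB⟩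
    simpa [e'] using this
  · intro y hy
    have := (hAB (hsrc2 y hy)).2
    rw [Set.mem_preimage, e.left_inv (hsrc hy)] at this
    exact this
  · rw [htgt]; exact fun w hw => (hAB hw).1
  · intro y hy
    exact congrArg Prod.fst (hcoe y (hsrc hy))

/-- A submersion that locally separates the classes of an equivalence relation gives rise to an
adapted chart. -/
theorem exists_adaptedChart [FiniteDimensional ℝ E] [FiniteDimensional ℝ V]
    [FiniteDimensional ℝ F] [IsManifold I ∞ M] [I.Boundaryless] {s : Setoid M} {h : M → V} {x : M}
    (hh : ∀ᶠ y in 𝓝 x, ContMDiffAt I 𝓘(ℝ, V) ∞ h y)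
    (hs : Function.Surjective (mder I 𝓘(ℝ, V) h x))
    (hd : Module.finrank ℝ E = Module.finrank ℝ V + Module.finrank ℝ F)
    (hrel : ∃ U ∈ 𝓝 x, ∀ y ∈ U, ∀ z ∈ U, s.r y z ↔ h y = h z) :
    ∃ c : AdaptedChart V F I s, c.base = x := by
  obtain ⟨U, hU, hr⟩ := hrel
  obtain ⟨e, A, B, hx, heU, h1, h2, -, -, h3, h4⟩ := exists_chart_of_mder_surjective hh hs hd hU
  exact ⟨⟨e, x, hx, h1, h2, A, B, h3, fun y hy z hz => by
    rw [hr y (heU hy) z (heU hz), h4 y hy, h4 z hz]⟩, rfl⟩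

end AdaptedCharts

theorem model_right_inv {E H : Type*} [NormedAddCommGroup E] [NormedSpace ℝ E]
    [TopologicalSpace H] (I : ModelWithCorners ℝ E H) [I.Boundaryless] (z : E) :
    I (I.symm z) = z :=
  I.right_inv (by rw [I.range_eq_univ]; trivial)

/-! ### The quotient manifold theorem. -/

section QuotientManifolds

variable {E H M V F : Type*} [NormedAddCommGroup E] [NormedSpace ℝ E] [TopologicalSpace H]
  [TopologicalSpace M] [ChartedSpace H M] [NormedAddCommGroup V] [NormedSpace ℝ V]
  [NormedAddCommGroup F] [NormedSpace ℝ F] {I : ModelWithCorners ℝ E H} {s : Setoid M}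

/-- Equivalent points are related by a map that is smooth at the first point and preserves classes. -/
def HasSmoothTransport (I : ModelWithCorners ℝ E H) (s : Setoid M) : Prop :=
  ∀ y y', s.r y y' → ∃ γ : M → M, ContMDiffAt I I ∞ γ y ∧ γ y = y' ∧ ∀ᶠ z in 𝓝 y, s.r z (γ z)

/-- The saturation of an open set `U` is open: a transport map carrying `y` to an equivalent point
of `U` carries a neighbourhood of `y` into `U` without leaving the classes. -/
theorem HasSmoothTransport.isOpenMap (h : HasSmoothTransport I s) :
    IsOpenMap (Quotient.mk s) := by
  intro U hU
  refine isOpen_coinduced.2 (isOpen_iff_mem_nhds.2 ?_)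
  rintro y ⟨y', hy', hyy'⟩
  obtain ⟨γ, hγ, hγy, hr⟩ := h y y' (Quotient.exact hyy'.symm)
  have : γ ⁻¹' U ∈ 𝓝 y := hγ.continuousAt (hU.mem_nhds (hγy ▸ hy'))
  filter_upwards [this, hr] with z hz hz'
  exact ⟨γ z, hz, Quotient.sound (Setoid.symm hz')⟩

namespace AdaptedChart

variable (c : AdaptedChart V F I s)

theorem mem_target {w : V} (hw : w ∈ c.left) : (w, (c.chart c.base).2) ∈ c.chart.target := by
  have := c.chart.map_source c.base_mem
  rw [c.target_eq] at this ⊢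
  exact ⟨hw, this.2⟩

theorem fst_mem {y : M} (hy : y ∈ c.chart.source) : (c.chart y).1 ∈ c.left := by
  have := c.chart.map_source hy
  rw [c.target_eq] at this
  exact this.1

theorem isOpen_left : IsOpen c.left := by
  have h : c.left = (fun w : V => (w, (c.chart c.base).2)) ⁻¹' c.chart.target := by
    ext w
    refine ⟨c.mem_target, fun hw => ?_⟩
    have hw' : (w, (c.chart c.base).2) ∈ c.chart.target := hw
    rw [c.target_eq] at hw'
    exact hw'.1
  rw [h]
  exact c.chart.open_target.preimage (by fun_prop)

/-- A local section of the projection to the quotient, in terms of an adapted chart. -/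
def localSection (w : V) : M := c.chart.symm (w, (c.chart c.base).2)

theorem localSection_mem {w : V} (hw : w ∈ c.left) : c.localSection w ∈ c.chart.source :=
  c.chart.map_target (c.mem_target hw)

theorem chart_localSection {w : V} (hw : w ∈ c.left) : (c.chart (c.localSection w)).1 = w := by
  rw [localSection, c.chart.right_inv (c.mem_target hw)]

theorem contMDiffOn_localSection : ContMDiffOn 𝓘(ℝ, V) I ∞ c.localSection c.left :=
  c.smooth_symm.comp (contMDiff_id.prodMk_space contMDiff_const).contMDiffOn fun _ hw => c.mem_target hw

open Classical in
/-- The first component of an adapted chart, as a function on the quotient. -/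
def quotientFun (b : Quotient s) : V :=
  if h : ∃ y ∈ c.chart.source, Quotient.mk s y = b then (c.chart h.choose).1
  -- An arbitrary value outside the domain of the quotient chart.
  else (c.chart c.base).1

theorem quotientFun_mk {y : M} (hy : y ∈ c.chart.source) :
    c.quotientFun (Quotient.mk s y) = (c.chart y).1 := by
  have h : ∃ z ∈ c.chart.source, Quotient.mk s z = Quotient.mk s y := ⟨y, hy, rfl⟩
  rw [quotientFun, dif_pos h]
  exact (c.rel_iff _ h.choose_spec.1 _ hy).1 (Quotient.exact h.choose_spec.2)

/-- The chart of the quotient defined by an adapted chart. -/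
def quotientChart (ho : IsOpenMap (Quotient.mk s)) : OpenPartialHomeomorph (Quotient s) V where
  toFun := c.quotientFun
  invFun w := Quotient.mk s (c.localSection w)
  source := Quotient.mk s '' c.chart.source
  target := c.left
  map_source' := by
    rintro _ ⟨y, hy, rfl⟩
    rw [c.quotientFun_mk hy]
    exact c.fst_mem hy
  map_target' w hw := ⟨_, c.localSection_mem hw, rfl⟩
  left_inv' := by
    rintro _ ⟨y, hy, rfl⟩
    rw [c.quotientFun_mk hy]
    refine Quotient.sound ((c.rel_iff _ (c.localSection_mem (c.fst_mem hy)) _ hy).2 ?_)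
    exact c.chart_localSection (c.fst_mem hy)
  right_inv' w hw := by rw [c.quotientFun_mk (c.localSection_mem hw), c.chart_localSection hw]
  open_source := ho _ c.chart.open_source
  open_target := c.isOpen_left
  continuousOn_toFun := by
    rintro _ ⟨y, hy, rfl⟩
    refine ContinuousAt.continuousWithinAt ?_
    intro O hO
    rw [c.quotientFun_mk hy] at hO
    obtain ⟨O', hO', hO'o, hyO'⟩ := mem_nhds_iff.1 hO
    have h1 : c.chart.source ∩ c.chart ⁻¹' (Prod.fst ⁻¹' O') ∈ 𝓝 y :=
      (c.chart.isOpen_inter_preimage (hO'o.preimage continuous_fst)).mem_nhds ⟨hy, hyO'⟩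
    refine Filter.mem_map.2 ?_
    filter_upwards [ho.image_mem_nhds h1]
    rintro _ ⟨z, ⟨hz, hz'⟩, rfl⟩
    refine hO' ?_
    rw [c.quotientFun_mk hz]
    exact hz'
  continuousOn_invFun :=
    continuous_quotient_mk'.comp_continuousOn c.contMDiffOn_localSection.continuousOn

/-- The transition function between two charts of the quotient is smooth. -/
theorem contDiffOn_transition (h : HasSmoothTransport I s) (c c' : AdaptedChart V F I s) :
    ContDiffOn ℝ ∞ (fun w => c'.quotientFun (Quotient.mk s (c.localSection w)))
      {w | w ∈ c.left ∧ Quotient.mk s (c.localSection w) ∈ Quotient.mk s '' c'.chart.source} := by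
  rintro w ⟨hw, y', hy', hyy'⟩
  refine ContDiffAt.contDiffWithinAt ?_
  -- The section of `c` may miss the domain of `c'`, although it passes through the right classes. A
  -- transport map moves it there, and the transition function becomes the first component of
  -- `c'.chart ∘ γ ∘ c.localSection`.
  obtain ⟨γ, hγ, hγy, hr⟩ := h (c.localSection w) y' (Quotient.exact hyy'.symm)
  have h1 : ContMDiffAt 𝓘(ℝ, V) I ∞ c.localSection w :=
    c.contMDiffOn_localSection.contMDiffAt (c.isOpen_left.mem_nhds hw)
  have h2 : ContMDiffAt I 𝓘(ℝ, V × F) ∞ c'.chart (γ (c.localSection w)) := by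
    rw [hγy]; exact c'.smooth.contMDiffAt (c'.chart.open_source.mem_nhds hy')
  have h3 := (h2.comp w (hγ.comp w h1)).contDiffAt.fst
  refine h3.congr_of_eventuallyEq ?_
  have h4 : ∀ᶠ z in 𝓝 w, γ (c.localSection z) ∈ c'.chart.source := by
    refine (hγ.comp w h1).continuousAt ?_
    exact c'.chart.open_source.mem_nhds (by rw [Function.comp, hγy]; exact hy')
  filter_upwards [h4, h1.continuousAt.eventually hr] with z hz hz'
  have : Quotient.mk s (c.localSection z) = Quotient.mk s (γ (c.localSection z)) := Quotient.sound hz'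
  rw [this, c'.quotientFun_mk hz]
  rfl

end AdaptedChart

/-- The quotient manifold theorem for equivalence relations with adapted charts. -/
theorem nonempty_quotientManifold [IsManifold I ∞ M] [I.Boundaryless] {d : ℕ}
    (equiv : E ≃L[ℝ] (EuclideanSpace ℝ (Fin d) × F)) (h : HasSmoothTransport I s)
    (hc : ∀ x : M, ∃ c : AdaptedChart (EuclideanSpace ℝ (Fin d)) F I s, c.base = x) :
    Nonempty (QuotientManifold I s) := by
  have ho := h.isOpenMap
  choose c hc using hc
  let C : ChartedSpace (EuclideanSpace ℝ (Fin d)) (Quotient s) :=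
    -- All adapted charts are admitted; any two are compatible by `contDiffOn_transition`.
    { atlas := {e | ∃ c : AdaptedChart (EuclideanSpace ℝ (Fin d)) F I s, e = c.quotientChart ho}
      chartAt := fun b => (c b.out).quotientChart ho
      mem_chart_source := fun b => ⟨b.out, by
        have := (c b.out).base_mem
        rwa [hc] at this, b.out_eq⟩
      chart_mem_atlas := fun b => ⟨_, rfl⟩ }
  have hM : IsManifold (𝓡 d) ∞ (Quotient s) := by
    refine isManifold_of_contDiffOn (𝓡 d) ∞ (Quotient s) ?_
    rintro _ _ ⟨c, rfl⟩ ⟨c', rfl⟩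
    refine (AdaptedChart.contDiffOn_transition h c c').mono ?_
    intro w hw
    exact ⟨hw.1.1, hw.1.2⟩
  refine ⟨⟨d, C, hM, ?_⟩⟩
  refine Manifold.IsSubmersionOfComplement.isSubmersion (F := F) fun x => ?_
  refine Manifold.IsSubmersionAtOfComplement.mk_of_charts equiv
    ((c x).chart.trans (equiv.symm.toHomeomorph.trans I.toHomeomorph.symm).toOpenPartialHomeomorph)
    ((c x).quotientChart ho) ?_ ?_ (trans_mem_maximalAtlas _ (c x).smooth (c x).smooth_symm equiv.symm)
    (IsManifold.subset_maximalAtlas ⟨_, rfl⟩) ?_ ?_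
  · have := (c x).base_mem
    rw [hc] at this
    simpa using this
  · have := (c x).base_mem
    rw [hc] at this
    exact ⟨x, this, rfl⟩
  · intro y hy
    exact ⟨y, by simpa using hy, rfl⟩
  · intro z hz
    have hz' : (∃ y, I y = z) ∧ equiv z ∈ (c x).chart.target := by
      simpa [OpenPartialHomeomorph.trans_target, model_right_inv] using hz
    replace hz' := hz'.2
    have h1 : (((c x).chart.trans
      (equiv.symm.toHomeomorph.trans I.toHomeomorph.symm).toOpenPartialHomeomorph).extend I).symm z =
        (c x).chart.symm (equiv z) := by
      simp [model_right_inv]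
    change (c x).quotientFun (Quotient.mk s _) = _
    rw [h1, (c x).quotientFun_mk ((c x).chart.map_target hz'), (c x).chart.right_inv hz']
    rfl

end QuotientManifolds

/-! ### The regular level set theorem. -/

section LevelSets

variable {E H M V : Type*} [NormedAddCommGroup E] [NormedSpace ℝ E] [TopologicalSpace H]
  [TopologicalSpace M] [ChartedSpace H M] [NormedAddCommGroup V] [NormedSpace ℝ V]
  {I : ModelWithCorners ℝ E H}

/-- The chart of a level set of the first component of a chart. -/
def levelChart {W : Type*} [NormedAddCommGroup W] {f : M → V} {c : V} (x : {x | f x = c})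
    (e : OpenPartialHomeomorph M (V × W)) (he : ∀ y ∈ e.source, (e y).1 = f y) :
    OpenPartialHomeomorph {x | f x = c} W := by
  classical
  exact
  { toFun := fun y => (e y).2
    -- The point `x` serves as a default value off the target.
    invFun := fun w => if h : (c, w) ∈ e.target then ⟨e.symm (c, w), by
      rw [Set.mem_ofPred_eq, ← he _ (e.map_target h), e.right_inv h]⟩ else x
    source := Subtype.val ⁻¹' e.source
    target := {w | (c, w) ∈ e.target}
    map_source' := by
      intro y hy
      have h1 : e y = (c, (e y).2) := Prod.ext ((he _ hy).trans y.2) rfl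
      exact h1 ▸ e.map_source hy
    map_target' := by
      intro w hw
      have hw' : (c, w) ∈ e.target := hw
      simp only [dif_pos hw', Set.mem_preimage]
      exact e.map_target hw'
    left_inv' := by
      intro y hy
      have h1 : e y = (c, (e y).2) := Prod.ext ((he _ hy).trans y.2) rfl
      have h2 : (c, (e y).2) ∈ e.target := h1 ▸ e.map_source hy
      rw [dif_pos h2]
      refine Subtype.ext ?_
      change e.symm (c, (e y).2) = y
      rw [← h1, e.left_inv hy]
    right_inv' := by
      intro w hw
      have hw' : (c, w) ∈ e.target := hw
      simp only [dif_pos hw', e.right_inv hw']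
    open_source := e.open_source.preimage continuous_subtype_val
    open_target := e.open_target.preimage (by fun_prop)
    continuousOn_toFun :=
      continuous_snd.comp_continuousOn (e.continuousOn.comp continuous_subtype_val.continuousOn
        fun _ hy => hy)
    continuousOn_invFun := by
      rw [Topology.IsInducing.subtypeVal.continuousOn_iff]
      refine (e.symm.continuousOn.comp (f := fun w => (c, w)) (by fun_prop)
        fun _ hw => hw).congr ?_
      intro w hw
      have hw' : (c, w) ∈ e.target := hw
      simp [dif_pos hw'] }

theorem levelChart_symm_apply {M V W : Type*} [TopologicalSpace M] [NormedAddCommGroup V]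
    [NormedAddCommGroup W] {f : M → V} {c : V}
    (x : {x | f x = c}) (e : OpenPartialHomeomorph M (V × W)) (he : ∀ y ∈ e.source, (e y).1 = f y)
    {w : W} (hw : (c, w) ∈ e.target) : ((levelChart x e he).symm w : M) = e.symm (c, w) := by
  exact congrArg Subtype.val (dif_pos hw)

/-- The regular level set theorem. -/
theorem nonempty_submanifoldStructure [FiniteDimensional ℝ E] [FiniteDimensional ℝ V]
    [IsManifold I ∞ M] [I.Boundaryless] {f : M → V} {c : V} (hf : ContMDiff I 𝓘(ℝ, V) ∞ f)
    (hs : ∀ x, f x = c → Function.Surjective (mder I 𝓘(ℝ, V) f x)) :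
    Nonempty (SubmanifoldStructure I {x | f x = c}) := by
  -- The truncated subtraction is exact as soon as the level set has a point, since the derivative
  -- there is surjective; for an empty level set the value of `d` is immaterial.
  let d := Module.finrank ℝ E - Module.finrank ℝ V
  let W := EuclideanSpace ℝ (Fin d)
  have hd : ∀ x : {x | f x = c}, Module.finrank ℝ E = Module.finrank ℝ V + Module.finrank ℝ W := by
    intro x
    have := LinearMap.finrank_le_finrank_of_surjective (f := (mder I 𝓘(ℝ, V) f x).toLinearMap)
      (hs x x.2)
    simp only [W, d, finrank_euclideanSpace, Fintype.card_fin]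
    omega
  have hex : ∀ x : {x | f x = c}, ∃ e : OpenPartialHomeomorph M (V × W), x.1 ∈ e.source ∧
      ContMDiffOn I 𝓘(ℝ, V × W) ∞ e e.source ∧ ContMDiffOn 𝓘(ℝ, V × W) I ∞ e.symm e.target ∧
      ∀ y ∈ e.source, (e y).1 = f y := by
    intro x
    obtain ⟨e, A, B, h1, -, h2, h3, -, -, -, h4⟩ := exists_chart_of_mder_surjective
      (Filter.Eventually.of_forall fun y => hf y) (hs x x.2) (hd x) Filter.univ_mem
    exact ⟨e, h1, h2, h3, h4⟩
  choose e hxe hse hte he using hex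
  let C : ChartedSpace W {x | f x = c} :=
    { atlas := Set.range fun x => levelChart x (e x) (he x)
      chartAt := fun x => levelChart x (e x) (he x)
      mem_chart_source := hxe
      chart_mem_atlas := fun x => ⟨x, rfl⟩ }
  have hM : IsManifold (𝓡 d) ∞ {x | f x = c} := by
    refine isManifold_of_contDiffOn (𝓡 d) ∞ _ ?_
    rintro _ _ ⟨x, rfl⟩ ⟨x', rfl⟩
    intro w hw
    obtain ⟨⟨hw1, hw2⟩, -⟩ := hw
    have hw1' : (c, w) ∈ (e x).target := hw1
    have hw2' : (e x).symm (c, w) ∈ (e x').source := by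
      rw [← levelChart_symm_apply x (e x) (he x) hw1']
      exact hw2
    refine ContDiffAt.contDiffWithinAt ?_
    have h1 : ContMDiffAt 𝓘(ℝ, W) 𝓘(ℝ, V × W) ∞ (fun w => (c, w)) w :=
      contMDiffAt_const.prodMk_space contMDiffAt_id
    have h2 := ((hse x').contMDiffAt ((e x').open_source.mem_nhds hw2')).comp w
      (((hte x).contMDiffAt ((e x).open_target.mem_nhds hw1')).comp w h1)
    refine h2.contDiffAt.snd.congr_of_eventuallyEq ?_
    have h3 : ∀ᶠ z in 𝓝 w, (c, z) ∈ (e x).target :=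
      h1.continuousAt ((e x).open_target.mem_nhds hw1')
    filter_upwards [h3] with z hz
    exact congrArg (fun m => (e x' m).2) (levelChart_symm_apply x (e x) (he x) hz)
  refine ⟨⟨d, C, hM, ?_, Topology.IsEmbedding.subtypeVal⟩⟩
  refine Manifold.IsImmersionOfComplement.isImmersion (F := V) fun x => ?_
  let L : (W × V) ≃L[ℝ] E := ContinuousLinearEquiv.ofFinrankEq (by
    rw [hd x, Module.finrank_prod, add_comm])
  -- Swapping the factors and translating by `c` brings the inclusion of the level set to the normal
  -- form w ↦ (w, 0) of an immersion.
  let τ : (V × W) ≃ₜ (W × V) := ((Homeomorph.addRight (-c)).prodCongr (Homeomorph.refl W)).trans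
    (Homeomorph.prodComm V W)
  have hτ : ∀ v w, τ (v, w) = (w, v - c) := fun v w => by
    simp [τ, sub_eq_add_neg]
  have hτs : ∀ v w, τ.symm (w, v) = (v + c, w) := fun v w => by
    rw [Homeomorph.symm_apply_eq, hτ, add_sub_cancel_right]
  let e' : OpenPartialHomeomorph M (W × V) := (e x).trans τ.toOpenPartialHomeomorph
  have he's : e'.source = (e x).source := by simp [e']
  have he't : e'.target = τ.symm ⁻¹' (e x).target := by simp [e']
  have hτc : ContMDiff 𝓘(ℝ, V × W) 𝓘(ℝ, W × V) ∞ τ := by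
    have : (τ : V × W → W × V) = fun q => (q.2, q.1 - c) := by funext q; exact hτ q.1 q.2
    rw [this]
    exact (contDiff_snd.prodMk (contDiff_fst.sub contDiff_const)).contMDiff
  have hτsc : ContMDiff 𝓘(ℝ, W × V) 𝓘(ℝ, V × W) ∞ τ.symm := by
    have : (τ.symm : W × V → V × W) = fun q => (q.2 + c, q.1) := by funext q; exact hτs q.2 q.1
    rw [this]
    exact ((contDiff_snd.add contDiff_const).prodMk contDiff_fst).contMDiff
  have hmem := trans_mem_maximalAtlas (I := I) e' (by
    rw [he's]; exact hτc.comp_contMDiffOn (hse x)) (by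
    rw [he't]; exact (hte x).comp hτsc.contMDiffOn fun _ hw => hw) L
  refine Manifold.IsImmersionAtOfComplement.mk_of_charts L (levelChart x (e x) (he x)) _
    (hxe x) ?_ (IsManifold.subset_maximalAtlas ⟨x, rfl⟩) hmem ?_ ?_
  · simpa [e'] using hxe x
  · intro y hy
    have hy' : (y : M) ∈ (e x).source := hy
    simpa [e'] using hy'
  · intro w hw
    have hw' : (c, w) ∈ (e x).target := by
      have : w ∈ (levelChart x (e x) (he x)).target := by simpa using hw
      exact this
    have h1 : (((levelChart x (e x) (he x)).extend (𝓡 d)).symm w : M) = (e x).symm (c, w) :=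
      levelChart_symm_apply x (e x) (he x) hw'
    have h2 : (e' ((e x).symm (c, w))) = (w, 0) := by
      change τ (e x ((e x).symm (c, w))) = _
      rw [(e x).right_inv hw', hτ, sub_self]
    have h3 : ∀ m, ((e'.trans (L.toHomeomorph.trans I.toHomeomorph.symm).toOpenPartialHomeomorph).extend I) m
        = L (e' m) := by
      intro m
      simp [model_right_inv]
    change ((e'.trans (L.toHomeomorph.trans I.toHomeomorph.symm).toOpenPartialHomeomorph).extend I)
      (((levelChart x (e x) (he x)).extend (𝓡 d)).symm w : M) = L (w, 0)
    rw [h1, h3, h2]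

end LevelSets

/-! ### Local sections of submersions. -/

section Submersions

variable {E H M E' H' N : Type*} [NormedAddCommGroup E] [NormedSpace ℝ E] [TopologicalSpace H]
  [TopologicalSpace M] [ChartedSpace H M] [NormedAddCommGroup E'] [NormedSpace ℝ E']
  [TopologicalSpace H'] [TopologicalSpace N] [ChartedSpace H' N] {I : ModelWithCorners ℝ E H}
  {J : ModelWithCorners ℝ E' H'}

/-- A submersion has a smooth local section through every point. -/
theorem exists_localSection [IsManifold I ∞ M] [IsManifold J ∞ N] [I.Boundaryless]
    {f : M → N} {x : M} (hf : Manifold.IsSubmersionAt I J ∞ f x) :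
    ∃ σ : N → M, (∀ᶠ n in 𝓝 (f x), ContMDiffAt J I ∞ σ n) ∧ σ (f x) = x ∧
      ∀ᶠ n in 𝓝 (f x), f (σ n) = n := by
  set φ := hf.domChart.extend I with hφ
  set χ := hf.codChart.extend J with hχ
  set q := hf.equiv with hq
  have hxφ : x ∈ φ.source := by
    rw [hφ, OpenPartialHomeomorph.extend_source]; exact hf.mem_domChart_source
  have hfχ : f x ∈ χ.source := by
    rw [hχ, OpenPartialHomeomorph.extend_source]; exact hf.mem_codChart_source
  have hw : ∀ z ∈ φ.target, χ (f (φ.symm z)) = (q z).1 := fun z hz => hf.writtenInCharts hz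
  have hto : IsOpen φ.target := hf.domChart.isOpen_extend_target
  have hχs : IsOpen χ.source := by
    rw [hχ, OpenPartialHomeomorph.extend_source]; exact hf.codChart.open_source
  have hχsm : ContMDiffOn J 𝓘(ℝ, E') ∞ χ χ.source := by
    rw [hχ, OpenPartialHomeomorph.extend_source]
    exact OpenPartialHomeomorph.contMDiffOn_extend hf.codChart_mem_maximalAtlas
  have hφsm : ContMDiffOn 𝓘(ℝ, E) I ∞ φ.symm φ.target := by
    have := contMDiffOn_extend_symm hf.domChart_mem_maximalAtlas
    refine this.mono ?_
    rw [hφ, OpenPartialHomeomorph.extend_target']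
  -- In submersion charts the section keeps the fibre coordinate equal to that of `x`.
  let ρ : N → E := fun n => q.symm (χ n, (q (φ x)).2)
  have hρ : ∀ n ∈ χ.source, ContMDiffAt J 𝓘(ℝ, E) ∞ ρ n := fun n hn =>
    q.symm.contDiff.contMDiff.contMDiffAt.comp n
      ((hχsm.contMDiffAt (hχs.mem_nhds hn)).prodMk_space contMDiffAt_const)
  have hφx : φ.symm (φ x) = x := φ.left_inv hxφ
  have hρx : ρ (f x) = φ x := by
    have h1 := hw _ (φ.map_source hxφ)
    rw [hφx] at h1
    simp only [ρ, h1, Prod.mk.eta, ContinuousLinearEquiv.symm_apply_apply]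
  have hev : ∀ᶠ n in 𝓝 (f x), n ∈ χ.source ∧ ρ n ∈ φ.target := by
    refine Filter.Eventually.and (hχs.mem_nhds hfχ) ?_
    refine (hρ _ hfχ).continuousAt (hto.mem_nhds ?_)
    rw [hρx]; exact φ.map_source hxφ
  refine ⟨fun n => φ.symm (ρ n), ?_, ?_, ?_⟩
  · filter_upwards [hev] with n hn
    exact (hφsm.contMDiffAt (hto.mem_nhds hn.2)).comp n (hρ n hn.1)
  · simp only [hρx, hφx]
  · filter_upwards [hev] with n hn
    have h1 : χ (f (φ.symm (ρ n))) = χ n := by rw [hw _ hn.2]; simp [ρ]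
    refine χ.injOn ?_ hn.1 h1
    have h2 : φ.symm (ρ n) ∈ hf.domChart.source := by
      rw [← OpenPartialHomeomorph.extend_source (I := I)]; exact φ.map_target hn.2
    rw [hχ, OpenPartialHomeomorph.extend_source]
    exact hf.source_subset_preimage_source h2

/-- The derivative of `σ` is a right inverse, by the chain rule for f ∘ σ = id. -/
theorem mder_surjective_of_localSection {f : M → N} {σ : N → M} {x : M}
    (hf : MDifferentiableAt I J f x) (hσ : MDifferentiableAt J I σ (f x)) (hx : σ (f x) = x)
    (h : ∀ᶠ n in 𝓝 (f x), f (σ n) = n) : Function.Surjective (mder I J f x) := by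
  have h1 := mder_comp (g := f) (f := σ) (x := f x) (by rw [hx]; exact hf) hσ
  rw [mder_congr (f := f ∘ σ) (f' := id) h, mder_id, hx] at h1
  exact fun v => ⟨mder J I σ (f x) v, (congrArg (fun T : E' →L[ℝ] E' => T v) h1).symm⟩

theorem mder_surjective_of_isSubmersionAt [IsManifold I ∞ M] [IsManifold J ∞ N] [I.Boundaryless]
    {f : M → N} {x : M} (hf : Manifold.IsSubmersionAt I J ∞ f x) :
    Function.Surjective (mder I J f x) := by
  obtain ⟨σ, h1, h2, h3⟩ := exists_localSection hf
  exact mder_surjective_of_localSection (hf.contMDiffAt.mdifferentiableAt (by simp))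
    (h1.self_of_nhds.mdifferentiableAt (by simp)) h2 h3

end Submersions

/-! ### Slices for free and proper actions. -/

section Slices

variable {EG G EM M : Type*} [NormedAddCommGroup EG] [NormedSpace ℝ EG] [TopologicalSpace G]
  [ChartedSpace EG G] [Group G] [NormedAddCommGroup EM] [NormedSpace ℝ EM] [TopologicalSpace M]
  [ChartedSpace EM M] [MulAction Gᵐᵒᵖ M]

/-- The infinitesimal action at a point, as a linear map between the model spaces. -/
def infActL (G : Type*) [TopologicalSpace G] [ChartedSpace EG G] [Group G] [MulAction Gᵐᵒᵖ M]
    (m : M) : EG →L[ℝ] EM := infAct G m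

/-- For a free and proper action, group elements that move points near `x` to points near `x` are
close to the identity. -/
theorem IsFreeProperAction.exists_nhds (h : IsFreeProperAction EG G EM M) [T2Space M] (x : M)
    {V : Set G} (hV : V ∈ 𝓝 (1 : G)) :
    ∃ U ∈ 𝓝 x, ∀ y ∈ U, ∀ k : G, op k • y ∈ U → k ∈ V := by
  have hp := h.proper.isProperMap_smul_pair
  obtain ⟨V', hV'V, hV'o, h1V'⟩ := mem_nhds_iff.1 hV
  -- Pairs whose group element is far from 1. Their image under the proper map (k, y) ↦ (y k, y) is
  -- closed, and by freeness it does not contain (x, x); a product neighbourhood of (x, x) avoiding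
  -- it does the job.
  let C : Set (Gᵐᵒᵖ × M) := {q | q.1.unop ∉ V'}
  have hC : IsClosed C := (hV'o.preimage (continuous_unop.comp continuous_fst)).isClosed_compl
  have hcl := hp.isClosedMap C hC
  have hx : ((x, x) : M × M) ∉ (fun gx : Gᵐᵒᵖ × M => (gx.1 • gx.2, gx.2)) '' C := by
    rintro ⟨⟨k, y⟩, hk, hky⟩
    have h2 : y = x := congrArg Prod.snd hky
    have h1 : k • y = x := congrArg Prod.fst hky
    subst h2
    refine hk ?_
    have : k.unop = 1 := h.free y k.unop (by simpa using h1)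
    rw [this]; exact h1V'
  obtain ⟨A, B, hA, hxA, hB, hxB, hAB⟩ := mem_nhds_prod_iff'.1 (hcl.isOpen_compl.mem_nhds hx)
  refine ⟨A ∩ B, Filter.inter_mem (hA.mem_nhds hxA) (hB.mem_nhds hxB), fun y hy k hk => ?_⟩
  by_contra hkV
  exact hAB (Set.mk_mem_prod hk.1 hy.2) ⟨(op k, y), fun hk' => hkV (hV'V hk'), rfl⟩

/-- The slice theorem: near `x`, a point `y` is determined by a transversal coordinate `(ψ y).1` and
a group coordinate `(ψ y).2`, and the action of the group is the right multiplication. -/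
theorem IsFreeProperAction.exists_slice [FiniteDimensional ℝ EG] [FiniteDimensional ℝ EM]
    [LieGroup 𝓘(ℝ, EG) ∞ G] [IsManifold 𝓘(ℝ, EM) ∞ M] [T2Space M]
    (h : IsFreeProperAction EG G EM M)
    (hinj : ∀ m : M, Function.Injective (infActL G m : EG →L[ℝ] EM)) (x : M) :
    ∃ (W : Submodule ℝ EM) (ψ : OpenPartialHomeomorph M (W × EG)),
      Module.finrank ℝ EM = Module.finrank ℝ W + Module.finrank ℝ EG ∧ x ∈ ψ.source ∧
      ContMDiffOn 𝓘(ℝ, EM) 𝓘(ℝ, W × EG) ∞ ψ ψ.source ∧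
      ContMDiffOn 𝓘(ℝ, W × EG) 𝓘(ℝ, EM) ∞ ψ.symm ψ.target ∧
      (ψ x).2 = extChartAt 𝓘(ℝ, EG) (1 : G) 1 ∧
      (∀ y ∈ ψ.source, ∀ z ∈ ψ.source, ∀ k : G, op k • y = z ↔ (ψ y).1 = (ψ z).1 ∧
        (extChartAt 𝓘(ℝ, EG) (1 : G)).symm (ψ z).2 =
          (extChartAt 𝓘(ℝ, EG) (1 : G)).symm (ψ y).2 * k) ∧
      ∀ v : EM, (mder 𝓘(ℝ, EM) 𝓘(ℝ, W × EG) ψ x v).1 = 0 →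
        (infActL G x : EG →L[ℝ] EM) (mder 𝓘(ℝ, EM) 𝓘(ℝ, W × EG) ψ x v).2 = v := by
  set R := LinearMap.range (infActL G x : EG →L[ℝ] EM).toLinearMap with hR
  obtain ⟨W, hW⟩ := R.exists_isCompl
  have hdim : Module.finrank ℝ EM = Module.finrank ℝ W + Module.finrank ℝ EG := by
    have h1 := Submodule.finrank_add_eq_of_isCompl hW
    have h2 : Module.finrank ℝ R = Module.finrank ℝ EG := LinearMap.finrank_range_of_inj (hinj x)
    omega
  set χ := extChartAt 𝓘(ℝ, EM) x with hχ
  set c := extChartAt 𝓘(ℝ, EG) (1 : G) with hc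
  let s : W → M := fun w => χ.symm (χ x + w)
  -- A transversal `s` through `x`, tangent to a complement `W` of the orbit directions, is swept
  -- out by the group near 1. The derivative at the centre is (w, ξ) ↦ w + ξ_M(x), which is
  -- bijective.
  let F0 : W × EG → M := fun q => op (c.symm q.2) • s q.1
  set a : W × EG := (0, c 1) with ha
  have hs0 : s 0 = x := by simp only [s, ZeroMemClass.coe_zero, add_zero]; exact extChartAt_to_inv x
  have hc1 : c.symm (c 1) = 1 := extChartAt_to_inv 1
  have hF0a : F0 a = x := by simp only [F0, a, hs0, hc1, op_one, one_smul]
  have hχt : χ x ∈ χ.target := mem_extChartAt_target x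
  have hct : c 1 ∈ c.target := mem_extChartAt_target 1
  have hssm : ∀ w : W, χ x + w ∈ χ.target → ContMDiffAt 𝓘(ℝ, W) 𝓘(ℝ, EM) ∞ s w := fun w hw =>
    (contMDiffAt_extChartAt_symm_of_mem x hw).comp w
      (contDiff_const.add W.subtypeL.contDiff).contMDiff.contMDiffAt
  have hgsm : ∀ u : EG, u ∈ c.target → ContMDiffAt 𝓘(ℝ, EG) 𝓘(ℝ, EG) ∞ c.symm u := fun u hu =>
    contMDiffAt_extChartAt_symm_of_mem 1 hu
  have hF0sm : ∀ q : W × EG, χ x + q.1 ∈ χ.target → q.2 ∈ c.target →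
      ContMDiffAt 𝓘(ℝ, W × EG) 𝓘(ℝ, EM) ∞ F0 q := fun q h1 h2 =>
    h.smooth.contMDiffAt.comp q
      (((hssm q.1 h1).comp q contDiff_fst.contMDiff.contMDiffAt).prodMk
        ((hgsm q.2 h2).comp q contDiff_snd.contMDiff.contMDiffAt))
  have hF0a' := hF0sm a (by simpa only [a, ZeroMemClass.coe_zero, add_zero] using hχt) hct
  have hev : ∀ᶠ q in 𝓝 a, χ x + q.1 ∈ χ.target ∧ q.2 ∈ c.target ∧ F0 q ∈ χ.source := by
    refine Filter.Eventually.and ?_ (Filter.Eventually.and ?_ ?_)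
    · have : Continuous fun q : W × EG => χ x + (q.1 : EM) := by fun_prop
      refine this.continuousAt ((isOpen_extChartAt_target x).mem_nhds ?_)
      simpa only [a, ZeroMemClass.coe_zero, add_zero] using hχt
    · exact continuous_snd.continuousAt ((isOpen_extChartAt_target (1 : G)).mem_nhds hct)
    · refine hF0a'.continuousAt ((isOpen_extChartAt_source x).mem_nhds ?_)
      rw [hF0a]; exact mem_extChartAt_source x
  let F : W × EG → EM := χ ∘ F0
  have hFsm : ∀ᶠ q in 𝓝 a, ContDiffAt ℝ ∞ F q := by
    filter_upwards [hev] with q hq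
    exact ((contMDiffAt_extChartAt_of_mem x hq.2.2).comp q (hF0sm q hq.1 hq.2.1)).contDiffAt
  have hinl : mder 𝓘(ℝ, W) 𝓘(ℝ, EM) (fun w => F0 (w, c 1)) 0 = W.subtypeL := by
    have h1 : (fun w => F0 (w, c 1)) = χ.symm ∘ fun w : W => χ x + w := by
      funext w; simp only [F0, hc1, op_one, one_smul, s, Function.comp]
    have h2 : ContDiff ℝ ∞ fun w : W => χ x + (w : EM) := contDiff_const.add W.subtypeL.contDiff
    rw [h1, mder_comp (I' := 𝓘(ℝ, EM))]
    · have h3 : mder 𝓘(ℝ, W) 𝓘(ℝ, EM) (fun w : W => χ x + (w : EM)) 0 = W.subtypeL := by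
        rw [mder_eq_fderiv, fderiv_const_add]
        exact W.subtypeL.fderiv
      rw [h3]
      simp only [ZeroMemClass.coe_zero, add_zero]
      rw [mder_extChartAt_symm_self]
      rfl
    · simp only [ZeroMemClass.coe_zero, add_zero]
      exact (contMDiffAt_extChartAt_symm_of_mem x hχt).mdifferentiableAt (by simp)
    · exact h2.contMDiff.contMDiffAt.mdifferentiableAt (by simp)
  have hinr : mder 𝓘(ℝ, EG) 𝓘(ℝ, EM) (fun u => F0 (0, u)) (c 1) = infActL G x := by
    have h1 : (fun u => F0 (0, u)) = (fun g : G => op g • x) ∘ c.symm := by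
      funext u; simp only [F0, hs0, Function.comp]
    rw [h1, mder_comp (I' := 𝓘(ℝ, EG)) (h.mdiff_orbit _ x) ((hgsm _ hct).mdifferentiableAt (by simp)),
      mder_extChartAt_symm_self, hc1]
    rfl
  have hF0d : ∀ q : W × EG, mder 𝓘(ℝ, W × EG) 𝓘(ℝ, EM) F0 a q = q.1 + (infActL G x : EG →L[ℝ] EM) q.2 := by
    intro q
    have hmd := hF0a'.mdifferentiableAt (by simp)
    have e1 := mder_comp (f := fun w : W => (w, c 1)) (x := 0) (I := 𝓘(ℝ, W)) hmd
      ((contDiff_prodMk_left (𝕜 := ℝ) (n := ∞) (c 1)).contMDiff.contMDiffAt.mdifferentiableAt (by simp))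
    have e2 := mder_comp (f := fun u : EG => ((0 : W), u)) (x := c 1) (I := 𝓘(ℝ, EG)) hmd
      ((contDiff_prodMk_right (𝕜 := ℝ) (n := ∞) (0 : W)).contMDiff.contMDiffAt.mdifferentiableAt (by simp))
    rw [mder_eq_fderiv (f := fun w : W => (w, c 1)), (hasFDerivAt_prodMk_left _ _).fderiv] at e1
    rw [mder_eq_fderiv (f := fun u : EG => ((0 : W), u)), (hasFDerivAt_prodMk_right _ _).fderiv] at e2
    have e1' := congrArg (fun T : W →L[ℝ] EM => T q.1) (e1.symm.trans hinl)
    have e2' := congrArg (fun T : EG →L[ℝ] EM => T q.2) (e2.symm.trans hinr)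
    have hq : q = (q.1, 0) + (0, q.2) := by simp
    rw [hq, map_add]
    simpa using! congrArg₂ (· + ·) e1' e2'
  have hFd : fderiv ℝ F a = mder 𝓘(ℝ, W × EG) 𝓘(ℝ, EM) F0 a := by
    rw [← mder_eq_fderiv, mder_comp (I' := 𝓘(ℝ, EM)), hF0a, mder_extChartAt_self]
    · rfl
    · rw [hF0a]
      exact (contMDiffAt_extChartAt_of_mem x (mem_extChartAt_source x)).mdifferentiableAt (by simp)
    · exact hF0a'.mdifferentiableAt (by simp)
  have hinjF : Function.Injective (fderiv ℝ F a) := by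
    refine (injective_iff_map_eq_zero _).2 fun q hq => ?_
    rw [hFd, hF0d] at hq
    have h1 : (q.1 : EM) ∈ R := ⟨-q.2, by
      change (infActL G x : EG →L[ℝ] EM) (-q.2) = _
      rw [map_neg]; exact (eq_neg_of_add_eq_zero_left hq).symm⟩
    have h2 : (q.1 : EM) = 0 := Submodule.disjoint_def.1 hW.disjoint _ h1 q.1.2
    rw [h2, zero_add] at hq
    exact Prod.ext (Subtype.ext h2) (hinj x (hq.trans (map_zero _).symm))
  have hbij : Function.Bijective (fderiv ℝ F a) :=
    ⟨hinjF, (LinearMap.injective_iff_surjective_of_finrank_eq_finrank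
      (by rw [hdim, Module.finrank_prod]) (f := (fderiv ℝ F a).toLinearMap)).1 hinjF⟩
  obtain ⟨e, hae, hcoe, hes, het⟩ := exists_openPartialHomeomorph_of_fderiv hFsm hbij
  obtain ⟨A, B, hA, haA, hB, haB, hAB⟩ :=
    mem_nhds_prod_iff'.1 (Filter.Eventually.and (e.open_source.mem_nhds hae) hev)
  let ψ0 := (vectorChart 𝓘(ℝ, EM) x).trans e.symm
  have hψ0s : ∀ y, y ∈ ψ0.source ↔ y ∈ χ.source ∧ χ y ∈ e.target := fun y => by
    rw [hχ, ← vectorChart_source]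
    simp only [ψ0, OpenPartialHomeomorph.trans_source]
    rfl
  have hψ0F : ∀ q ∈ A ×ˢ B, F0 q ∈ ψ0.source ∧ ψ0 (F0 q) = q := by
    intro q hq
    obtain ⟨h1, -, -, h2⟩ := hAB hq
    have h3 : χ (F0 q) = e q := (hcoe q).symm
    refine ⟨(hψ0s _).2 ⟨h2, by rw [h3]; exact e.map_source h1⟩, ?_⟩
    change e.symm (χ (F0 q)) = q
    rw [h3, e.left_inv h1]
  have haAB : a ∈ A ×ˢ B := ⟨haA, haB⟩
  have hψ0x : ψ0 x = a := by have := (hψ0F a haAB).2; rwa [hF0a] at this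
  have hxψ0 : x ∈ ψ0.source := by have := (hψ0F a haAB).1; rwa [hF0a] at this
  have hFψ0 : ∀ y ∈ ψ0.source, ψ0 y ∈ A ×ˢ B → F0 (ψ0 y) = y := by
    intro y hy hyAB
    exact ψ0.injOn (hψ0F _ hyAB).1 hy (hψ0F _ hyAB).2
  have hcont : ContinuousAt (fun q : EG × G => c.symm q.1 * q.2) (c 1, 1) := by
    have h1 : ContinuousAt c.symm (c 1) := (hgsm _ hct).continuousAt
    have hmul : Continuous fun q : G × G => q.1 * q.2 := (contMDiff_mul 𝓘(ℝ, EG) ∞).continuous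
    exact ContinuousAt.comp (g := fun q : G × G => q.1 * q.2) (f := fun q : EG × G => (c.symm q.1, q.2))
      hmul.continuousAt ((ContinuousAt.comp (x := ((c 1, 1) : EG × G)) h1 continuousAt_fst).prodMk continuousAt_snd)
  have hev2 : ∀ᶠ q in 𝓝 ((c 1, 1) : EG × G), c.symm q.1 * q.2 ∈ c.source ∧
      c (c.symm q.1 * q.2) ∈ B := by
    have h0 : c.symm (c 1) * 1 = 1 := by rw [hc1, mul_one]
    have h1 : ∀ᶠ g in 𝓝 (1 : G), g ∈ c.source ∧ c g ∈ B :=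
      Filter.Eventually.and (extChartAt_source_mem_nhds 1)
        ((continuousAt_extChartAt 1) (hB.mem_nhds haB))
    refine hcont.eventually (p := fun g => g ∈ c.source ∧ c g ∈ B) ?_
    change ∀ᶠ g in 𝓝 (c.symm (c 1) * 1), _
    rw [h0]; exact h1
  obtain ⟨B0, V, hB0, hcB0, hV, h1V, hBV⟩ := mem_nhds_prod_iff'.1 hev2
  -- Properness excludes that an orbit returns to `U` by an element far from 1. An element `k`
  -- joining two points of `U` lies in `V`, so that the product of the group coordinate with `k`
  -- remains in the chart and in the box `A ×ˢ B`.
  obtain ⟨U, hU, hUV⟩ := h.exists_nhds x (hV.mem_nhds h1V)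
  have hAB0 : IsOpen (A ×ˢ (B ∩ B0)) := hA.prod (hB.inter hB0)
  let ψ := ψ0.restrOpen (interior U ∩ (ψ0.source ∩ ψ0 ⁻¹' (A ×ˢ (B ∩ B0))))
    (isOpen_interior.inter (ψ0.isOpen_inter_preimage hAB0))
  have hψs : ∀ y, y ∈ ψ.source → y ∈ ψ0.source ∧ y ∈ U ∧ ψ0 y ∈ A ×ˢ (B ∩ B0) := by
    rintro y ⟨h1, h2, h3, h4⟩
    exact ⟨h1, interior_subset h2, h4⟩
  have hxψ : x ∈ ψ.source := by
    refine ⟨hxψ0, mem_interior_iff_mem_nhds.2 hU, hxψ0, ?_⟩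
    rw [Set.mem_preimage, hψ0x]; exact ⟨haA, haB, hcB0⟩
  have hψ0sm : ∀ y ∈ ψ0.source, ContMDiffAt 𝓘(ℝ, EM) 𝓘(ℝ, W × EG) ∞ ψ0 y := by
    intro y hy
    obtain ⟨h1, h2⟩ := (hψ0s y).1 hy
    exact (het _ h2).contMDiffAt.comp y (contMDiffAt_extChartAt_of_mem x h1)
  have hFψ : ∀ y ∈ ψ.source, F0 (ψ y) = y := by
    intro y hy
    obtain ⟨h1, -, h3⟩ := hψs y hy
    exact hFψ0 y h1 ⟨h3.1, h3.2.1⟩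
  refine ⟨W, ψ, hdim, hxψ, ?_, ?_, ?_, ?_, ?_⟩
  · exact fun y hy => (hψ0sm y (hψs y hy).1).contMDiffWithinAt
  · intro q hq
    have h1 : ψ.symm q ∈ ψ.source := ψ.map_target hq
    obtain ⟨h2, -, h3⟩ := hψs _ h1
    have h4 : ψ (ψ.symm q) = q := ψ.right_inv hq
    change ψ (ψ.symm q) ∈ _ at h3
    rw [h4] at h3
    obtain ⟨-, h5, h6, h7⟩ := hAB (show q ∈ A ×ˢ B from ⟨h3.1, h3.2.1⟩)
    refine ((hF0sm q h5 h6).contMDiffWithinAt).congr_of_eventuallyEq ?_ ?_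
    · filter_upwards [self_mem_nhdsWithin] with q' hq'
      have := hFψ _ (ψ.map_target hq')
      rwa [ψ.right_inv hq', eq_comm] at this
    · have := hFψ _ (ψ.map_target hq)
      rwa [ψ.right_inv hq, eq_comm] at this
  · exact congrArg Prod.snd hψ0x
  · intro y hy z hz k
    constructor
    · intro hyz
      obtain ⟨hy1, hy2, hy3⟩ := hψs y hy
      obtain ⟨hz1, hz2, hz3⟩ := hψs z hz
      have hk : k ∈ V := hUV y hy2 k (hyz ▸ hz2)
      obtain ⟨hk1, hk2⟩ := hBV (show ((ψ y).2, k) ∈ B0 ×ˢ V from ⟨hy3.2.2, hk⟩)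
      -- The point y k has the same transversal coordinate as `y` and group coordinate multiplied by
      -- `k`; injectivity of the coordinates identifies it with the coordinates of `z`.
      have h1 : z = F0 ((ψ y).1, c (c.symm (ψ y).2 * k)) := by
        have : F0 ((ψ y).1, c (c.symm (ψ y).2 * k)) = op k • F0 (ψ y) := by
          simp only [F0]
          rw [c.left_inv hk1, op_mul, mul_smul]
        rw [this, hFψ y hy, hyz]
      have h2 : ψ z = ((ψ y).1, c (c.symm (ψ y).2 * k)) := by
        have := (hψ0F ((ψ y).1, c (c.symm (ψ y).2 * k)) ⟨hy3.1, hk2⟩).2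
        rwa [← h1] at this
      rw [h2]
      exact ⟨rfl, c.left_inv hk1⟩
    · rintro ⟨h1, h2⟩
      rw [← hFψ y hy, ← hFψ z hz]
      simp only [F0]
      rw [h2, op_mul, mul_smul, h1]
  · intro v hv
    have hmd : MDifferentiableAt 𝓘(ℝ, EM) 𝓘(ℝ, W × EG) ψ x := (hψ0sm x hxψ0).mdifferentiableAt (by simp)
    have hψx : ψ x = a := hψ0x
    -- Differentiating F0 ∘ ψ = id expresses `v` as its transversal part plus a fundamental vector;
    -- the first part vanishes by assumption.
    have h1 : mder 𝓘(ℝ, EM) 𝓘(ℝ, EM) (F0 ∘ ψ) x = ContinuousLinearMap.id ℝ EM := by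
      rw [mder_congr (f' := id), mder_id]
      filter_upwards [ψ.open_source.mem_nhds hxψ] with y hy
      exact hFψ y hy
    rw [mder_comp (I' := 𝓘(ℝ, W × EG)) (by rw [hψx]; exact hF0a'.mdifferentiableAt (by simp)) hmd, hψx] at h1
    have h2 := congrArg (fun T : EM →L[ℝ] EM => T v) h1
    change mder 𝓘(ℝ, W × EG) 𝓘(ℝ, EM) F0 a (mder 𝓘(ℝ, EM) 𝓘(ℝ, W × EG) ψ x v) = v at h2
    rwa [hF0d, hv, ZeroMemClass.coe_zero, zero_add] at h2

end Slices

/-! ### Quotients by the stabilizer of an affine action. -/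

section SubgroupQuotients

variable {EG G EM M V : Type*} [NormedAddCommGroup EG] [NormedSpace ℝ EG] [TopologicalSpace G]
  [ChartedSpace EG G] [Group G] [NormedAddCommGroup EM] [NormedSpace ℝ EM] [TopologicalSpace M]
  [ChartedSpace EM M] [MulAction Gᵐᵒᵖ M] [NormedAddCommGroup V] [NormedSpace ℝ V]

variable (EG) in
/-- A smooth map from a Lie group to a vector space that is equivariant for an affine action of the
group. -/
structure IsAffineOrbitMap (κ : G → V) : Prop where
  smooth : ContMDiff 𝓘(ℝ, EG) 𝓘(ℝ, V) ∞ κ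
  equivariant : ∀ g : G, ∃ (L : V →L[ℝ] V) (c : V), Function.Injective L ∧
    ∀ h : G, κ (g * h) = L (κ h) + c

/-- Left translation by `g` changes the values by an injective affine map, so `g` can be cancelled:
the fibres of κ are the left cosets of the stabilizer. -/
theorem IsAffineOrbitMap.eq_iff {κ : G → V} (hκ : IsAffineOrbitMap EG κ) (g k : G) :
    κ g = κ (g * k) ↔ κ k = κ 1 := by
  obtain ⟨L, c, hL, h⟩ := hκ.equivariant g
  have h1 := h 1
  rw [mul_one] at h1
  rw [h1, h k, add_left_inj, hL.eq_iff, eq_comm]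

/-- Differentiating κ(gh) = L κ(h) + c at h = 1 gives T_gκ ∘ T₁(left translation) = L ∘ T₁κ, with a
surjective factor on the left and an injective one on the right. The constancy of the rank replaces
the closed subgroup theorem for the stabilizer. -/
theorem IsAffineOrbitMap.finrank_range [FiniteDimensional ℝ EG] [LieGroup 𝓘(ℝ, EG) ∞ G]
    {κ : G → V} (hκ : IsAffineOrbitMap EG κ) (g : G) :
    Module.finrank ℝ (LinearMap.range (mder 𝓘(ℝ, EG) 𝓘(ℝ, V) κ g).toLinearMap) =
      Module.finrank ℝ (LinearMap.range (mder 𝓘(ℝ, EG) 𝓘(ℝ, V) κ 1).toLinearMap) := by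
  obtain ⟨L, c, hL, h⟩ := hκ.equivariant g
  have hmul : ∀ a x : G, MDifferentiableAt 𝓘(ℝ, EG) 𝓘(ℝ, EG) (fun y : G => a * y) x := fun a x =>
    ((contMDiff_const.mul contMDiff_id : ContMDiff 𝓘(ℝ, EG) 𝓘(ℝ, EG) ∞ (fun y : G => a * y)) x).mdifferentiableAt
      (by simp)
  have hκd : ∀ x, MDifferentiableAt 𝓘(ℝ, EG) 𝓘(ℝ, V) κ x := fun x =>
    (hκ.smooth x).mdifferentiableAt (by simp)
  have e1 := mder_comp (f := fun y : G => g * y) (x := 1) (hκd (g * 1)) (hmul g 1)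
  have e2 := mder_comp (g := fun v : V => L v + c) (f := κ) (x := 1) (I'' := 𝓘(ℝ, V))
    ((L.contDiff.add contDiff_const).contMDiff.contMDiffAt.mdifferentiableAt (n := ∞) (by simp)) (hκd 1)
  have e3 : (κ ∘ fun y : G => g * y) = (fun v : V => L v + c) ∘ κ := funext fun y => h y
  have e4 : mder 𝓘(ℝ, V) 𝓘(ℝ, V) (fun v : V => L v + c) (κ 1) = L := by
    rw [mder_eq_fderiv, fderiv_add_const, ContinuousLinearMap.fderiv]
  rw [mul_one] at e1
  rw [e4, ← e3, e1] at e2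
  have e5 := mder_comp (g := fun y : G => g * y) (f := fun y : G => g⁻¹ * y) (x := g) (I := 𝓘(ℝ, EG))
    (hmul g _) (hmul g⁻¹ g)
  have e6 : ((fun y : G => g * y) ∘ fun y : G => g⁻¹ * y) = id := by funext y; simp
  rw [e6, mder_id, inv_mul_cancel] at e5
  have hsurj : LinearMap.range (mder 𝓘(ℝ, EG) 𝓘(ℝ, EG) (fun y : G => g * y) 1).toLinearMap = ⊤ :=
    LinearMap.range_eq_top.2 fun v => ⟨mder 𝓘(ℝ, EG) 𝓘(ℝ, EG) (fun y : G => g⁻¹ * y) g v,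
      (congrArg (fun T : EG →L[ℝ] EG => T v) e5).symm⟩
  have e7 : (mder 𝓘(ℝ, EG) 𝓘(ℝ, V) κ g).toLinearMap.comp
      (mder 𝓘(ℝ, EG) 𝓘(ℝ, EG) (fun y : G => g * y) 1).toLinearMap =
      L.toLinearMap.comp (mder 𝓘(ℝ, EG) 𝓘(ℝ, V) κ 1).toLinearMap := by
    ext v; exact congrArg (fun T : EG →L[ℝ] V => T v) e2
  rw [← LinearMap.range_comp_of_range_eq_top _ hsurj, e7, LinearMap.range_comp]
  exact (LinearEquiv.finrank_eq (Submodule.equivMapOfInjective L.toLinearMap hL _)).symm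

variable (EG EM) in
/-- The dimension of the quotient by the stabilizer of an affine action. -/
def quotientDim (κ : G → V) : ℕ := (Module.finrank ℝ EM - Module.finrank ℝ EG) +
  Module.finrank ℝ (LinearMap.range (mder 𝓘(ℝ, EG) 𝓘(ℝ, V) κ 1).toLinearMap)

/-- A submersion separating the orbits of a stabilizer near `x`, with the tangent spaces of the orbits
as kernels. -/
theorem IsFreeProperAction.exists_separating_submersion [FiniteDimensional ℝ EG]
    [FiniteDimensional ℝ EM] [FiniteDimensional ℝ V] [LieGroup 𝓘(ℝ, EG) ∞ G]
    [IsManifold 𝓘(ℝ, EM) ∞ M] [T2Space M] (h : IsFreeProperAction EG G EM M)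
    (hinj : ∀ m : M, Function.Injective (infActL G m : EG →L[ℝ] EM)) {κ : G → V}
    (hκ : IsAffineOrbitMap EG κ) {s : Setoid M}
    (hs : ∀ y z, s.r y z ↔ ∃ k : G, κ k = κ 1 ∧ op k • y = z) (x : M) :
    quotientDim EG EM κ ≤ Module.finrank ℝ EM ∧
    ∃ f : M → EuclideanSpace ℝ (Fin (quotientDim EG EM κ)),
      (∀ᶠ y in 𝓝 x, ContMDiffAt 𝓘(ℝ, EM) (𝓡 (quotientDim EG EM κ)) ∞ f y) ∧
      Function.Surjective (mder 𝓘(ℝ, EM) (𝓡 (quotientDim EG EM κ)) f x) ∧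
      (∃ U ∈ 𝓝 x, ∀ y ∈ U, ∀ z ∈ U, s.r y z ↔ f y = f z) ∧
      ∀ v, mder 𝓘(ℝ, EM) (𝓡 (quotientDim EG EM κ)) f x v = 0 →
        ∃ ξ : EG, mder 𝓘(ℝ, EG) 𝓘(ℝ, V) κ 1 ξ = 0 ∧ (infActL G x : EG →L[ℝ] EM) ξ = v := by
  obtain ⟨W, ψ, hdim, hxψ, hψ, hψs, hψx, hrel, hker⟩ := h.exists_slice hinj x
  set c := extChartAt 𝓘(ℝ, EG) (1 : G) with hc
  have hc1 : c.symm (c 1) = 1 := extChartAt_to_inv 1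
  have hct : c 1 ∈ c.target := mem_extChartAt_target 1
  let κ' : EG → V := κ ∘ c.symm
  have hκ' : ∀ u ∈ c.target, ContDiffAt ℝ ∞ κ' u := fun u hu =>
    ((hκ.smooth _).comp u (contMDiffAt_extChartAt_symm_of_mem 1 hu)).contDiffAt
  have hd : ∀ u ∈ c.target, fderiv ℝ κ' u = (mder 𝓘(ℝ, EG) 𝓘(ℝ, V) κ (c.symm u)).comp
      (mder 𝓘(ℝ, EG) 𝓘(ℝ, EG) c.symm u) := fun u hu => by
    rw [← mder_eq_fderiv]
    exact mder_comp ((hκ.smooth _).mdifferentiableAt (by simp))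
      ((contMDiffAt_extChartAt_symm_of_mem 1 hu).mdifferentiableAt (by simp))
  have hd1 : fderiv ℝ κ' (c 1) = mder 𝓘(ℝ, EG) 𝓘(ℝ, V) κ 1 := by
    rw [hd _ hct, mder_extChartAt_symm_self, hc1]; rfl
  have hrank : ∀ u ∈ c.target, Module.finrank ℝ (LinearMap.range (fderiv ℝ κ' u).toLinearMap) =
      Module.finrank ℝ (LinearMap.range (mder 𝓘(ℝ, EG) 𝓘(ℝ, V) κ 1).toLinearMap) := fun u hu => by
    rw [← hκ.finrank_range (c.symm u), hd u hu]
    have h1 := mder_symm_comp_mder_extChartAt (I := 𝓘(ℝ, EG)) (1 : G) (c.map_target hu)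
    change (mder 𝓘(ℝ, EG) 𝓘(ℝ, EG) c.symm (c (c.symm u))).comp _ = _ at h1
    rw [c.right_inv hu] at h1
    have hsurj : LinearMap.range (mder 𝓘(ℝ, EG) 𝓘(ℝ, EG) c.symm u).toLinearMap = ⊤ :=
      LinearMap.range_eq_top.2 fun v => ⟨_, congrArg (fun T : EG →L[ℝ] EG => T v) h1⟩
    exact congrArg (fun S : Submodule ℝ V => Module.finrank ℝ S)
      (LinearMap.range_comp_of_range_eq_top (mder 𝓘(ℝ, EG) 𝓘(ℝ, V) κ (c.symm u)).toLinearMap hsurj)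
  have hto : ∀ᶠ u in 𝓝 (c 1), u ∈ c.target := (isOpen_extChartAt_target (1 : G)).mem_nhds hct
  -- The rank is renamed `r`, which keeps the type of `L` free of the chart expression κ'.
  obtain ⟨r, hr, L, hL1, hL2, U, hU, hUL⟩ : ∃ r : ℕ,
      r = Module.finrank ℝ (LinearMap.range (mder 𝓘(ℝ, EG) 𝓘(ℝ, V) κ 1).toLinearMap) ∧
      ∃ L : V →L[ℝ] EuclideanSpace ℝ (Fin r),
        (∀ u, ∃ ξ, L (mder 𝓘(ℝ, EG) 𝓘(ℝ, V) κ 1 ξ) = u) ∧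
        (∀ v, L (mder 𝓘(ℝ, EG) 𝓘(ℝ, V) κ 1 v) = 0 → mder 𝓘(ℝ, EG) 𝓘(ℝ, V) κ 1 v = 0) ∧
        ∃ U ∈ 𝓝 (c 1), ∀ y ∈ U, ∀ z ∈ U, L (κ' y) = L (κ' z) → κ' y = κ' z := by
    obtain ⟨L, hL1, hL2, hL3⟩ := exists_projection_of_finrank_range_eq
      (hto.mono fun u hu => hκ' u hu)
      (hto.mono fun u hu => (hrank u hu).trans (hrank _ hct).symm)
    refine ⟨_, hrank _ hct, L, fun u => ?_, fun v hv => ?_, hL3⟩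
    · obtain ⟨ξ, hξ⟩ := hL1 u
      exact ⟨ξ, (congrArg (fun T : EG →L[ℝ] V => L (T ξ)) hd1).symm.trans hξ⟩
    · exact (congrArg (fun T : EG →L[ℝ] V => T v) hd1).symm.trans
        (hL2 v ((congrArg (fun T : EG →L[ℝ] V => L (T v)) hd1).trans hv))
  have hrle : r ≤ Module.finrank ℝ EG := hr ▸ LinearMap.finrank_range_le _
  -- By the slice, dim M − dim G is the dimension of the transversal `W`, without truncation.
  have hqd : quotientDim EG EM κ = Module.finrank ℝ W + r := by
    rw [quotientDim, ← hr]; omega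
  refine ⟨by omega, ?_⟩
  let ι : (W × EuclideanSpace ℝ (Fin r)) ≃L[ℝ] EuclideanSpace ℝ (Fin (quotientDim EG EM κ)) :=
    ContinuousLinearEquiv.ofFinrankEq (by rw [Module.finrank_prod, hqd]; simp)
  -- The transversal coordinate separates the orbits of the whole group, and κ of the group
  -- coordinate separates the cosets of the stabilizer. The projection `L` makes the derivative of
  -- the second component surjective without merging nearby fibres.
  let f0 : W × EG → W × EuclideanSpace ℝ (Fin r) := fun q => (q.1, L (κ' q.2))
  have hf0 : ∀ q : W × EG, q.2 ∈ c.target → ContDiffAt ℝ ∞ f0 q := fun q hq =>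
    contDiffAt_fst.prodMk (L.contDiff.contDiffAt.comp q ((hκ' _ hq).comp q contDiffAt_snd))
  have hψx' : (ψ x).2 ∈ c.target := hψx ▸ hct
  have hsm : ∀ᶠ y in 𝓝 x, y ∈ ψ.source ∧ (ψ y).2 ∈ c.target := by
    refine Filter.Eventually.and (ψ.open_source.mem_nhds hxψ) ?_
    exact (continuous_snd.continuousAt.comp (ψ.continuousAt hxψ))
      ((isOpen_extChartAt_target (1 : G)).mem_nhds hψx')
  have hψd : MDifferentiableAt 𝓘(ℝ, EM) 𝓘(ℝ, W × EG) ψ x :=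
    (hψ.contMDiffAt (ψ.open_source.mem_nhds hxψ)).mdifferentiableAt (by simp)
  have hf0d : ∀ q, fderiv ℝ f0 (ψ x) q = (q.1, L (mder 𝓘(ℝ, EG) 𝓘(ℝ, V) κ 1 q.2)) := by
    intro q
    have h1 : HasFDerivAt f0 ((ContinuousLinearMap.fst ℝ W EG).prod
        (L.comp ((fderiv ℝ κ' (ψ x).2).comp (ContinuousLinearMap.snd ℝ W EG)))) (ψ x) :=
      hasFDerivAt_fst.prodMk (L.hasFDerivAt.comp _
        (((hκ' _ hψx').differentiableAt (by simp)).hasFDerivAt.comp _ hasFDerivAt_snd))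
    rw [h1.fderiv, hψx, hd1]
    rfl
  have hfd : mder 𝓘(ℝ, EM) (𝓡 (quotientDim EG EM κ)) (ι ∘ f0 ∘ ψ) x =
      (ι : _ →L[ℝ] _).comp ((fderiv ℝ f0 (ψ x)).comp (mder 𝓘(ℝ, EM) 𝓘(ℝ, W × EG) ψ x)) := by
    have hm : MDifferentiableAt 𝓘(ℝ, W × EG) 𝓘(ℝ, W × EuclideanSpace ℝ (Fin r)) f0 (ψ x) :=
      ((hf0 _ hψx').differentiableAt (by simp)).mdifferentiableAt
    rw [mder_comp (I' := 𝓘(ℝ, W × EuclideanSpace ℝ (Fin r)))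
        (ι.differentiable.differentiableAt.mdifferentiableAt) (hm.comp x hψd),
      mder_comp (I' := 𝓘(ℝ, W × EG)) hm hψd, mder_eq_fderiv, mder_eq_fderiv,
      ContinuousLinearEquiv.fderiv]
  refine ⟨ι ∘ f0 ∘ ψ, ?_, ?_, ?_, ?_⟩
  · filter_upwards [hsm] with y hy
    exact ι.contDiff.contMDiff.contMDiffAt.comp y ((hf0 _ hy.2).contMDiffAt.comp y
      (hψ.contMDiffAt (ψ.open_source.mem_nhds hy.1)))
  · rw [hfd]
    have hψsurj : Function.Surjective (mder 𝓘(ℝ, EM) 𝓘(ℝ, W × EG) ψ x) := by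
      have hs : MDifferentiableAt 𝓘(ℝ, W × EG) 𝓘(ℝ, EM) ψ.symm (ψ x) :=
        (hψs.contMDiffAt (ψ.open_target.mem_nhds (ψ.map_source hxψ))).mdifferentiableAt (by simp)
      exact mder_surjective_of_localSection hψd hs (ψ.left_inv hxψ) (by
        filter_upwards [ψ.open_target.mem_nhds (ψ.map_source hxψ)] with q hq
        exact ψ.right_inv hq)
    have hf0s : Function.Surjective (fderiv ℝ f0 (ψ x)) := by
      rintro ⟨w, u⟩
      obtain ⟨ξ, hξ⟩ := hL1 u
      exact ⟨(w, ξ), (hf0d _).trans (Prod.ext rfl hξ)⟩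
    exact ι.surjective.comp (hf0s.comp hψsurj)
  · have hU' : U ∈ 𝓝 (ψ x).2 := by rw [hψx]; exact hU
    refine ⟨ψ.source ∩ (fun y => (ψ y).2) ⁻¹' U, Filter.inter_mem (ψ.open_source.mem_nhds hxψ)
      ((continuous_snd.continuousAt.comp (ψ.continuousAt hxψ)) hU'), ?_⟩
    rintro y ⟨hy, hyU⟩ z ⟨hz, hzU⟩
    rw [hs]
    have h1 : (ι ∘ f0 ∘ ψ) y = (ι ∘ f0 ∘ ψ) z ↔ (ψ y).1 = (ψ z).1 ∧ κ' (ψ y).2 = κ' (ψ z).2 := by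
      simp only [Function.comp, ι.injective.eq_iff, f0, Prod.ext_iff]
      exact and_congr_right fun _ => ⟨hUL _ hyU _ hzU, fun h => by rw [h]⟩
    rw [h1]
    constructor
    · rintro ⟨k, hk, hyz⟩
      obtain ⟨h2, h3⟩ := (hrel y hy z hz k).1 hyz
      refine ⟨h2, ?_⟩
      simp only [κ', Function.comp]
      rw [h3, hκ.eq_iff]; exact hk
    · rintro ⟨h2, h3⟩
      set a := c.symm (ψ y).2
      set b := c.symm (ψ z).2
      have h4 : b = a * (a⁻¹ * b) := by group
      refine ⟨a⁻¹ * b, ?_, (hrel y hy z hz _).2 ⟨h2, h4⟩⟩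
      rw [← hκ.eq_iff a, ← h4]; exact h3
  · intro v hv
    rw [hfd] at hv
    have h1 : fderiv ℝ f0 (ψ x) (mder 𝓘(ℝ, EM) 𝓘(ℝ, W × EG) ψ x v) = 0 := ι.map_eq_zero_iff.1 hv
    rw [hf0d] at h1
    exact ⟨_, hL2 _ (congrArg Prod.snd h1), hker v (congrArg Prod.fst h1)⟩

theorem IsFreeProperAction.hasSmoothTransport (h : IsFreeProperAction EG G EM M) {K : Set G}
    {s : Setoid M} (hs : ∀ y z, s.r y z ↔ ∃ k : G, k ∈ K ∧ op k • y = z) :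
    HasSmoothTransport 𝓘(ℝ, EM) s := by
  intro y z hyz
  obtain ⟨k, hk, rfl⟩ := (hs y z).1 hyz
  have h1 : ContMDiff 𝓘(ℝ, EM) (𝓘(ℝ, EM).prod 𝓘(ℝ, EG)) ∞ (fun m : M => (m, k)) :=
    contMDiff_id.prodMk contMDiff_const
  exact ⟨fun y => op k • y, (h.smooth.comp h1).contMDiffAt, rfl,
    Filter.Eventually.of_forall fun z => (hs _ _).2 ⟨k, hk, rfl⟩⟩

/-- The quotient of a manifold by the stabilizer of an affine action is a manifold. -/
theorem IsFreeProperAction.nonempty_quotientManifold [FiniteDimensional ℝ EG]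
    [FiniteDimensional ℝ EM] [FiniteDimensional ℝ V] [LieGroup 𝓘(ℝ, EG) ∞ G]
    [IsManifold 𝓘(ℝ, EM) ∞ M] [T2Space M] [Nonempty M] (h : IsFreeProperAction EG G EM M)
    (hinj : ∀ m : M, Function.Injective (infActL G m : EG →L[ℝ] EM)) {κ : G → V}
    (hκ : IsAffineOrbitMap EG κ) {s : Setoid M}
    (hs : ∀ y z, s.r y z ↔ ∃ k : G, κ k = κ 1 ∧ op k • y = z) :
    Nonempty (QuotientManifold 𝓘(ℝ, EM) s) := by
  obtain ⟨x0⟩ := ‹Nonempty M›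
  have hle := (h.exists_separating_submersion hinj hκ hs x0).1
  let F := EuclideanSpace ℝ (Fin (Module.finrank ℝ EM - quotientDim EG EM κ))
  have hdim : Module.finrank ℝ EM =
      Module.finrank ℝ (EuclideanSpace ℝ (Fin (quotientDim EG EM κ))) + Module.finrank ℝ F := by
    simp only [F, finrank_euclideanSpace, Fintype.card_fin]
    omega
  refine MagneticReduction.nonempty_quotientManifold (F := F) (d := quotientDim EG EM κ)
    (ContinuousLinearEquiv.ofFinrankEq (hdim.trans Module.finrank_prod.symm))
    (h.hasSmoothTransport (K := {k | κ k = κ 1}) hs) fun x => ?_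
  obtain ⟨-, f, h1, h2, h3, -⟩ := h.exists_separating_submersion hinj hκ hs x
  exact exists_adaptedChart h1 h2 hdim h3

/-- The kernel of the derivative of the projection to the quotient consists of the values of the
infinitesimal action of the stabilizer. -/
theorem IsFreeProperAction.exists_of_mder_mk_eq_zero [FiniteDimensional ℝ EG]
    [FiniteDimensional ℝ EM] [FiniteDimensional ℝ V] [LieGroup 𝓘(ℝ, EG) ∞ G]
    [IsManifold 𝓘(ℝ, EM) ∞ M] [T2Space M] (h : IsFreeProperAction EG G EM M)
    (hinj : ∀ m : M, Function.Injective (infActL G m : EG →L[ℝ] EM)) {κ : G → V}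
    (hκ : IsAffineOrbitMap EG κ) {s : Setoid M}
    (hs : ∀ y z, s.r y z ↔ ∃ k : G, κ k = κ 1 ∧ op k • y = z)
    (Y : QuotientManifold 𝓘(ℝ, EM) s) (x : M) (v : EM)
    (hv : mder 𝓘(ℝ, EM) (𝓡 Y.dim) (Quotient.mk s) x v = 0) :
    ∃ ξ : EG, mder 𝓘(ℝ, EG) 𝓘(ℝ, V) κ 1 ξ = 0 ∧ (infActL G x : EG →L[ℝ] EM) ξ = v := by
  obtain ⟨-, f, h1, -, ⟨U, hU, h3⟩, h4⟩ := h.exists_separating_submersion hinj hκ hs x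
  refine h4 v ?_
  have hsub := Y.isSubmersion.isSubmersionAt x
  obtain ⟨σ, hσ1, hσ2, hσ3⟩ := exists_localSection hsub
  have hπ : MDifferentiableAt 𝓘(ℝ, EM) (𝓡 Y.dim) (Quotient.mk s) x :=
    hsub.contMDiffAt.mdifferentiableAt (by simp)
  have hσd := hσ1.self_of_nhds.mdifferentiableAt (by simp)
  have hfd : MDifferentiableAt 𝓘(ℝ, EM) (𝓡 (quotientDim EG EM κ)) f (σ (Quotient.mk s x)) := by
    rw [hσ2]; exact h1.self_of_nhds.mdifferentiableAt (by simp)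
  -- Near `x` the points `y` and σ[y] are equivalent and both lie in `U`, where `f` is constant on
  -- classes. Thus `f` factors through the projection, and its derivative annihilates the kernel of
  -- the latter.
  have heq : f =ᶠ[𝓝 x] f ∘ (σ ∘ Quotient.mk s) := by
    have hc : Filter.Tendsto (σ ∘ Quotient.mk s) (𝓝 x) (𝓝 x) := by
      have := (hσd.continuousAt.comp hπ.continuousAt : ContinuousAt (σ ∘ Quotient.mk s) x)
      have h5 : (σ ∘ Quotient.mk s) x = x := hσ2
      rw [ContinuousAt, h5] at this
      exact this
    filter_upwards [hU, hc hU, hπ.continuousAt.eventually hσ3] with y hy hy' hy''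
    exact (h3 y hy _ hy').1 (Quotient.exact hy''.symm)
  rw [mder_congr heq, mder_comp (g := f) (f := σ ∘ Quotient.mk s) (I' := 𝓘(ℝ, EM)) hfd (hσd.comp x hπ), mder_comp (I' := 𝓡 Y.dim) hσd hπ]
  simp only [ContinuousLinearMap.comp_apply, hv, map_zero]

end SubgroupQuotients

/-! ### Smoothness, pullback and exterior derivative of forms. -/

section SmoothForms

variable {E₀ E M E' M' : Type*} [NormedAddCommGroup E₀] [NormedSpace ℝ E₀]
  [NormedAddCommGroup E] [NormedSpace ℝ E] [TopologicalSpace M]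
  [ChartedSpace E M] [NormedAddCommGroup E'] [NormedSpace ℝ E'] [TopologicalSpace M']
  [ChartedSpace E' M'] {k : ℕ} {F F' : Type*} [NormedAddCommGroup F] [NormedSpace ℝ F]
  [NormedAddCommGroup F'] [NormedSpace ℝ F']

theorem finiteDimensional_continuousMultilinearMap [FiniteDimensional ℝ E] [FiniteDimensional ℝ F] :
    FiniteDimensional ℝ (ContinuousMultilinearMap ℝ (fun _ : Fin k => E) F) :=
  FiniteDimensional.of_injective
    (ContinuousMultilinearMap.toMultilinearMapLinear (R' := ℝ) (A := ℝ)
      (M₁ := fun _ : Fin k => E) (M₂ := F))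
    ContinuousMultilinearMap.toMultilinearMap_injective

/-- Alternating maps form a continuous direct summand of the multilinear maps. -/
theorem exists_retraction_continuousAlternatingMap [FiniteDimensional ℝ E] [FiniteDimensional ℝ F] :
    ∃ R : ContinuousMultilinearMap ℝ (fun _ : Fin k => E) F →L[ℝ] E [⋀^Fin k]→L[ℝ] F,
      ∀ η : E [⋀^Fin k]→L[ℝ] F, R η.toContinuousMultilinearMap = η := by
  have := finiteDimensional_continuousMultilinearMap (E := E) (F := F) (k := k)
  obtain ⟨R, hR⟩ := LinearMap.exists_leftInverse_of_injective
    (ContinuousAlternatingMap.toContinuousMultilinearMapLI (𝕜 := ℝ) (E := E) (F := F)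
      (ι := Fin k)).toLinearMap
    (LinearMap.ker_eq_bot.2 (LinearIsometry.injective _))
  exact ⟨R.toContinuousLinearMap, fun η => congrArg (fun T => T η) hR⟩

/-- For multilinear maps, precomposition is multilinear in the inner linear maps and linear in the
outer one, hence smooth. The retraction onto alternating maps transfers this to forms. -/
theorem contDiff_compContinuousLinearMap [FiniteDimensional ℝ E₀] [FiniteDimensional ℝ F] :
    ContDiff ℝ ∞ fun q : (E [⋀^Fin k]→L[ℝ] F) × (E₀ →L[ℝ] E) =>
      q.1.compContinuousLinearMap q.2 := by
  obtain ⟨R, hR⟩ := exists_retraction_continuousAlternatingMap (E := E₀) (F := F) (k := k)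
  have h1 : ContDiff ℝ ∞ fun q : (E [⋀^Fin k]→L[ℝ] F) × (E₀ →L[ℝ] E) =>
      ContinuousMultilinearMap.compContinuousLinearMapContinuousMultilinear ℝ
        (fun _ : Fin k => E₀) (fun _ => E) F (fun _ => q.2)
        (ContinuousAlternatingMap.toContinuousMultilinearMapLI (𝕜 := ℝ) (E := E) (F := F) q.1) :=
    ((ContinuousMultilinearMap.contDiff _).comp (contDiff_pi.2 fun _ => contDiff_snd)).clm_apply
      ((LinearIsometry.contDiff _).comp contDiff_fst)
  have h2 := R.contDiff.comp h1
  have h3 : (R ∘ fun q : (E [⋀^Fin k]→L[ℝ] F) × (E₀ →L[ℝ] E) =>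
      ContinuousMultilinearMap.compContinuousLinearMapContinuousMultilinear ℝ
        (fun _ : Fin k => E₀) (fun _ => E) F (fun _ => q.2)
        (ContinuousAlternatingMap.toContinuousMultilinearMapLI (𝕜 := ℝ) (E := E) (F := F) q.1)) =
      fun q => q.1.compContinuousLinearMap q.2 := funext fun q => hR (q.1.compContinuousLinearMap q.2)
  rwa [h3] at h2

theorem _root_.ContDiffAt.compContinuousAlternatingMap {X : Type*} [NormedAddCommGroup X]
    [NormedSpace ℝ X] {L : X → F →L[ℝ] F'}
    {η : X → E [⋀^Fin k]→L[ℝ] F} {x : X} (hL : ContDiffAt ℝ ∞ L x) (hη : ContDiffAt ℝ ∞ η x) :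
    ContDiffAt ℝ ∞ (fun x => (L x).compContinuousAlternatingMap (η x)) x := by
  have h : IsBoundedBilinearMap ℝ fun q : (F →L[ℝ] F') × (E [⋀^Fin k]→L[ℝ] F) =>
      q.1.compContinuousAlternatingMap q.2 :=
    { add_left := fun _ _ _ => rfl
      smul_left := fun _ _ _ => rfl
      add_right := fun L _ _ => ContinuousAlternatingMap.ext fun _ => map_add L _ _
      smul_right := fun _ L _ => ContinuousAlternatingMap.ext fun _ => map_smul L _ _
      bound := ⟨1, one_pos, fun L η => by
        rw [one_mul]; exact ContinuousLinearMap.norm_compContinuousAlternatingMap_le L η⟩ }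
  exact h.contDiff.contDiffAt.comp x (hL.prodMk hη)

/-- The value of a form at a point, as an alternating map on the model space. -/
def formAt (η : DiffForm E M k F) (x : M) : E [⋀^Fin k]→L[ℝ] F := η x

/-- The pullback of a form on a manifold along a map defined on a vector space. -/
def formAlong (φ : E₀ → M) (η : DiffForm E M k F) (u : E₀) : E₀ [⋀^Fin k]→L[ℝ] F :=
  (formAt η (φ u)).compContinuousLinearMap (mder 𝓘(ℝ, E₀) 𝓘(ℝ, E) φ u)

theorem formInChart_eq_formAlong (η : DiffForm E M k F) (x : M) :
    formInChart η x = formAlong (extChartAt 𝓘(ℝ, E) x).symm η := rfl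

theorem formAlong_congr {φ φ' : E₀ → M} {u : E₀} (η : DiffForm E M k F) (h : φ =ᶠ[𝓝 u] φ') :
    formAlong φ η =ᶠ[𝓝 u] formAlong φ' η := by
  filter_upwards [h.eventuallyEq_nhds] with v hv
  unfold formAlong
  rw [mder_congr hv, hv.self_of_nhds]

theorem formAlong_comp {φ : E₀ → M} {f : M → M'} (η : DiffForm E' M' k F) {u : E₀}
    (hf : MDifferentiableAt 𝓘(ℝ, E) 𝓘(ℝ, E') f (φ u))
    (hφ : MDifferentiableAt 𝓘(ℝ, E₀) 𝓘(ℝ, E) φ u) :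
    formAlong (f ∘ φ) η u = formAlong φ (pullbackForm f η : DiffForm E M k F) u := by
  unfold formAlong
  rw [mder_comp hf hφ]
  rfl

theorem IsSmoothForm.contDiffAt_formInChart {η : DiffForm E M k F} (hη : IsSmoothForm η) (x : M) {y : E}
    (hy : y ∈ (extChartAt 𝓘(ℝ, E) x).target) : ContDiffAt ℝ ∞ (formInChart η x) y :=
  (hη x).contDiffAt ((isOpen_extChartAt_target x).mem_nhds hy)

theorem IsSmoothForm.add {η₁ η₂ : DiffForm E M k F} (h₁ : IsSmoothForm η₁) (h₂ : IsSmoothForm η₂) :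
    IsSmoothForm (η₁ + η₂) := fun x => (h₁ x).add (h₂ x)

variable [IsManifold 𝓘(ℝ, E) ∞ M] [IsManifold 𝓘(ℝ, E') ∞ M']

/-- Near `u₀` the pullback along φ equals the pullback, between vector spaces, of the form written
in the one chart at φ(u₀). This reduces the claims about `formAlong` to calculus in vector spaces.
-/
theorem formAlong_eventuallyEq (η : DiffForm E M k F) {φ : E₀ → M} {u₀ : E₀}
    (hφ : ∀ᶠ u in 𝓝 u₀, ContMDiffAt 𝓘(ℝ, E₀) 𝓘(ℝ, E) ∞ φ u) :
    formAlong φ η =ᶠ[𝓝 u₀] fun u =>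
      (formInChart η (φ u₀) (extChartAt 𝓘(ℝ, E) (φ u₀) (φ u))).compContinuousLinearMap
        (fderiv ℝ (extChartAt 𝓘(ℝ, E) (φ u₀) ∘ φ) u) := by
  filter_upwards [hφ, hφ.self_of_nhds.continuousAt.eventually_mem
    (extChartAt_source_mem_nhds (I := 𝓘(ℝ, E)) (φ u₀))] with u hu hus
  set χ := extChartAt 𝓘(ℝ, E) (φ u₀)
  have h1 := mder_comp (g := χ) (f := φ) (x := u) (I := 𝓘(ℝ, E₀)) (I' := 𝓘(ℝ, E))
    ((contMDiffAt_extChartAt_of_mem _ hus).mdifferentiableAt (by simp)) (hu.mdifferentiableAt (by simp))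
  have h2 := mder_symm_comp_mder_extChartAt (I := 𝓘(ℝ, E)) (φ u₀) hus
  rw [← mder_eq_fderiv, h1]
  have h4 : mder 𝓘(ℝ, E₀) 𝓘(ℝ, E) φ u = (mder 𝓘(ℝ, E) 𝓘(ℝ, E) χ.symm (χ (φ u))).comp
      ((mder 𝓘(ℝ, E) 𝓘(ℝ, E) χ (φ u)).comp (mder 𝓘(ℝ, E₀) 𝓘(ℝ, E) φ u)) := by
    rw [← ContinuousLinearMap.comp_assoc, h2, ContinuousLinearMap.id_comp]
  change _ = (formAt η (χ.symm (χ (φ u)))).compContinuousLinearMap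
    ((mder 𝓘(ℝ, E) 𝓘(ℝ, E) χ.symm (χ (φ u))).comp
      ((mder 𝓘(ℝ, E) 𝓘(ℝ, E) χ (φ u)).comp (mder 𝓘(ℝ, E₀) 𝓘(ℝ, E) φ u)))
  rw [← h4, χ.left_inv hus]
  rfl

section

variable {η : DiffForm E M k F} {φ : E₀ → M} {u₀ : E₀}

theorem IsSmoothForm.contDiffAt_formAlong [FiniteDimensional ℝ E₀] [FiniteDimensional ℝ F]
    (hη : IsSmoothForm η)
    (hφ : ∀ᶠ u in 𝓝 u₀, ContMDiffAt 𝓘(ℝ, E₀) 𝓘(ℝ, E) ∞ φ u) :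
    ContDiffAt ℝ ∞ (formAlong φ η) u₀ := by
  refine ContDiffAt.congr_of_eventuallyEq ?_ (formAlong_eventuallyEq η hφ)
  have h1 : ContDiffAt ℝ ∞ (extChartAt 𝓘(ℝ, E) (φ u₀) ∘ φ) u₀ :=
    ((contMDiffAt_extChartAt_of_mem _ (mem_extChartAt_source (φ u₀))).comp u₀
      hφ.self_of_nhds).contDiffAt
  have h2 : ContDiffAt ℝ ∞ (fun u => formInChart η (φ u₀) (extChartAt 𝓘(ℝ, E) (φ u₀) (φ u))) u₀ :=
    ContDiffAt.comp (g := formInChart η (φ u₀)) (f := extChartAt 𝓘(ℝ, E) (φ u₀) ∘ φ) u₀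
      (hη.contDiffAt_formInChart _ (mem_extChartAt_target _)) h1
  exact ContDiffAt.comp (g := fun q : (E [⋀^Fin k]→L[ℝ] F) × (E₀ →L[ℝ] E) =>
      q.1.compContinuousLinearMap q.2) u₀
    contDiff_compContinuousLinearMap.contDiffAt (h2.prodMk (h1.fderiv_right (by simp)))

/-- Naturality of d in vector spaces, applied to the chart expression of φ. With φ the inverse of a
chart it shows that `extD`, which uses a different chart at each point, is independent of the chart.
-/
theorem extDeriv_formAlong (hη : IsSmoothForm η)
    (hφ : ∀ᶠ u in 𝓝 u₀, ContMDiffAt 𝓘(ℝ, E₀) 𝓘(ℝ, E) ∞ φ u) :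
    extDeriv (formAlong φ η) u₀ = formAlong φ (extD η) u₀ := by
  have h1 : ContMDiffAt 𝓘(ℝ, E₀) 𝓘(ℝ, E) ∞ (extChartAt 𝓘(ℝ, E) (φ u₀) ∘ φ) u₀ :=
    (contMDiffAt_extChartAt_of_mem _ (mem_extChartAt_source (φ u₀))).comp u₀ hφ.self_of_nhds
  have h2 := mder_comp (g := extChartAt 𝓘(ℝ, E) (φ u₀)) (f := φ) (x := u₀) (I := 𝓘(ℝ, E₀))
    (I' := 𝓘(ℝ, E))
    ((contMDiffAt_extChartAt_of_mem _ (mem_extChartAt_source (φ u₀))).mdifferentiableAt (by simp))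
    (hφ.self_of_nhds.mdifferentiableAt (by simp))
  rw [(formAlong_eventuallyEq η hφ).extDeriv_eq]
  have h3 : DifferentiableAt ℝ (formInChart η (φ u₀)) ((extChartAt 𝓘(ℝ, E) (φ u₀) ∘ φ) u₀) :=
    (hη.contDiffAt_formInChart _ (mem_extChartAt_target _)).differentiableAt (by simp)
  refine (extDeriv_pullback h3 (r := ∞) h1.contDiffAt (by
    rw [minSmoothness_of_isRCLikeNormedField]
    exact WithTop.coe_le_coe.2 (le_top : (2 : ℕ∞) ≤ ⊤))).trans ?_
  rw [← mder_eq_fderiv, h2]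
  rfl

-- In a fixed chart `extD η` is the exterior derivative of the expression of η in that chart, by the
-- naturality `extDeriv_formAlong`.
set_option synthInstance.maxHeartbeats 200000 in
theorem IsSmoothForm.extD [FiniteDimensional ℝ E] [FiniteDimensional ℝ F] (hη : IsSmoothForm η) :
    IsSmoothForm (extD η) := by
  intro x y hy
  have ht := (isOpen_extChartAt_target (I := 𝓘(ℝ, E)) x)
  have h1 : formInChart (MagneticReduction.extD η) x =ᶠ[𝓝 y] extDeriv (formInChart η x) := by
    filter_upwards [ht.mem_nhds hy] with z hz
    refine (extDeriv_formAlong hη ?_).symm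
    filter_upwards [ht.mem_nhds hz] with w hw
    exact contMDiffAt_extChartAt_symm_of_mem x hw
  refine (ContDiffAt.congr_of_eventuallyEq ?_ h1).contDiffWithinAt
  exact (ContinuousAlternatingMap.alternatizeUncurryFinCLM ℝ E F).contDiff.contDiffAt.comp y
    ((hη.contDiffAt_formInChart x hy).fderiv_right (m := ∞) (by simp))

theorem IsSmoothForm.pullbackForm [FiniteDimensional ℝ E] [FiniteDimensional ℝ F] {f : M → M'}
    {η : DiffForm E' M' k F} (hη : IsSmoothForm η) (hf : ContMDiff 𝓘(ℝ, E) 𝓘(ℝ, E') ∞ f) :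
    IsSmoothForm (pullbackForm f η : DiffForm E M k F) := by
  intro x y hy
  have ht := (isOpen_extChartAt_target (I := 𝓘(ℝ, E)) x)
  have h1 : formInChart (MagneticReduction.pullbackForm f η : DiffForm E M k F) x =ᶠ[𝓝 y]
      formAlong (f ∘ (extChartAt 𝓘(ℝ, E) x).symm) η := by
    filter_upwards [ht.mem_nhds hy] with z hz
    exact (formAlong_comp η ((hf _).mdifferentiableAt (by simp))
      ((contMDiffAt_extChartAt_symm_of_mem x hz).mdifferentiableAt (by simp))).symm
  refine (ContDiffAt.congr_of_eventuallyEq (hη.contDiffAt_formAlong ?_) h1).contDiffWithinAt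
  filter_upwards [ht.mem_nhds hy] with w hw
  exact (hf _).comp w (contMDiffAt_extChartAt_symm_of_mem x hw)

/-- Both sides are computed along f ∘ (chart)⁻¹, a map defined on a vector space, where
`extDeriv_formAlong` applies; the derivative of the chart is then cancelled. -/
theorem extD_pullbackForm [FiniteDimensional ℝ E] [FiniteDimensional ℝ F] {f : M → M'}
    {η : DiffForm E' M' k F} (hη : IsSmoothForm η) (hf : ContMDiff 𝓘(ℝ, E) 𝓘(ℝ, E') ∞ f) :
    extD (pullbackForm f η : DiffForm E M k F) = pullbackForm f (extD η) := by
  funext x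
  have ht := (isOpen_extChartAt_target (I := 𝓘(ℝ, E)) x)
  have hχ := mem_extChartAt_target (I := 𝓘(ℝ, E)) x
  have h0 : ∀ k' (η' : DiffForm E' M' k' F), formInChart (pullbackForm f η' : DiffForm E M k' F) x
      =ᶠ[𝓝 (extChartAt 𝓘(ℝ, E) x x)] formAlong (f ∘ (extChartAt 𝓘(ℝ, E) x).symm) η' := by
    intro k' η'
    filter_upwards [ht.mem_nhds hχ] with z hz
    exact (formAlong_comp η' ((hf _).mdifferentiableAt (by simp))
      ((contMDiffAt_extChartAt_symm_of_mem x hz).mdifferentiableAt (by simp))).symm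
  have h1 := extDeriv_formAlong (φ := f ∘ (extChartAt 𝓘(ℝ, E) x).symm)
    (u₀ := extChartAt 𝓘(ℝ, E) x x) hη (by
      filter_upwards [ht.mem_nhds hχ] with w hw
      exact (hf _).comp w (contMDiffAt_extChartAt_symm_of_mem x hw))
  rw [← (h0 _ η).extDeriv_eq, ← (h0 _ (extD η)).self_of_nhds, formInChart_eq_formAlong] at h1
  refine (congrArg (fun T : E [⋀^Fin (k + 1)]→L[ℝ] F => T.compContinuousLinearMap
    (mder 𝓘(ℝ, E) 𝓘(ℝ, E) (extChartAt 𝓘(ℝ, E) x) x)) h1).trans ?_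
  have h5 := mder_symm_comp_mder_extChartAt (I := 𝓘(ℝ, E)) x (mem_extChartAt_source x)
  change (formAt (MagneticReduction.pullbackForm f (MagneticReduction.extD η))
    ((extChartAt 𝓘(ℝ, E) x).symm (extChartAt 𝓘(ℝ, E) x x))).compContinuousLinearMap
    ((mder 𝓘(ℝ, E) 𝓘(ℝ, E) (extChartAt 𝓘(ℝ, E) x).symm (extChartAt 𝓘(ℝ, E) x x)).comp
      (mder 𝓘(ℝ, E) 𝓘(ℝ, E) (extChartAt 𝓘(ℝ, E) x) x)) = _
  rw [h5, extChartAt_to_inv]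
  rfl

theorem IsSmoothForm.pairing {f : M → F →L[ℝ] ℝ} {A : DiffForm E M k F}
    (hf : ContMDiff 𝓘(ℝ, E) 𝓘(ℝ, F →L[ℝ] ℝ) ∞ f) (hA : IsSmoothForm A) :
    IsSmoothForm (pairing f A) := by
  intro x y hy
  refine ContDiffAt.contDiffWithinAt ?_
  exact ContDiffAt.compContinuousAlternatingMap (L := f ∘ (extChartAt 𝓘(ℝ, E) x).symm)
    (η := formInChart A x)
    ((hf _).comp y (contMDiffAt_extChartAt_symm_of_mem x hy)).contDiffAt
    (hA.contDiffAt_formInChart x hy)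

end

end SmoothForms

/-! ### Descent of basic forms along a submersion. -/

section Descent

variable {E M E' N : Type*} [NormedAddCommGroup E] [NormedSpace ℝ E]
  [TopologicalSpace M] [ChartedSpace E M] [NormedAddCommGroup E'] [NormedSpace ℝ E']
  [FiniteDimensional ℝ E'] [TopologicalSpace N] [ChartedSpace E' N] {k : ℕ} {F : Type*}
  [NormedAddCommGroup F] [NormedSpace ℝ F] [FiniteDimensional ℝ F]
  [IsManifold 𝓘(ℝ, E) ∞ M] [IsManifold 𝓘(ℝ, E') ∞ N]

/-- A smooth form descends along a surjective submersion if its values depend only on the projections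
of the base point and of the vectors. -/
theorem existsUnique_pullbackForm_eq {ρ : M → N}
    (hρ : Manifold.IsSubmersion 𝓘(ℝ, E) 𝓘(ℝ, E') ∞ ρ) (hsurj : Function.Surjective ρ)
    {η : DiffForm E M k F} (hη : IsSmoothForm η)
    (hbasic : ∀ (x y : M) (v w : Fin k → E), ρ x = ρ y →
      (∀ i, mder 𝓘(ℝ, E) 𝓘(ℝ, E') ρ x (v i) = mder 𝓘(ℝ, E) 𝓘(ℝ, E') ρ y (w i)) →
      formAt η x v = formAt η y w) :
    ∃! ζ : DiffForm E' N k F, IsSmoothForm ζ ∧ pullbackForm ρ ζ = η := by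
  have hs : ∀ x, Function.Surjective (mder 𝓘(ℝ, E) 𝓘(ℝ, E') ρ x) := fun x =>
    mder_surjective_of_isSubmersionAt (hρ.isSubmersionAt x)
  have hsm : ∀ x, ContMDiffAt 𝓘(ℝ, E) 𝓘(ℝ, E') ∞ ρ x := fun x => (hρ.isSubmersionAt x).contMDiffAt
  choose s hs' using hsurj
  have hR : ∀ b, ∃ R : E' →L[ℝ] E, ∀ v, mder 𝓘(ℝ, E) 𝓘(ℝ, E') ρ (s b) (R v) = v := fun b => by
    obtain ⟨R, hR⟩ := LinearMap.exists_rightInverse_of_surjective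
      (mder 𝓘(ℝ, E) 𝓘(ℝ, E') ρ (s b)).toLinearMap (LinearMap.range_eq_top.2 (hs (s b)))
    exact ⟨R.toContinuousLinearMap, fun v => congrArg (fun T : E' →ₗ[ℝ] E' => T v) hR⟩
  choose R hR using hR
  -- Preimages of the point and of the vectors are chosen without any regularity; `hbasic` makes the
  -- value independent of the choices.
  let ζ : DiffForm E' N k F := fun b => (formAt η (s b)).compContinuousLinearMap (R b)
  have hζ : pullbackForm ρ ζ = η := by
    funext x
    refine ContinuousAlternatingMap.ext fun v => ?_
    refine hbasic (s (ρ x)) x (fun i => R (ρ x) (mder 𝓘(ℝ, E) 𝓘(ℝ, E') ρ x (v i))) v (hs' _) fun i => ?_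
    exact hR _ _
  refine ⟨ζ, ⟨?_, hζ⟩, ?_⟩
  · intro b₀ y hy
    have ht := isOpen_extChartAt_target (I := 𝓘(ℝ, E')) b₀
    set χ := extChartAt 𝓘(ℝ, E') b₀
    obtain ⟨x, hx⟩ : ∃ x, ρ x = χ.symm y := ⟨_, hs' _⟩
    obtain ⟨σ, hσ1, hσ2, hσ3⟩ := exists_localSection (hρ.isSubmersionAt x)
    rw [hx] at hσ1 hσ2 hσ3
    have hχ : ∀ᶠ z in 𝓝 y, ContMDiffAt 𝓘(ℝ, E') 𝓘(ℝ, E') ∞ χ.symm z := by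
      filter_upwards [ht.mem_nhds hy] with z hz
      exact contMDiffAt_extChartAt_symm_of_mem b₀ hz
    have hχc := hχ.self_of_nhds.continuousAt
    have hσχ : ∀ᶠ z in 𝓝 y, ContMDiffAt 𝓘(ℝ, E') 𝓘(ℝ, E) ∞ (σ ∘ χ.symm) z := by
      filter_upwards [hχ, hχc.eventually hσ1] with z h1 h2
      exact h2.comp z h1
    -- Through a smooth local section, the chart expression of ζ becomes the pullback of ρ*ζ = η
    -- along a smooth map, which is smooth.
    have heq : χ.symm =ᶠ[𝓝 y] ρ ∘ (σ ∘ χ.symm) := by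
      filter_upwards [hχc.eventually hσ3] with z hz
      exact hz.symm
    refine (ContDiffAt.congr_of_eventuallyEq (hη.contDiffAt_formAlong hσχ) ?_).contDiffWithinAt
    refine (formAlong_congr ζ heq).trans ?_
    filter_upwards [hσχ] with z hz
    rw [formAlong_comp ζ ((hsm _).mdifferentiableAt (by simp)) (hz.mdifferentiableAt (by simp)), hζ]
  · rintro ζ' ⟨-, hζ'⟩
    funext b
    refine ContinuousAlternatingMap.ext fun v => ?_
    obtain ⟨x, rfl⟩ : ∃ x, ρ x = b := ⟨_, hs' b⟩
    choose w hw using fun i => hs x (v i)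
    have h1 := congrArg (fun T : E [⋀^Fin k]→L[ℝ] F => T w) ((congrFun hζ' x).trans (congrFun hζ x).symm)
    have hw' : (fun i => mder 𝓘(ℝ, E) 𝓘(ℝ, E') ρ x (w i)) = v := funext hw
    change formAt ζ' (ρ x) v = formAt ζ (ρ x) v
    rw [← hw']
    exact h1

end Descent

/-! ### Smooth dependence of derivatives on parameters. -/

section ParametrizedDerivatives

variable {E H M E' H' M' EN HN N : Type*} [NormedAddCommGroup E] [NormedSpace ℝ E]
  [TopologicalSpace H] [TopologicalSpace M] [ChartedSpace H M] [NormedAddCommGroup E']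
  [NormedSpace ℝ E'] [TopologicalSpace H'] [TopologicalSpace M'] [ChartedSpace H' M']
  [NormedAddCommGroup EN] [NormedSpace ℝ EN] [TopologicalSpace HN] [TopologicalSpace N]
  [ChartedSpace HN N] {I : ModelWithCorners ℝ E H} {I' : ModelWithCorners ℝ E' H'}
  {J : ModelWithCorners ℝ EN HN} [IsManifold I ∞ M] [IsManifold I' ∞ M']
  [IsManifold J ∞ N]

/-- The derivatives of a smooth family of maps, in the charts, depend smoothly on the parameter and on
the base point. -/
theorem contMDiffAt_mder [I.Boundaryless] {f : N → M → M'} {g : N → M} {x₀ : N}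
    (hf : ContMDiffAt (J.prod I) I' ∞ (Function.uncurry f) (x₀, g x₀))
    (hg : ContMDiffAt J I ∞ g x₀) :
    ContMDiffAt J 𝓘(ℝ, E →L[ℝ] E') ∞ (fun x =>
      (mder I' 𝓘(ℝ, E') (extChartAt I' (f x₀ (g x₀))) (f x (g x))).comp
        ((mder I I' (f x) (g x)).comp
          (mder 𝓘(ℝ, E) I (extChartAt I (g x₀)).symm (extChartAt I (g x₀) (g x))))) x₀ := by
  have h1 : IsManifold I 1 M := IsManifold.of_le (n := ∞) (by simp)
  have h2 : IsManifold I' 1 M' := IsManifold.of_le (n := ∞) (by simp)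
  have h4 : IsManifold J 1 N := IsManifold.of_le (n := ∞) (by simp)
  have h := ContMDiffAt.mfderiv f g hf hg (m := ∞) (by simp)
  refine h.congr_of_eventuallyEq ?_
  have h3 : ContinuousAt (fun x => f x (g x)) x₀ :=
    ContinuousAt.comp (g := Function.uncurry f) (f := fun x => (x, g x)) hf.continuousAt
      (continuousAt_id.prodMk hg.continuousAt)
  filter_upwards [hg.continuousAt.eventually_mem (chart_source_mem_nhds H (g x₀)),
    h3.eventually_mem (chart_source_mem_nhds H' (f x₀ (g x₀)))] with x hx hx'
  rw [inTangentCoordinates_eq_mfderiv_comp hx hx', I.range_eq_univ, mfderivWithin_univ]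
  rfl

theorem contMDiffAt_mder_const [I.Boundaryless] {f : N → M → M'} {x₀ : N} {a : M}
    (hf : ContMDiffAt (J.prod I) I' ∞ (Function.uncurry f) (x₀, a)) :
    ContMDiffAt J 𝓘(ℝ, E →L[ℝ] E') ∞ (fun x =>
      (mder I' 𝓘(ℝ, E') (extChartAt I' (f x₀ a)) (f x a)).comp (mder I I' (f x) a)) x₀ := by
  have h := contMDiffAt_mder (g := fun _ : N => a) hf contMDiffAt_const
  refine h.congr_of_eventuallyEq (Filter.Eventually.of_forall fun x => ?_)
  simp only [mder_extChartAt_symm_self, ContinuousLinearMap.comp_id]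

end ParametrizedDerivatives

/-! ### The adjoint representation and connection forms. -/

section Actions

variable {EG G EM M : Type*} [NormedAddCommGroup EG] [NormedSpace ℝ EG] [TopologicalSpace G]
  [ChartedSpace EG G] [Group G] [NormedAddCommGroup EM] [NormedSpace ℝ EM] [TopologicalSpace M]
  [ChartedSpace EM M] [MulAction Gᵐᵒᵖ M]

/-- Every conjugation fixes 1, so all the derivatives can be read in the chart at 1, whose own
derivative at 1 is the identity; they form a smooth family. -/
theorem contMDiff_Ad [LieGroup 𝓘(ℝ, EG) ∞ G] :
    ContMDiff 𝓘(ℝ, EG) 𝓘(ℝ, EG →L[ℝ] EG) ∞ (Ad : G → EG →L[ℝ] EG) := by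
  intro g₀
  have h1 : ContMDiff (𝓘(ℝ, EG).prod 𝓘(ℝ, EG)) 𝓘(ℝ, EG) ∞
      (Function.uncurry fun g x : G => g * x * g⁻¹) :=
    (contMDiff_fst.mul contMDiff_snd).mul contMDiff_fst.inv
  have h : IsManifold 𝓘(ℝ, EG) ∞ G := inferInstance
  have h2 := contMDiffAt_mder_const (x₀ := g₀) (a := (1 : G)) (h1 (g₀, 1))
  refine h2.congr_of_eventuallyEq (Filter.Eventually.of_forall fun g => ?_)
  simp only [mul_one, mul_inv_cancel, mder_extChartAt_self, ContinuousLinearMap.id_comp]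
  rfl

theorem Ad_comp_Ad_inv [LieGroup 𝓘(ℝ, EG) ∞ G] (g : G) :
    (Ad g : EG →L[ℝ] EG).comp (Ad g⁻¹) = ContinuousLinearMap.id ℝ EG := by
  rw [← Ad_mul, mul_inv_cancel, Ad_one]

theorem Ad_inv_comp_Ad [LieGroup 𝓘(ℝ, EG) ∞ G] (g : G) :
    (Ad g⁻¹ : EG →L[ℝ] EG).comp (Ad g) = ContinuousLinearMap.id ℝ EG := by
  rw [← Ad_mul, inv_mul_cancel, Ad_one]

theorem coAd_coAd_inv [LieGroup 𝓘(ℝ, EG) ∞ G] (g : G) (ν : EG →L[ℝ] ℝ) :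
    coAd g (coAd g⁻¹ ν) = ν := by
  simp only [coAd, ContinuousLinearMap.comp_assoc, Ad_inv_comp_Ad, ContinuousLinearMap.comp_id]

theorem coAd_inv_coAd [LieGroup 𝓘(ℝ, EG) ∞ G] (g : G) (ν : EG →L[ℝ] ℝ) :
    coAd g⁻¹ (coAd g ν) = ν := by
  simp only [coAd, ContinuousLinearMap.comp_assoc, Ad_comp_Ad_inv, ContinuousLinearMap.comp_id]

theorem IsFreeProperAction.contMDiff_smul (h : IsFreeProperAction EG G EM M) (g : G) :
    ContMDiff 𝓘(ℝ, EM) 𝓘(ℝ, EM) ∞ (fun m : M => op g • m) :=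
  h.smooth.comp (contMDiff_id.prodMk contMDiff_const)

theorem IsFreeProperAction.contMDiff_orbit (h : IsFreeProperAction EG G EM M) (m : M) :
    ContMDiff 𝓘(ℝ, EG) 𝓘(ℝ, EM) ∞ (fun g : G => op g • m) :=
  h.smooth.comp (contMDiff_const.prodMk contMDiff_id)

/-- The connection form is a left inverse of ξ ↦ ξ_M(m). -/
theorem IsPrincipalConnection.infActL_injective {A : DiffForm EM M 1 EG}
    (hA : IsPrincipalConnection G A) (m : M) :
    Function.Injective (infActL G m : EG →L[ℝ] EM) := by
  intro ξ ξ' h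
  have h1 : infAct (EM := EM) G m ξ = infAct G m ξ' := h
  rw [← hA.reproduces m ξ, h1, hA.reproduces]

/-- A form in one variable, as a linear map on the model space. -/
def toCovector {E N F : Type*} [NormedAddCommGroup E] [NormedSpace ℝ E] [TopologicalSpace N]
    [ChartedSpace E N] [NormedAddCommGroup F] [NormedSpace ℝ F] (A : DiffForm E N 1 F) (x : N) :
    E →L[ℝ] F :=
  (ContinuousAlternatingMap.ofSubsingleton ℝ E F (0 : Fin 1)).symm (formAt A x)

theorem formAt_eq_toCovector {E N F : Type*} [NormedAddCommGroup E] [NormedSpace ℝ E]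
    [TopologicalSpace N] [ChartedSpace E N] [NormedAddCommGroup F] [NormedSpace ℝ F]
    (A : DiffForm E N 1 F) (x : N) (v : Fin 1 → E) : formAt A x v = toCovector A x (v 0) := by
  change _ = formAt A x fun _ => v 0
  congr 1
  funext i
  rw [Subsingleton.elim i 0]

theorem IsPrincipalConnection.toCovector_infActL {A : DiffForm EM M 1 EG}
    (hA : IsPrincipalConnection G A) (m : M) (ξ : EG) :
    toCovector A m ((infActL G m : EG →L[ℝ] EM) ξ) = ξ := by
  have h1 := formAt_eq_toCovector A m ![(infActL G m : EG →L[ℝ] EM) ξ]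
  exact h1.symm.trans (hA.reproduces m ξ)

theorem toCovector_pullbackForm {E N E' N' F : Type*} [NormedAddCommGroup E] [NormedSpace ℝ E]
    [TopologicalSpace N] [ChartedSpace E N] [NormedAddCommGroup E'] [NormedSpace ℝ E']
    [TopologicalSpace N'] [ChartedSpace E' N'] [NormedAddCommGroup F] [NormedSpace ℝ F]
    (f : N → N') (A : DiffForm E' N' 1 F) (x : N) :
    toCovector (pullbackForm f A : DiffForm E N 1 F) x =
      (toCovector A (f x)).comp (mder 𝓘(ℝ, E) 𝓘(ℝ, E') f x) := rfl

theorem pullbackForm_comp {E N E' N' E'' N'' F : Type*} {k : ℕ} [NormedAddCommGroup E]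
    [NormedSpace ℝ E] [TopologicalSpace N] [ChartedSpace E N] [NormedAddCommGroup E']
    [NormedSpace ℝ E'] [TopologicalSpace N'] [ChartedSpace E' N'] [NormedAddCommGroup E'']
    [NormedSpace ℝ E''] [TopologicalSpace N''] [ChartedSpace E'' N''] [NormedAddCommGroup F]
    [NormedSpace ℝ F] {f : N' → N''} {g : N → N'} (η : DiffForm E'' N'' k F)
    (hf : ContMDiff 𝓘(ℝ, E') 𝓘(ℝ, E'') ∞ f) (hg : ContMDiff 𝓘(ℝ, E) 𝓘(ℝ, E') ∞ g) :
    (pullbackForm (f ∘ g) η : DiffForm E N k F) =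
      pullbackForm g (pullbackForm f η : DiffForm E' N' k F) := by
  funext x
  have h := mder_comp (g := f) (f := g) (x := x) ((hf _).mdifferentiableAt (by simp))
    ((hg _).mdifferentiableAt (by simp))
  change (formAt η (f (g x))).compContinuousLinearMap (mder 𝓘(ℝ, E) 𝓘(ℝ, E'') (f ∘ g) x) = _
  rw [h]
  rfl

end Actions

/-! ### The pulled back connection, the isotropy group as a fibre, and invariance. -/

namespace MagneticSystem

variable {EG G EP P EQ Q : Type*}
    [NormedAddCommGroup EG] [NormedSpace ℝ EG] [TopologicalSpace G] [ChartedSpace EG G] [Group G]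
    [NormedAddCommGroup EP] [NormedSpace ℝ EP] [TopologicalSpace P] [ChartedSpace EP P]
    [NormedAddCommGroup EQ] [NormedSpace ℝ EQ] [TopologicalSpace Q] [ChartedSpace EQ Q]
    [MulAction Gᵐᵒᵖ P] [MulAction Gᵐᵒᵖ Q] (S : MagneticSystem EG G EP P EQ Q)

/-- The derivative of `ε` maps the infinitesimal action on `P` to the one on `Q`. -/
theorem mder_ε_infActL (p : P) :
    (mder 𝓘(ℝ, EP) 𝓘(ℝ, EQ) S.ε p).comp (infActL G p : EG →L[ℝ] EP) = infActL G (S.ε p) := by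
  have h1 := mder_comp (g := S.ε) (f := fun g : G => op g • p) (x := 1) (I := 𝓘(ℝ, EG))
    (I' := 𝓘(ℝ, EP)) (I'' := 𝓘(ℝ, EQ)) ((S.ε.contMDiff _).mdifferentiableAt (by simp))
    (S.actP.mdiff_orbit 1 p)
  have h2 : (S.ε ∘ fun g : G => op g • p) = fun g : G => op g • S.ε p :=
    funext fun g => S.ε_equivariant g p
  rw [h2, op_one, one_smul] at h1
  exact h1.symm

variable {A : DiffForm EQ Q 1 EG}

/-- The derivative of ε carries ξ_P to ξ_Q, and ξ ↦ ξ_Q is injective. -/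
theorem infActL_injective (S : MagneticSystem EG G EP P EQ Q) (hA : IsPrincipalConnection G A) (p : P) :
    Function.Injective (infActL G p : EG →L[ℝ] EP) := by
  have h := hA.infActL_injective (S.ε p)
  rw [← mder_ε_infActL] at h
  exact Function.Injective.of_comp (f := mder 𝓘(ℝ, EP) 𝓘(ℝ, EQ) S.ε p) h

theorem isPrincipalConnection_pullbackForm [FiniteDimensional ℝ EP] [FiniteDimensional ℝ EG]
    [IsManifold 𝓘(ℝ, EP) ∞ P] [IsManifold 𝓘(ℝ, EQ) ∞ Q] (hA : IsPrincipalConnection G A) :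
    IsPrincipalConnection G (pullbackForm S.ε A : DiffForm EP P 1 EG) where
  smooth := hA.smooth.pullbackForm S.ε.contMDiff
  equivariant g := by
    have h : (S.ε ∘ fun p : P => op g • p) = (fun q : Q => op g • q) ∘ S.ε :=
      funext fun p => S.ε_equivariant g p
    rw [← pullbackForm_comp A S.ε.contMDiff (S.actP.contMDiff_smul g), h,
      pullbackForm_comp A (S.actQ.contMDiff_smul g) S.ε.contMDiff, hA.equivariant]
    rfl
  reproduces p ξ := by
    have h := formAt_eq_toCovector (pullbackForm S.ε A : DiffForm EP P 1 EG) p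
      ![(infActL G p : EG →L[ℝ] EP) ξ]
    refine Eq.trans h ?_
    rw [toCovector_pullbackForm]
    change toCovector A (S.ε p) ((mder 𝓘(ℝ, EP) 𝓘(ℝ, EQ) S.ε p).comp (infActL G p : EG →L[ℝ] EP) ξ) = ξ
    rw [mder_ε_infActL, hA.toCovector_infActL]

variable (A) in
theorem isSmoothForm_potentialForm [FiniteDimensional ℝ EP] [FiniteDimensional ℝ EG]
    [IsManifold 𝓘(ℝ, EP) ∞ P]
    [IsManifold 𝓘(ℝ, EQ) ∞ Q] (μ : EG →L[ℝ] ℝ) (hA : IsPrincipalConnection G A) :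
    IsSmoothForm (S.potentialForm A μ) :=
  IsSmoothForm.pairing (contMDiff_const.add S.δ_smooth) (S.isPrincipalConnection_pullbackForm hA).smooth

section Isotropy

variable (μ : EG →L[ℝ] ℝ)

/-- The map `G → 𝔤^*`, `g ↦ Ad_{g⁻¹}^*(μ + δ(p g)) - δ(p)`, which does not depend on `p`, and whose
fibre over `μ` is the isotropy group of `μ`. -/
def orbitMap (p : P) (g : G) : EG →L[ℝ] ℝ := coAd g⁻¹ (μ + S.δ (op g • p)) - S.δ p

theorem orbitMap_one (p : P) : S.orbitMap μ p 1 = μ := by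
  simp [orbitMap, coAd, Ad_one]

theorem contMDiff_orbitMap [LieGroup 𝓘(ℝ, EG) ∞ G] (p : P) :
    ContMDiff 𝓘(ℝ, EG) 𝓘(ℝ, EG →L[ℝ] ℝ) ∞ (S.orbitMap μ p) :=
  ((contMDiff_const.add (S.δ_smooth.comp (S.actP.contMDiff_orbit p))).clm_comp
    (contMDiff_Ad.comp (contMDiff_inv 𝓘(ℝ, EG) ∞))).sub contMDiff_const

/-- The pullback of the potential form by the action of an arbitrary group element. -/
theorem pullbackForm_potentialForm [FiniteDimensional ℝ EP] [FiniteDimensional ℝ EG]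
    [IsManifold 𝓘(ℝ, EP) ∞ P] [IsManifold 𝓘(ℝ, EQ) ∞ Q] (hA : IsPrincipalConnection G A) (g : G) :
    (pullbackForm (fun p : P => op g • p) (S.potentialForm A μ) : DiffForm EP P 1 ℝ) =
      pairing (fun p => S.orbitMap μ p g + S.δ p) (pullbackForm S.ε A : DiffForm EP P 1 EG) := by
  have h : (pullbackForm (fun p : P => op g • p) (S.potentialForm A μ) : DiffForm EP P 1 ℝ) =
      pairing (fun p => μ + S.δ (op g • p))
        (pullbackForm (fun p : P => op g • p) (pullbackForm S.ε A : DiffForm EP P 1 EG) :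
          DiffForm EP P 1 EG) := rfl
  rw [h, (S.isPrincipalConnection_pullbackForm hA).equivariant g]
  simp only [orbitMap, sub_add_cancel]
  rfl

variable [ConnectedSpace P] [IsManifold 𝓘(ℝ, EP) ∞ P] [LieGroup 𝓘(ℝ, EG) ∞ G]

/-- The value is Ad*_{g⁻¹}(μ + (δ(pg) − Ad*_g δ(p))), which involves p only through the difference
that is constant by `potential_const`. -/
theorem orbitMap_eq (p p' : P) (g : G) : S.orbitMap μ p g = S.orbitMap μ p' g := by
  have h : ∀ p, S.orbitMap μ p g = coAd g⁻¹ (μ + (S.δ (op g • p) - coAd g (S.δ p))) := fun p => by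
    have h1 := coAd_inv_coAd g (S.δ p)
    have h2 : coAd g⁻¹ (μ + (S.δ (op g • p) - coAd g (S.δ p))) =
        coAd g⁻¹ (μ + S.δ (op g • p)) - coAd g⁻¹ (coAd g (S.δ p)) := by
      rw [← add_sub_assoc]; exact ContinuousLinearMap.sub_comp _ _ _
    rw [h2, h1]; rfl
  rw [h, h, S.potential_const g p p']

theorem orbitMap_eq_iff (p : P) (g : G) : S.orbitMap μ p g = S.orbitMap μ p 1 ↔ g ∈ S.isotropy μ := by
  rw [orbitMap_one]
  refine Iff.trans ?_ (S.affineAct_eq_iff μ g p).symm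
  rw [orbitMap, sub_eq_iff_eq_add]
  constructor
  · intro h
    rw [← h, coAd_coAd_inv]
  · intro h
    rw [h, coAd_inv_coAd]

/-- Independence of the base point is essential: with κ(h) computed at pg, the term Ad*_{g⁻¹}κ(h)
contains Ad*_{(gh)⁻¹}(μ + δ(pgh)), which is what κ(gh) computed at p requires. The rest depends on g
only. -/
theorem isAffineOrbitMap (p : P) : IsAffineOrbitMap EG (S.orbitMap μ p) where
  smooth := S.contMDiff_orbitMap μ p
  equivariant g := by
    refine ⟨ContinuousLinearMap.precomp ℝ (Ad g⁻¹), coAd g⁻¹ (S.δ (op g • p)) - S.δ p, ?_, ?_⟩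
    · exact Function.LeftInverse.injective (g := coAd g) fun ν => coAd_coAd_inv g ν
    · intro h
      rw [S.orbitMap_eq μ p (op g • p) h]
      simp only [orbitMap, coAd, mul_inv_rev, Ad_mul, op_mul, mul_smul,
        ContinuousLinearMap.precomp_apply, ContinuousLinearMap.sub_comp, ContinuousLinearMap.comp_assoc]
      abel

theorem orbitsP_iff (p y z : P) :
    (S.orbitsP μ).r y z ↔ ∃ k : G, S.orbitMap μ p k = S.orbitMap μ p 1 ∧ op k • y = z := by
  simp only [orbitMap_eq_iff]
  constructor
  · rintro ⟨⟨k, hk⟩, h⟩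
    -- The orbit relation moves the second point to the first, hence the inverse.
    refine ⟨k.unop⁻¹, inv_mem hk, ?_⟩
    have h1 : k • z = y := h
    rw [← h1, op_inv, op_unop, inv_smul_smul]
  · rintro ⟨k, hk, rfl⟩
    refine ⟨⟨(op k)⁻¹, inv_mem (s := S.isotropy μ) hk⟩, ?_⟩
    exact inv_smul_smul (op k) y

theorem pullbackForm_potentialForm_eq_self [FiniteDimensional ℝ EP] [FiniteDimensional ℝ EG]
    [IsManifold 𝓘(ℝ, EQ) ∞ Q] (hA : IsPrincipalConnection G A) {g : G} (hg : g ∈ S.isotropy μ) :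
    pullbackForm (fun p : P => op g • p) (S.potentialForm A μ) = S.potentialForm A μ := by
  rw [S.pullbackForm_potentialForm μ hA]
  have h : ∀ p, S.orbitMap μ p g = μ := fun p =>
    ((S.orbitMap_eq_iff μ p g).2 hg).trans (S.orbitMap_one μ p)
  simp only [h]
  rfl

theorem pullbackForm_magnetic_eq_self [FiniteDimensional ℝ EP] [FiniteDimensional ℝ EG]
    [IsManifold 𝓘(ℝ, EQ) ∞ Q] (hA : IsPrincipalConnection G A) {g : G} (hg : g ∈ S.isotropy μ) :
    pullbackForm (fun p : P => op g • p) (S.B + extD (S.potentialForm A μ)) =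
      S.B + extD (S.potentialForm A μ) := by
  have h1 := extD_pullbackForm (S.isSmoothForm_potentialForm A μ hA) (S.actP.contMDiff_smul g)
  rw [S.pullbackForm_potentialForm_eq_self μ hA hg] at h1
  have h2 : (pullbackForm (fun p : P => op g • p) (S.B + extD (S.potentialForm A μ)) :
      DiffForm EP P 2 ℝ) =
    (pullbackForm (fun p : P => op g • p) S.B : DiffForm EP P 2 ℝ) +
      (pullbackForm (fun p : P => op g • p) (extD (S.potentialForm A μ)) : DiffForm EP P 2 ℝ) := rfl
  rw [h2, S.B_invariant, ← h1]

end Isotropy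

end MagneticSystem

/-! ### Horizontality and descent of the magnetic form. -/

namespace MagneticSystem

variable {EG G EP P EQ Q : Type*}
    [NormedAddCommGroup EG] [NormedSpace ℝ EG] [TopologicalSpace G] [ChartedSpace EG G] [Group G]
    [NormedAddCommGroup EP] [NormedSpace ℝ EP] [TopologicalSpace P] [ChartedSpace EP P]
    [NormedAddCommGroup EQ] [NormedSpace ℝ EQ] [TopologicalSpace Q] [ChartedSpace EQ Q]
    [MulAction Gᵐᵒᵖ P] [MulAction Gᵐᵒᵖ Q] (S : MagneticSystem EG G EP P EQ Q)
    {A : DiffForm EQ Q 1 EG} (μ : EG →L[ℝ] ℝ)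

theorem toCovector_potentialForm (p : P) (v : EP) :
    toCovector (S.potentialForm A μ) p v =
      (μ + S.δ p) (toCovector (pullbackForm S.ε A : DiffForm EP P 1 EG) p v) := rfl

variable [FiniteDimensional ℝ EP] [FiniteDimensional ℝ EG]
    [IsManifold 𝓘(ℝ, EP) ∞ P]

theorem nonempty_quotientManifold_orbitsP [LieGroup 𝓘(ℝ, EG) ∞ G] [ConnectedSpace P] [T2Space P]
    (hA : IsPrincipalConnection G A) :
    Nonempty (QuotientManifold 𝓘(ℝ, EP) (S.orbitsP μ)) :=
  S.actP.nonempty_quotientManifold (S.infActL_injective hA)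
    (S.isAffineOrbitMap μ (Classical.arbitrary P)) (S.orbitsP_iff μ _)

variable [IsManifold 𝓘(ℝ, EQ) ∞ Q]

theorem isSmoothForm_magnetic (hA : IsPrincipalConnection G A) :
    IsSmoothForm (S.B + extD (S.potentialForm A μ)) :=
  S.B_smooth.add (S.isSmoothForm_potentialForm A μ hA).extD

variable [LieGroup 𝓘(ℝ, EG) ∞ G]

/-- The contraction of the differential of the potential form with a fundamental vector field. -/
theorem extD_potentialForm_infActL (hA : IsPrincipalConnection G A) (p : P) (ξ : EG) (v : EP) :
    formAt (extD (S.potentialForm A μ)) p ![(infActL G p : EG →L[ℝ] EP) ξ, v] =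
      mder 𝓘(ℝ, EG) 𝓘(ℝ, EG →L[ℝ] ℝ) (S.orbitMap μ p) 1 ξ
          (toCovector (pullbackForm S.ε A : DiffForm EP P 1 EG) p v) -
        formAt S.B p ![(infActL G p : EG →L[ℝ] EP) ξ, v] := by
  set c := extChartAt 𝓘(ℝ, EG) (1 : G) with hc
  set χ := extChartAt 𝓘(ℝ, EP) p with hχ
  set α := S.potentialForm A μ with hα
  have hc1 : c.symm (c 1) = 1 := extChartAt_to_inv 1
  have hχp : χ.symm (χ p) = p := extChartAt_to_inv p
  have hct : c 1 ∈ c.target := mem_extChartAt_target 1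
  have hχt : χ p ∈ χ.target := mem_extChartAt_target p
  -- The action in charts. The potential form is pulled back to the vector space EG × EP, where the
  -- constant fields (ξ, 0) and (0, v) turn d into a difference of two partial derivatives.
  let φ : EG × EP → P := fun q => op (c.symm q.1) • χ.symm q.2
  have hφ : ∀ q : EG × EP, q.1 ∈ c.target → q.2 ∈ χ.target →
      ContMDiffAt 𝓘(ℝ, EG × EP) 𝓘(ℝ, EP) ∞ φ q := fun q h1 h2 =>
    S.actP.smooth.contMDiffAt.comp q
      (((contMDiffAt_extChartAt_symm_of_mem p h2).comp q contDiff_snd.contMDiff.contMDiffAt).prodMk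
        ((contMDiffAt_extChartAt_symm_of_mem 1 h1).comp q contDiff_fst.contMDiff.contMDiffAt))
  have hcev : ∀ᶠ u in 𝓝 (c 1), u ∈ c.target := (isOpen_extChartAt_target (1 : G)).mem_nhds hct
  have hχev : ∀ᶠ w in 𝓝 (χ p), w ∈ χ.target := (isOpen_extChartAt_target p).mem_nhds hχt
  have hev : ∀ᶠ q in 𝓝 ((c 1, χ p) : EG × EP), ContMDiffAt 𝓘(ℝ, EG × EP) 𝓘(ℝ, EP) ∞ φ q := by
    filter_upwards [continuous_fst.continuousAt.eventually hcev,
      continuous_snd.continuousAt.eventually hχev] with q h1 h2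
    exact hφ q h1 h2
  -- the partial derivatives of `φ`
  have hd1 : ∀ w ∈ χ.target, (mder 𝓘(ℝ, EG × EP) 𝓘(ℝ, EP) φ (c 1, w)).comp
      (ContinuousLinearMap.inl ℝ EG EP) = infActL G (χ.symm w) := by
    intro w hw
    have h1 := mder_comp (g := φ) (f := fun u : EG => (u, w)) (x := c 1) (I := 𝓘(ℝ, EG))
      (I' := 𝓘(ℝ, EG × EP)) ((hφ (c 1, w) hct hw).mdifferentiableAt (by simp))
      ((contDiff_prodMk_left (𝕜 := ℝ) (n := ∞) w).contMDiff.contMDiffAt.mdifferentiableAt (by simp))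
    rw [mder_eq_fderiv (f := fun u : EG => (u, w)), (hasFDerivAt_prodMk_left _ _).fderiv] at h1
    rw [← h1]
    have h2 : (φ ∘ fun u : EG => (u, w)) = (fun g : G => op g • χ.symm w) ∘ c.symm := rfl
    rw [h2, mder_comp (I' := 𝓘(ℝ, EG)) (S.actP.mdiff_orbit _ _)
      ((contMDiffAt_extChartAt_symm_of_mem 1 hct).mdifferentiableAt (by simp)),
      mder_extChartAt_symm_self, hc1]
    rfl
  have hd2 : ∀ u ∈ c.target, (mder 𝓘(ℝ, EG × EP) 𝓘(ℝ, EP) φ (u, χ p)).comp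
      (ContinuousLinearMap.inr ℝ EG EP) =
        mder 𝓘(ℝ, EP) 𝓘(ℝ, EP) (fun p : P => op (c.symm u) • p) p := by
    intro u hu
    have h1 := mder_comp (g := φ) (f := fun w : EP => (u, w)) (x := χ p) (I := 𝓘(ℝ, EP))
      (I' := 𝓘(ℝ, EG × EP)) ((hφ (u, χ p) hu hχt).mdifferentiableAt (by simp))
      ((contDiff_prodMk_right (𝕜 := ℝ) (n := ∞) u).contMDiff.contMDiffAt.mdifferentiableAt (by simp))
    rw [mder_eq_fderiv (f := fun w : EP => (u, w)), (hasFDerivAt_prodMk_right _ _).fderiv] at h1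
    rw [← h1]
    have h2 : (φ ∘ fun w : EP => (u, w)) = (fun p : P => op (c.symm u) • p) ∘ χ.symm := rfl
    rw [h2, mder_comp (I' := 𝓘(ℝ, EP)) (S.actP.mdiff_act _ _)
      ((contMDiffAt_extChartAt_symm_of_mem p hχt).mdifferentiableAt (by simp)),
      mder_extChartAt_symm_self, hχp]
    rfl
  -- the pullback of the potential form in the two directions
  have hsm := S.isSmoothForm_potentialForm A μ hA
  have hAP := S.isPrincipalConnection_pullbackForm hA
  have hη := hsm.contDiffAt_formAlong hev
  have hηd := hη.differentiableAt (by simp)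
  have hv1 : ∀ w ∈ χ.target, formAlong φ α (c 1, w) ![(ξ, 0)] = (μ + S.δ (χ.symm w)) ξ := by
    intro w hw
    have h1 : φ (c 1, w) = χ.symm w := by simp only [φ, hc1, op_one, one_smul]
    have h2 := congrArg (fun T : EG →L[ℝ] EP => T ξ) (hd1 w hw)
    have h3 := formAt_eq_toCovector α (φ (c 1, w))
      (fun i => mder 𝓘(ℝ, EG × EP) 𝓘(ℝ, EP) φ (c 1, w) (![(ξ, 0)] i))
    refine h3.trans ?_
    have h4 : mder 𝓘(ℝ, EG × EP) 𝓘(ℝ, EP) φ (c 1, w) (![(ξ, (0 : EP))] 0) =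
      (infActL G (χ.symm w) : EG →L[ℝ] EP) ξ := h2
    rw [h4, h1, toCovector_potentialForm, hAP.toCovector_infActL]
  have hv2 : ∀ u ∈ c.target, formAlong φ α (u, χ p) ![(0, v)] =
      (S.orbitMap μ p (c.symm u) + S.δ p)
        (toCovector (pullbackForm S.ε A : DiffForm EP P 1 EG) p v) := by
    intro u hu
    have h1 : φ (u, χ p) = op (c.symm u) • p := by simp only [φ, hχp]
    have h2 := congrArg (fun T : EP →L[ℝ] EP => T v) (hd2 u hu)
    have h3 := formAt_eq_toCovector α (φ (u, χ p))
      (fun i => mder 𝓘(ℝ, EG × EP) 𝓘(ℝ, EP) φ (u, χ p) (![(0, v)] i))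
    refine h3.trans ?_
    have h4 : mder 𝓘(ℝ, EG × EP) 𝓘(ℝ, EP) φ (u, χ p) (![((0 : EG), v)] 0) =
      mder 𝓘(ℝ, EP) 𝓘(ℝ, EP) (fun p : P => op (c.symm u) • p) p v := h2
    rw [h4, h1]
    -- The value at the moved point on the moved vector is that of the pullback by the group
    -- element, in which κ(g) takes the place of μ.
    have h5 := congrArg (fun η : DiffForm EP P 1 ℝ => toCovector η p v)
      (S.pullbackForm_potentialForm μ hA (c.symm u))
    exact h5
  -- derivatives of these functions
  have hD1 : fderiv ℝ (fun q => formAlong φ α q ![(0, v)]) (c 1, χ p) (ξ, 0) =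
      mder 𝓘(ℝ, EG) 𝓘(ℝ, EG →L[ℝ] ℝ) (S.orbitMap μ p) 1 ξ
          (toCovector (pullbackForm S.ε A : DiffForm EP P 1 EG) p v) := by
    have h0 : DifferentiableAt ℝ (fun q => formAlong φ α q ![(0, v)]) (c 1, χ p) :=
      hηd.continuousAlternatingMap_apply (g := fun i _ => ![(0, v)] i) fun i =>
        differentiableAt_const _
    have h1 := (HasFDerivAt.comp (f := fun u : EG => (u, χ p)) (c 1) h0.hasFDerivAt
      (hasFDerivAt_prodMk_left (c 1) (χ p))).fderiv
    set a := toCovector (pullbackForm S.ε A : DiffForm EP P 1 EG) p v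
    have h2 : ((fun q => formAlong φ α q ![(0, v)]) ∘ fun u : EG => (u, χ p)) =ᶠ[𝓝 (c 1)]
        fun u => (S.orbitMap μ p ∘ c.symm) u a + S.δ p a := by
      filter_upwards [hcev] with u hu
      exact hv2 u hu
    have h3 : ContMDiffAt 𝓘(ℝ, EG) 𝓘(ℝ, EG →L[ℝ] ℝ) ∞ (S.orbitMap μ p ∘ c.symm) (c 1) :=
      (S.contMDiff_orbitMap μ p _).comp _ (contMDiffAt_extChartAt_symm_of_mem 1 hct)
    have h4 : fderiv ℝ (S.orbitMap μ p ∘ c.symm) (c 1) =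
        mder 𝓘(ℝ, EG) 𝓘(ℝ, EG →L[ℝ] ℝ) (S.orbitMap μ p) 1 := by
      rw [← mder_eq_fderiv, mder_comp (I' := 𝓘(ℝ, EG))
        ((S.contMDiff_orbitMap μ p _).mdifferentiableAt (by simp))
        ((contMDiffAt_extChartAt_symm_of_mem 1 hct).mdifferentiableAt (by simp)),
        mder_extChartAt_symm_self, hc1]
      rfl
    have h5 : HasFDerivAt (fun u => (S.orbitMap μ p ∘ c.symm) u a + S.δ p a)
        ((ContinuousLinearMap.apply ℝ ℝ a).comp (fderiv ℝ (S.orbitMap μ p ∘ c.symm) (c 1))) (c 1) :=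
      ((ContinuousLinearMap.apply ℝ ℝ a).hasFDerivAt.comp (c 1)
        (h3.contDiffAt.differentiableAt (by simp)).hasFDerivAt).add_const _
    rw [h2.fderiv_eq, h5.fderiv, h4] at h1
    exact (congrArg (fun T : EG →L[ℝ] ℝ => T ξ) h1).symm
  have hD2 : fderiv ℝ (fun q => formAlong φ α q ![(ξ, 0)]) (c 1, χ p) (0, v) =
      formAt S.B p ![(infActL G p : EG →L[ℝ] EP) ξ, v] := by
    have h0 : DifferentiableAt ℝ (fun q => formAlong φ α q ![(ξ, 0)]) (c 1, χ p) :=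
      hηd.continuousAlternatingMap_apply (g := fun i _ => ![(ξ, 0)] i) fun i =>
        differentiableAt_const _
    have h1 := (HasFDerivAt.comp (f := fun w : EP => (c 1, w)) (χ p) h0.hasFDerivAt
      (hasFDerivAt_prodMk_right (c 1) (χ p))).fderiv
    have h2 : ((fun q => formAlong φ α q ![(ξ, 0)]) ∘ fun w : EP => (c 1, w)) =ᶠ[𝓝 (χ p)]
        fun w => μ ξ + ((fun p' => S.δ p' ξ) ∘ χ.symm) w := by
      filter_upwards [hχev] with w hw
      exact hv1 w hw
    have h3 : ContMDiff 𝓘(ℝ, EP) 𝓘(ℝ, ℝ) ∞ (fun p' => S.δ p' ξ) :=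
      S.δ_smooth.clm_apply contMDiff_const
    have h4 : fderiv ℝ ((fun p' => S.δ p' ξ) ∘ χ.symm) (χ p) =
        mder 𝓘(ℝ, EP) 𝓘(ℝ, ℝ) (fun p' => S.δ p' ξ) p := by
      rw [← mder_eq_fderiv, mder_comp (I' := 𝓘(ℝ, EP)) ((h3 _).mdifferentiableAt (by simp))
        ((contMDiffAt_extChartAt_symm_of_mem p hχt).mdifferentiableAt (by simp)),
        mder_extChartAt_symm_self, hχp]
      rfl
    rw [h2.fderiv_eq, fderiv_const_add, h4] at h1
    refine (congrArg (fun T : EP →L[ℝ] ℝ => T v) h1).symm.trans ?_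
    exact (S.δ_potential ξ p v).symm
  have hext := congrArg (fun T : (EG × EP) [⋀^Fin 2]→L[ℝ] ℝ => T ![(ξ, 0), (0, v)])
    (extDeriv_formAlong hsm hev)
  have hlhs := extDeriv_apply hηd ![(ξ, 0), (0, v)]
  have hr0 : (0 : Fin 2).removeNth ![((ξ, 0) : EG × EP), (0, v)] = ![(0, v)] := by
    funext i; fin_cases i; rfl
  have hr1 : (1 : Fin 2).removeNth ![((ξ, 0) : EG × EP), (0, v)] = ![(ξ, 0)] := by
    funext i; fin_cases i; rfl
  rw [Fin.sum_univ_two, hr0, hr1] at hlhs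
  simp only [Fin.val_zero, pow_zero, one_smul, Matrix.cons_val_zero, Fin.val_one, pow_one,
    neg_smul, Matrix.cons_val_one] at hlhs
  rw [hD1, hD2, ← sub_eq_add_neg] at hlhs
  rw [← hlhs]
  refine Eq.trans ?_ hext.symm
  have h1 : φ (c 1, χ p) = p := by simp only [φ, hc1, op_one, one_smul, hχp]
  have h2 := congrArg (fun T : EG →L[ℝ] EP => T ξ) (hd1 (χ p) hχt)
  have h3 := congrArg (fun T : EP →L[ℝ] EP => T v) (hd2 (c 1) hct)
  have h4 : (fun p : P => op (c.symm (c 1)) • p) = id := by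
    funext p; rw [hc1, op_one, one_smul]; rfl
  rw [h4, mder_id] at h3
  rw [hχp] at h2
  change _ = formAt (extD α) (φ (c 1, χ p)) (fun i => mder 𝓘(ℝ, EG × EP) 𝓘(ℝ, EP) φ (c 1, χ p)
    (![(ξ, 0), (0, v)] i))
  rw [h1]
  congr 1
  funext i
  fin_cases i
  · exact h2.symm
  · exact h3.symm

/-- The reduced magnetic form is horizontal with respect to the isotropy group. -/
theorem magnetic_infActL_eq_zero (hA : IsPrincipalConnection G A) (p : P) (ξ : EG)
    (hξ : mder 𝓘(ℝ, EG) 𝓘(ℝ, EG →L[ℝ] ℝ) (S.orbitMap μ p) 1 ξ = 0) (v : EP) :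
    formAt (S.B + extD (S.potentialForm A μ)) p ![(infActL G p : EG →L[ℝ] EP) ξ, v] = 0 := by
  have h : formAt (S.B + extD (S.potentialForm A μ)) p ![(infActL G p : EG →L[ℝ] EP) ξ, v] =
    formAt S.B p ![(infActL G p : EG →L[ℝ] EP) ξ, v] +
      formAt (extD (S.potentialForm A μ)) p ![(infActL G p : EG →L[ℝ] EP) ξ, v] := rfl
  rw [h, S.extD_potentialForm_infActL μ hA, hξ]
  simp

variable [ConnectedSpace P] [T2Space P]

/-- The form is basic: it annihilates the kernel of the projection, by horizontality, and is
`G_μ`-invariant. Hence its values depend only on projections. -/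
theorem existsUnique_reduced_magnetic (hA : IsPrincipalConnection G A)
    (Y : QuotientManifold 𝓘(ℝ, EP) (S.orbitsP μ)) :
    ∃! Bred : DiffForm (EuclideanSpace ℝ (Fin Y.dim)) (Quotient (S.orbitsP μ)) 2 ℝ,
      IsSmoothForm Bred ∧ pullbackForm (Quotient.mk (S.orbitsP μ)) Bred =
        S.B + extD (S.potentialForm A μ) := by
  refine existsUnique_pullbackForm_eq Y.isSubmersion Quotient.mk_surjective
    (S.isSmoothForm_magnetic μ hA) ?_
  set η := S.B + extD (S.potentialForm A μ) with hη
  -- vertical vectors are in the kernel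
  have hker : ∀ (x : P) (a b : EP), mder 𝓘(ℝ, EP) (𝓡 Y.dim) (Quotient.mk (S.orbitsP μ)) x a = 0 →
      formAt η x ![a, b] = 0 := by
    intro x a b ha
    obtain ⟨ξ, hξ, rfl⟩ := S.actP.exists_of_mder_mk_eq_zero (S.infActL_injective hA)
      (S.isAffineOrbitMap μ x) (S.orbitsP_iff μ x) Y x a ha
    exact S.magnetic_infActL_eq_zero μ hA x ξ hξ b
  -- Vectors with equal projections differ by a vertical one; the two arguments are exchanged one at
  -- a time, the second after a transposition.
  have hker2 : ∀ (x : P) (v w : Fin 2 → EP),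
      (∀ i, mder 𝓘(ℝ, EP) (𝓡 Y.dim) (Quotient.mk (S.orbitsP μ)) x (v i) =
        mder 𝓘(ℝ, EP) (𝓡 Y.dim) (Quotient.mk (S.orbitsP μ)) x (w i)) →
      formAt η x v = formAt η x w := by
    intro x v w h
    have e : ∀ u : Fin 2 → EP, u = ![u 0, u 1] := fun u => by
      funext i; fin_cases i <;> rfl
    have h1 : formAt η x ![v 0, v 1] = formAt η x ![w 0, v 1] := by
      have h2 := (formAt η x).map_vecCons_sub (v 0) (w 0) ![v 1]
      rw [hker x _ _ (by rw [map_sub, h 0, sub_self])] at h2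
      exact (sub_eq_zero.1 h2.symm)
    have h3 : formAt η x ![w 0, v 1] = formAt η x ![w 0, w 1] := by
      have hswap : ∀ a b : EP, formAt η x ![a, b] = - formAt η x ![b, a] := fun a b => by
        have h4 := (formAt η x).map_swap ![b, a] (i := 0) (j := 1) (by simp)
        have h5 : ![a, b] = ![b, a] ∘ Equiv.swap (0 : Fin 2) 1 := by
          funext i; fin_cases i <;> rfl
        rw [h5]
        exact h4
      rw [hswap, hswap (w 0)]
      have h2 := (formAt η x).map_vecCons_sub (v 1) (w 1) ![w 0]
      rw [hker x _ _ (by rw [map_sub, h 1, sub_self])] at h2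
      rw [sub_eq_zero.1 h2.symm]
    rw [e v, e w, h1, h3]
  intro x y v w hxy hvw
  obtain ⟨k, hk, rfl⟩ := (S.orbitsP_iff μ x x y).1 (Quotient.exact hxy)
  have hk' := (S.orbitMap_eq_iff μ x k).1 hk
  have hinv : ∀ u : Fin 2 → EP, formAt η (op k • x)
      (fun i => mder 𝓘(ℝ, EP) 𝓘(ℝ, EP) (fun p : P => op k • p) x (u i)) = formAt η x u := fun u =>
    congrArg (fun ζ : DiffForm EP P 2 ℝ => formAt ζ x u) (S.pullbackForm_magnetic_eq_self μ hA hk')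
  -- Invariance moves the evaluation from `x` to the equivalent point `op k • x`, so that both sides
  -- live in one tangent space.
  rw [← hinv v]
  refine hker2 _ _ _ fun i => ?_
  rw [← hvw i]
  have h1 : Quotient.mk (S.orbitsP μ) ∘ (fun p : P => op k • p) = Quotient.mk (S.orbitsP μ) := by
    funext z
    exact (Quotient.sound ((S.orbitsP_iff μ x z (op k • z)).2 ⟨k, hk, rfl⟩)).symm
  have hmk : ∀ z, MDifferentiableAt 𝓘(ℝ, EP) (𝓡 Y.dim) (Quotient.mk (S.orbitsP μ)) z := fun z =>
    (Y.isSubmersion.isSubmersionAt z).contMDiffAt.mdifferentiableAt (by simp)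
  have h2 := mder_comp (g := Quotient.mk (S.orbitsP μ)) (f := fun p : P => op k • p) (x := x)
    (I := 𝓘(ℝ, EP)) (hmk _) (S.actP.mdiff_act k x)
  rw [h1] at h2
  exact (congrArg (fun T : EP →L[ℝ] EuclideanSpace ℝ (Fin Y.dim) => T (v i)) h2).symm

end MagneticSystem

/-! ### Quotients by the fibres of a map with local sections. -/

section QuotientsBySubmersions

variable {E H M ET HT T : Type*} [NormedAddCommGroup E] [NormedSpace ℝ E]
  [TopologicalSpace H] [TopologicalSpace M] [ChartedSpace H M] [NormedAddCommGroup ET]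
  [NormedSpace ℝ ET] [TopologicalSpace HT] [TopologicalSpace T]
  [ChartedSpace HT T] {I : ModelWithCorners ℝ E H} {J : ModelWithCorners ℝ ET HT}
  [IsManifold I ∞ M] [I.Boundaryless] {s : Setoid M} {Ψ : M → T}

/-- The quotient of a manifold by the fibres of a smooth map with local sections is a manifold. -/
theorem nonempty_quotientManifold_of_localSections [FiniteDimensional ℝ E] [FiniteDimensional ℝ ET]
    [IsManifold J ∞ T] [Nonempty M] (hΨ : ContMDiff I J ∞ Ψ)
    (hs : ∀ x y, s.r x y ↔ Ψ x = Ψ y)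
    (hsec : ∀ x, ∃ τ : T → M, ContMDiffAt J I ∞ τ (Ψ x) ∧ τ (Ψ x) = x ∧ ∀ t, Ψ (τ t) = t) :
    Nonempty (QuotientManifold I s) := by
  set d := Module.finrank ℝ ET with hd
  let ι : ET ≃L[ℝ] EuclideanSpace ℝ (Fin d) := ContinuousLinearEquiv.ofFinrankEq (by simp [hd])
  have hsurj : ∀ x, Function.Surjective (mder I J Ψ x) := fun x => by
    obtain ⟨τ, h1, h2, h3⟩ := hsec x
    exact mder_surjective_of_localSection ((hΨ x).mdifferentiableAt (by simp))
      (h1.mdifferentiableAt (by simp)) h2 (Filter.Eventually.of_forall h3)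
  have hle : d ≤ Module.finrank ℝ E := by
    obtain ⟨x⟩ := ‹Nonempty M›
    exact LinearMap.finrank_le_finrank_of_surjective (f := (mder I J Ψ x).toLinearMap) (hsurj x)
  let F := EuclideanSpace ℝ (Fin (Module.finrank ℝ E - d))
  have hdim : Module.finrank ℝ E =
      Module.finrank ℝ (EuclideanSpace ℝ (Fin d)) + Module.finrank ℝ F := by
    simp only [F, finrank_euclideanSpace, Fintype.card_fin]
    omega
  refine nonempty_quotientManifold (F := F) (d := d)
    (ContinuousLinearEquiv.ofFinrankEq (hdim.trans Module.finrank_prod.symm)) ?_ fun x => ?_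
  · intro x y hxy
    have hxy' := (hs x y).1 hxy
    obtain ⟨τ, h1, h2, h3⟩ := hsec y
    rw [← hxy'] at h1 h2
    -- With τ a section through `y`, the map τ ∘ Ψ preserves the fibres of Ψ and sends `x` to `y`.
    exact ⟨τ ∘ Ψ, h1.comp x (hΨ x), h2, Filter.Eventually.of_forall fun z => (hs _ _).2 (h3 _).symm⟩
  · have hc := contMDiffAt_extChartAt_of_mem (I := J) (Ψ x) (mem_extChartAt_source (Ψ x))
    have hU : Ψ ⁻¹' (extChartAt J (Ψ x)).source ∈ 𝓝 x :=
      (hΨ x).continuousAt (extChartAt_source_mem_nhds (Ψ x))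
    refine exists_adaptedChart (h := ι ∘ extChartAt J (Ψ x) ∘ Ψ) ?_ ?_ hdim
      ⟨_, hU, fun y hy z hz => ?_⟩
    · filter_upwards [hU] with y hy
      exact ι.contDiff.contMDiff.contMDiffAt.comp y
        ((contMDiffAt_extChartAt_of_mem _ hy).comp y (hΨ y))
    · rw [mder_comp (I' := 𝓘(ℝ, ET)) ι.differentiable.differentiableAt.mdifferentiableAt
          ((hc.comp x (hΨ x)).mdifferentiableAt (by simp)),
        mder_comp (I' := J) (hc.mdifferentiableAt (by simp)) ((hΨ x).mdifferentiableAt (by simp)),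
        mder_extChartAt_self, mder_eq_fderiv, ContinuousLinearEquiv.fderiv]
      exact ι.surjective.comp (hsurj x)
    · rw [hs]
      simp only [Function.comp, ι.injective.eq_iff]
      exact ⟨fun h => by rw [h], fun h => (extChartAt J (Ψ x)).injOn hy hz h⟩

/-- A surjective smooth map with local sections induces a diffeomorphism from the quotient manifold. -/
theorem exists_diffeomorph_of_localSections (hΨ : ContMDiff I J ∞ Ψ)
    (hs : ∀ x y, s.r x y ↔ Ψ x = Ψ y) (hsurj : Function.Surjective Ψ)
    (hsec : ∀ x, ∃ τ : T → M, ContMDiffAt J I ∞ τ (Ψ x) ∧ τ (Ψ x) = x ∧ ∀ t, Ψ (τ t) = t)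
    (Z : QuotientManifold I s) :
    ∃ Φ : Quotient s ≃ₘ^∞⟮𝓡 Z.dim, J⟯ T, ∀ x, Φ (Quotient.mk s x) = Ψ x := by
  have hmk : ContMDiff I (𝓡 Z.dim) ∞ (Quotient.mk s) := fun x =>
    (Z.isSubmersion.isSubmersionAt x).contMDiffAt
  let e : Quotient s ≃ T := Equiv.ofBijective (Quotient.lift Ψ fun x y h => (hs x y).1 h) ⟨by
    rintro ⟨x⟩ ⟨y⟩ h
    exact Quotient.sound ((hs x y).2 h), fun t => by
    obtain ⟨x, hx⟩ := hsurj t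
    exact ⟨Quotient.mk s x, hx⟩⟩
  have he : ∀ x, e (Quotient.mk s x) = Ψ x := fun _ => rfl
  -- Locally the bijection is Ψ composed with a section of the quotient, and its inverse is the
  -- projection composed with a section of Ψ.
  refine ⟨⟨e, ?_, ?_⟩, he⟩
  · rintro ⟨x⟩
    obtain ⟨σ, h1, h2, h3⟩ := exists_localSection (Z.isSubmersion.isSubmersionAt x)
    refine ((hΨ _).comp (Quotient.mk s x) h1.self_of_nhds).congr_of_eventuallyEq ?_
    filter_upwards [h3] with n hn
    rw [Function.comp, ← he, hn]
  · intro t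
    obtain ⟨x, rfl⟩ := hsurj t
    obtain ⟨τ, h1, -, h3⟩ := hsec x
    refine ((hmk _).comp (Ψ x) h1).congr_of_eventuallyEq (Filter.Eventually.of_forall fun t => ?_)
    refine e.injective ?_
    change e (e.symm t) = e (Quotient.mk s (τ t))
    rw [e.apply_symm_apply, he, h3]

end QuotientsBySubmersions

/-! ### Smooth families of covectors and the pullback of the cotangent bundle. -/

section CovectorFields

variable {E H M EB B EC C F : Type*} [NormedAddCommGroup E] [NormedSpace ℝ E] [TopologicalSpace H]
  [TopologicalSpace M] [ChartedSpace H M] {I : ModelWithCorners ℝ E H}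
  [NormedAddCommGroup EB] [NormedSpace ℝ EB] [TopologicalSpace B] [ChartedSpace EB B]
  [NormedAddCommGroup EC] [NormedSpace ℝ EC] [TopologicalSpace C] [ChartedSpace EC C]
  [NormedAddCommGroup F] [NormedSpace ℝ F]

variable (I) in
/-- A family of covectors along a map `b` is smooth at a point if its expression in the preferred chart
of the base is. -/
def CovectorSmoothAt (b : M → B) (β : M → EB →L[ℝ] ℝ) (x : M) : Prop :=
  ContMDiffAt I 𝓘(ℝ, EB →L[ℝ] ℝ) ∞ (fun m => (β m).comp
    (mder 𝓘(ℝ, EB) 𝓘(ℝ, EB) (extChartAt 𝓘(ℝ, EB) (b x)).symm (extChartAt 𝓘(ℝ, EB) (b x) (b m)))) x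

variable {b : M → B} {β β' : M → EB →L[ℝ] ℝ} {x : M}

theorem CovectorSmoothAt.add (h : CovectorSmoothAt I b β x) (h' : CovectorSmoothAt I b β' x) :
    CovectorSmoothAt I b (fun m => β m + β' m) x :=
  (ContMDiffAt.add h h').congr_of_eventuallyEq
    (Filter.Eventually.of_forall fun _ => ContinuousLinearMap.add_comp _ _ _)

theorem CovectorSmoothAt.sub (h : CovectorSmoothAt I b β x) (h' : CovectorSmoothAt I b β' x) :
    CovectorSmoothAt I b (fun m => β m - β' m) x :=
  (ContMDiffAt.sub h h').congr_of_eventuallyEq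
    (Filter.Eventually.of_forall fun _ => ContinuousLinearMap.sub_comp _ _ _)

variable [IsManifold 𝓘(ℝ, EB) ∞ B]

theorem covectorSmoothAt_pairing {A : DiffForm EB B 1 F} (hA : IsSmoothForm A)
    {ν : M → F →L[ℝ] ℝ} (hν : ContMDiffAt I 𝓘(ℝ, F →L[ℝ] ℝ) ∞ ν x)
    (hb : ContMDiffAt I 𝓘(ℝ, EB) ∞ b x) :
    CovectorSmoothAt I b (fun m => (ν m).comp (toCovector A (b m))) x := by
  have h1 : ContMDiffAt I 𝓘(ℝ, EB) ∞ (extChartAt 𝓘(ℝ, EB) (b x) ∘ b) x :=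
    (contMDiffAt_extChartAt_of_mem _ (mem_extChartAt_source (b x))).comp x hb
  have h2 : ContMDiffAt I 𝓘(ℝ, EB →L[ℝ] F) ∞ (fun m =>
      (ContinuousAlternatingMap.ofSubsingletonLIE (𝕜 := ℝ) (E := EB) (F := F) (0 : Fin 1)).symm
        (formInChart A (b x) (extChartAt 𝓘(ℝ, EB) (b x) (b m)))) x :=
    (LinearIsometryEquiv.contDiff _).contMDiff.contMDiffAt.comp x
      ((hA.contDiffAt_formInChart _ (mem_extChartAt_target (I := 𝓘(ℝ, EB)) (b x))).contMDiffAt.comp x h1)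
  refine (hν.clm_comp h2).congr_of_eventuallyEq ?_
  filter_upwards [hb.continuousAt.eventually_mem (extChartAt_source_mem_nhds (I := 𝓘(ℝ, EB)) (b x))] with m hm
  rw [ContinuousLinearMap.comp_assoc]
  congr 1
  have h3 : toCovector A (b m) = toCovector A
      ((extChartAt 𝓘(ℝ, EB) (b x)).symm (extChartAt 𝓘(ℝ, EB) (b x) (b m))) := by
    rw [(extChartAt 𝓘(ℝ, EB) (b x)).left_inv hm]
  rw [h3]
  rfl

/-- Inserting the identity (chart)⁻¹ ∘ chart on the target splits the pulled back covector into the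
chart expressions of β and of the derivative of g. -/
theorem covector_comp_eventuallyEq {q : M → C} {g : C → B}
    (hq : ContMDiffAt I 𝓘(ℝ, EC) ∞ q x) (hg : ContMDiffAt 𝓘(ℝ, EC) 𝓘(ℝ, EB) ∞ g (q x)) :
    ∀ᶠ m in 𝓝 x, ((β m).comp (mder 𝓘(ℝ, EC) 𝓘(ℝ, EB) g (q m))).comp
        (mder 𝓘(ℝ, EC) 𝓘(ℝ, EC) (extChartAt 𝓘(ℝ, EC) (q x)).symm
            (extChartAt 𝓘(ℝ, EC) (q x) (q m))) =
      ((β m).comp (mder 𝓘(ℝ, EB) 𝓘(ℝ, EB) (extChartAt 𝓘(ℝ, EB) (g (q x))).symm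
        (extChartAt 𝓘(ℝ, EB) (g (q x)) (g (q m))))).comp
      ((mder 𝓘(ℝ, EB) 𝓘(ℝ, EB) (extChartAt 𝓘(ℝ, EB) (g (q x))) (g (q m))).comp
        ((mder 𝓘(ℝ, EC) 𝓘(ℝ, EB) g (q m)).comp
          (mder 𝓘(ℝ, EC) 𝓘(ℝ, EC) (extChartAt 𝓘(ℝ, EC) (q x)).symm
            (extChartAt 𝓘(ℝ, EC) (q x) (q m))))) := by
  filter_upwards [(hg.continuousAt.comp hq.continuousAt).eventually_mem
    (extChartAt_source_mem_nhds (I := 𝓘(ℝ, EB)) (g (q x)))] with m hm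
  have h := mder_symm_comp_mder_extChartAt (I := 𝓘(ℝ, EB)) (g (q x)) hm
  ext v
  have h' := fun w => congrArg (fun L : EB →L[ℝ] EB => β m (L w)) h
  exact (h' _).symm

/-- In the trivialization, a covector is composed with the derivative of the inverse chart of the
base, while the coordinate change on the trivial line bundle is the identity. This matches
`CovectorSmoothAt`. -/
theorem contMDiffAt_pullbackCotangent_iff {EN N K : Type*} [NormedAddCommGroup EN] [NormedSpace ℝ EN]
    [TopologicalSpace N] [ChartedSpace EN N] [FunLike K N B] [ContinuousMapClass K N B] {f : K}
    {h : M → PullbackCotangent EB f} :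
    ContMDiffAt I (𝓘(ℝ, EN).prod 𝓘(ℝ, EB →L[ℝ] ℝ)) ∞ h x ↔
      ContMDiffAt I 𝓘(ℝ, EN) ∞ (fun m => (h m).proj) x ∧
        CovectorSmoothAt I (fun m => f (h m).proj) (fun m => (h m).covector) x := by
  rw [contMDiffAt_totalSpace]
  refine and_congr_right fun hp => ?_
  refine Filter.EventuallyEq.contMDiffAt_iff ?_
  have hc : ContinuousAt (fun m => f (h m).proj) x :=
    (map_continuous f).continuousAt.comp hp.continuousAt
  have : IsManifold 𝓘(ℝ, EB) 1 B := .of_le (n := ∞) (by simp)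
  filter_upwards [hc.eventually_mem (chart_source_mem_nhds EB (f (h x).proj))] with m hm
  have h1 := TangentBundle.symmL_trivializationAt (I := 𝓘(ℝ, EB)) hm
  rw [ModelWithCorners.Boundaryless.range_eq_univ, mfderivWithin_univ] at h1
  have h2 : (trivializationAt ℝ (Trivial B ℝ) (f (h x).proj)).continuousLinearMapAt ℝ
      (f (h m).proj) = ContinuousLinearMap.id ℝ ℝ :=
    Trivial.continuousLinearMapAt_trivialization ℝ B ℝ (f (h m).proj)
  exact (congrArg₂ (fun (L : ℝ →L[ℝ] ℝ) (T : EB →L[ℝ] EB) =>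
    L.comp (((h m).covector : EB →L[ℝ] ℝ).comp T)) h2 h1).trans (ContinuousLinearMap.id_comp _)

theorem isManifold_pullbackCotangent {EN N : Type*} [NormedAddCommGroup EN] [NormedSpace ℝ EN]
    [TopologicalSpace N] [ChartedSpace EN N] [IsManifold 𝓘(ℝ, EN) ∞ N]
    (f : C^∞⟮𝓘(ℝ, EN), N; 𝓘(ℝ, EB), B⟯) :
    IsManifold (𝓘(ℝ, EN).prod 𝓘(ℝ, EB →L[ℝ] ℝ)) ∞ (PullbackCotangent EB f) :=
  inferInstance

/-- Needed for `reducedε`, which is bundled only as a continuous map: its smoothness refers to the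
quotient structures chosen on both sides. -/
theorem isManifold_pullbackCotangent_of_contMDiff {EN N : Type*} [NormedAddCommGroup EN]
    [NormedSpace ℝ EN] [TopologicalSpace N] [ChartedSpace EN N] [IsManifold 𝓘(ℝ, EN) ∞ N]
    (f : C(N, B)) (hf : ContMDiff 𝓘(ℝ, EN) 𝓘(ℝ, EB) ∞ f) :
    IsManifold (𝓘(ℝ, EN).prod 𝓘(ℝ, EB →L[ℝ] ℝ)) ∞ (PullbackCotangent EB f) :=
  isManifold_pullbackCotangent ⟨f, hf⟩

variable [IsManifold 𝓘(ℝ, EC) ∞ C]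

/-- The coordinate expression of the derivative of a smooth map. -/
theorem contMDiffAt_mder_in_charts {q : M → C} {g : C → B}
    (hq : ContMDiffAt I 𝓘(ℝ, EC) ∞ q x) (hg : ContMDiffAt 𝓘(ℝ, EC) 𝓘(ℝ, EB) ∞ g (q x)) :
    ContMDiffAt I 𝓘(ℝ, EC →L[ℝ] EB) ∞ (fun m =>
      (mder 𝓘(ℝ, EB) 𝓘(ℝ, EB) (extChartAt 𝓘(ℝ, EB) (g (q x))) (g (q m))).comp
        ((mder 𝓘(ℝ, EC) 𝓘(ℝ, EB) g (q m)).comp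
          (mder 𝓘(ℝ, EC) 𝓘(ℝ, EC) (extChartAt 𝓘(ℝ, EC) (q x)).symm
            (extChartAt 𝓘(ℝ, EC) (q x) (q m))))) x :=
  ContMDiffAt.comp x (contMDiffAt_mder (J := 𝓘(ℝ, EC)) (f := fun _ : C => g) (g := fun c : C => c)
    (ContMDiffAt.comp (g := g) (f := Prod.snd) (q x, q x) hg contMDiffAt_snd) contMDiffAt_id) hq

/-- Pullbacks of smooth families of covectors are smooth. -/
theorem CovectorSmoothAt.pullback {q : M → C} {g : C → B}
    (h : CovectorSmoothAt I (g ∘ q) β x) (hq : ContMDiffAt I 𝓘(ℝ, EC) ∞ q x)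
    (hg : ContMDiffAt 𝓘(ℝ, EC) 𝓘(ℝ, EB) ∞ g (q x)) :
    CovectorSmoothAt I q (fun m => (β m).comp (mder 𝓘(ℝ, EC) 𝓘(ℝ, EB) g (q m))) x :=
  (ContMDiffAt.clm_comp h (contMDiffAt_mder_in_charts hq hg)).congr_of_eventuallyEq
    (covector_comp_eventuallyEq hq hg)

/-- A family of covectors whose pullback by a submersion is smooth is smooth. -/
theorem CovectorSmoothAt.of_pullback [FiniteDimensional ℝ EB] {q : M → C} {g : C → B}
    (hq : ContMDiffAt I 𝓘(ℝ, EC) ∞ q x)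
    (hg : ContMDiffAt 𝓘(ℝ, EC) 𝓘(ℝ, EB) ∞ g (q x))
    (hs : Function.Surjective (mder 𝓘(ℝ, EC) 𝓘(ℝ, EB) g (q x)))
    (h : CovectorSmoothAt I q (fun m => (β m).comp (mder 𝓘(ℝ, EC) 𝓘(ℝ, EB) g (q m))) x) :
    CovectorSmoothAt I (g ∘ q) β x := by
  have : CompleteSpace EB := FiniteDimensional.complete ℝ EB
  have hT := contMDiffAt_mder_in_charts hq hg
  have heq := covector_comp_eventuallyEq (β := β) hq hg
  set T : M → EC →L[ℝ] EB := fun m =>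
      (mder 𝓘(ℝ, EB) 𝓘(ℝ, EB) (extChartAt 𝓘(ℝ, EB) (g (q x))) (g (q m))).comp
        ((mder 𝓘(ℝ, EC) 𝓘(ℝ, EB) g (q m)).comp
          (mder 𝓘(ℝ, EC) 𝓘(ℝ, EC) (extChartAt 𝓘(ℝ, EC) (q x)).symm
            (extChartAt 𝓘(ℝ, EC) (q x) (q m)))) with hTdef
  have hTx : T x = mder 𝓘(ℝ, EC) 𝓘(ℝ, EB) g (q x) := by
    simp only [hTdef, mder_extChartAt_self, mder_extChartAt_symm_self, ContinuousLinearMap.comp_id,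
      ContinuousLinearMap.id_comp]
  obtain ⟨R, hR⟩ := LinearMap.exists_rightInverse_of_surjective
    (mder 𝓘(ℝ, EC) 𝓘(ℝ, EB) g (q x)).toLinearMap (LinearMap.range_eq_top.2 hs)
  let R' : EB →L[ℝ] EC := R.toContinuousLinearMap
  -- A right inverse `R'` of the derivative at `x`, kept constant, makes T R' equal to the identity
  -- at `x` and invertible nearby. Then β is recovered as (β T) R' (T R')⁻¹, a smooth expression.
  let W : M → EB →L[ℝ] EB := fun m => (T m).comp R'
  have hWx : W x = (ContinuousLinearEquiv.refl ℝ EB : EB →L[ℝ] EB) := by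
    simp only [W, hTx]
    ext v
    exact congrArg (fun L : EB →ₗ[ℝ] EB => L v) hR
  have hW : ContMDiffAt I 𝓘(ℝ, EB →L[ℝ] EB) ∞ W x := hT.clm_comp contMDiffAt_const
  have hinv : ContMDiffAt I 𝓘(ℝ, EB →L[ℝ] EB) ∞ (fun m => ContinuousLinearMap.inverse (W m)) x := by
    have h1 := contDiffAt_map_inverse (𝕜 := ℝ) (n := ∞) (ContinuousLinearEquiv.refl ℝ EB)
    rw [← hWx] at h1
    exact h1.contMDiffAt.comp x hW
  have hunit : ∀ᶠ m in 𝓝 x, W m ∈ Set.range ((↑) : (EB ≃L[ℝ] EB) → EB →L[ℝ] EB) := by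
    refine hW.continuousAt.eventually_mem ?_
    rw [hWx]
    exact ContinuousLinearEquiv.nhds (ContinuousLinearEquiv.refl ℝ EB)
  refine ContMDiffAt.congr_of_eventuallyEq (ContMDiffAt.clm_comp (ContMDiffAt.clm_comp h
    (contMDiffAt_const (c := R'))) hinv) ?_
  filter_upwards [heq, hunit] with m hm hm'
  obtain ⟨e, he⟩ := hm'
  rw [hm, ContinuousLinearMap.comp_assoc _ (T m) R']
  change _ = (ContinuousLinearMap.comp _ (W m)).comp (ContinuousLinearMap.inverse (W m))
  rw [ContinuousLinearMap.comp_assoc, ← he, ContinuousLinearMap.inverse_equiv]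
  simp

end CovectorFields

/-! ### The infinitesimal action on smooth families of covectors. -/

section

variable {E H M EQ Q EG G : Type*} [NormedAddCommGroup E] [NormedSpace ℝ E] [TopologicalSpace H]
  [TopologicalSpace M] [ChartedSpace H M] {I : ModelWithCorners ℝ E H}
  [NormedAddCommGroup EQ] [NormedSpace ℝ EQ] [TopologicalSpace Q] [ChartedSpace EQ Q]
  [NormedAddCommGroup EG] [NormedSpace ℝ EG] [TopologicalSpace G] [ChartedSpace EG G] [Group G]
  [MulAction Gᵐᵒᵖ Q]

/-- The composition of a smooth family of covectors with the infinitesimal action is smooth. -/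
theorem CovectorSmoothAt.comp_infActL [IsManifold 𝓘(ℝ, EQ) ∞ Q] [IsManifold 𝓘(ℝ, EG) ∞ G]
    (hact : IsFreeProperAction EG G EQ Q)
    {q : M → Q} {β : M → EQ →L[ℝ] ℝ} {x : M} (h : CovectorSmoothAt I q β x)
    (hq : ContMDiffAt I 𝓘(ℝ, EQ) ∞ q x) :
    ContMDiffAt I 𝓘(ℝ, EG →L[ℝ] ℝ) ∞ (fun m => (β m).comp (infActL G (q m) : EG →L[ℝ] EQ)) x := by
  have h1 := contMDiffAt_mder_const (J := 𝓘(ℝ, EQ)) (f := fun (q : Q) (g : G) => op g • q)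
    (a := (1 : G)) (hact.smooth (q x, 1))
  simp only [op_one, one_smul] at h1
  refine (ContMDiffAt.clm_comp h (h1.comp x hq)).congr_of_eventuallyEq ?_
  filter_upwards [hq.continuousAt.eventually_mem
    (extChartAt_source_mem_nhds (I := 𝓘(ℝ, EQ)) (q x))] with m hm
  have h2 := mder_symm_comp_mder_extChartAt (I := 𝓘(ℝ, EQ)) (q x) hm
  ext ξ
  have h3 := fun w => congrArg (fun L : EQ →L[ℝ] EQ => β m (L w)) h2
  exact (h3 _).symm

end

/-! ### Sections and derivatives of quotient projections. -/

section

variable {E H M : Type*} [NormedAddCommGroup E] [NormedSpace ℝ E] [TopologicalSpace H]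
  [TopologicalSpace M] [ChartedSpace H M] {I : ModelWithCorners ℝ E H} {s : Setoid M}

namespace QuotientManifold

variable (Y : QuotientManifold I s)

theorem contMDiff_mk : ContMDiff I (𝓡 Y.dim) ∞ (Quotient.mk s) := fun x =>
  (Y.isSubmersion.isSubmersionAt x).contMDiffAt

variable [IsManifold I ∞ M] [I.Boundaryless]

theorem mder_mk_surjective (x : M) : Function.Surjective (mder I (𝓡 Y.dim) (Quotient.mk s) x) :=
  mder_surjective_of_isSubmersionAt (Y.isSubmersion.isSubmersionAt x)

theorem exists_rightInverse_mder_mk (x : M) : ∃ R : EuclideanSpace ℝ (Fin Y.dim) →L[ℝ] E,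
    ∀ v, mder I (𝓡 Y.dim) (Quotient.mk s) x (R v) = v := by
  obtain ⟨R, hR⟩ := LinearMap.exists_rightInverse_of_surjective
    (mder I (𝓡 Y.dim) (Quotient.mk s) x).toLinearMap
    (LinearMap.range_eq_top.2 (Y.mder_mk_surjective x))
  exact ⟨R.toContinuousLinearMap, fun v => congrArg (fun T : _ →ₗ[ℝ] _ => T v) hR⟩

/-- A right inverse of the derivative of the projection to a quotient manifold. -/
def mderMkInv (x : M) : EuclideanSpace ℝ (Fin Y.dim) →L[ℝ] E :=
  (Y.exists_rightInverse_mder_mk x).choose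

theorem mder_mk_mderMkInv (x : M) (v : EuclideanSpace ℝ (Fin Y.dim)) :
    mder I (𝓡 Y.dim) (Quotient.mk s) x (Y.mderMkInv x v) = v :=
  (Y.exists_rightInverse_mder_mk x).choose_spec v

/-- A section of the projection to a quotient manifold that is smooth at a given point. -/
theorem exists_section (x : M) : ∃ σ : Quotient s → M, ContMDiffAt (𝓡 Y.dim) I ∞ σ (Quotient.mk s x) ∧
    σ (Quotient.mk s x) = x ∧ ∀ n, Quotient.mk s (σ n) = n := by
  classical
  obtain ⟨σ, h1, h2, h3⟩ := exists_localSection (Y.isSubmersion.isSubmersionAt x)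
  -- Arbitrary representatives extend the local section to a global one, without affecting it near
  -- the given point.
  refine ⟨fun n => if Quotient.mk s (σ n) = n then σ n else n.out, ?_, ?_, fun n => ?_⟩
  · refine h1.self_of_nhds.congr_of_eventuallyEq ?_
    filter_upwards [h3] with n hn
    rw [if_pos hn]
  · simp only [h2, if_true]
  · dsimp only
    split_ifs with h
    · exact h
    · exact n.out_eq

end QuotientManifold

end

/-! ### The momentum map and its level sets. -/

namespace MagneticSystem

variable {EG G EP P EQ Q : Type*}
    [NormedAddCommGroup EG] [NormedSpace ℝ EG] [TopologicalSpace G] [ChartedSpace EG G] [Group G]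
    [NormedAddCommGroup EP] [NormedSpace ℝ EP] [TopologicalSpace P] [ChartedSpace EP P]
    [NormedAddCommGroup EQ] [NormedSpace ℝ EQ] [TopologicalSpace Q] [ChartedSpace EQ Q]
    [MulAction Gᵐᵒᵖ P] [MulAction Gᵐᵒᵖ Q] (S : MagneticSystem EG G EP P EQ Q)
    {A : DiffForm EQ Q 1 EG} (μ : EG →L[ℝ] ℝ)

/-- The covector part of a point of `T^*_P Q`, in the dual of the model space. -/
def cov (x : S.TPQ) : EQ →L[ℝ] ℝ := x.covector

variable (A) in
/-- The covector part of the shift map. -/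
def shiftCov (x : S.TPQ) : EQ →L[ℝ] ℝ :=
  S.cov x - (μ + S.δ x.proj).comp (toCovector A (S.ε x.proj))

theorem J_eq (x : S.TPQ) : S.J x = (S.cov x).comp (infActL G (S.ε x.proj)) - S.δ x.proj := rfl

/-- On the level set α(ξ_Q) = ⟨μ + δ(p), ξ⟩, and the subtracted term has the same value because
A(ξ_Q) = ξ. This is the reason for the shift. -/
theorem shiftCov_comp_infActL (hA : IsPrincipalConnection G A) {x : S.TPQ} (hx : S.J x = μ) :
    (S.shiftCov A μ x).comp (infActL G (S.ε x.proj) : EG →L[ℝ] EQ) = 0 := by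
  ext ξ
  have h1 : (S.cov x).comp (infActL G (S.ε x.proj) : EG →L[ℝ] EQ) = μ + S.δ x.proj := by
    rw [← hx, J_eq, sub_add_cancel]
  have h2 := congrArg (fun T : EG →L[ℝ] ℝ => T ξ) h1
  simp only [shiftCov, ContinuousLinearMap.comp_apply, sub_apply,
    hA.toCovector_infActL, zero_apply]
  exact sub_eq_zero.2 h2

theorem contMDiff_J [IsManifold 𝓘(ℝ, EQ) ∞ Q] [IsManifold 𝓘(ℝ, EG) ∞ G] :
    ContMDiff (𝓘(ℝ, EP).prod 𝓘(ℝ, EQ →L[ℝ] ℝ)) 𝓘(ℝ, EG →L[ℝ] ℝ) ∞ S.J := by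
  intro x
  obtain ⟨h1, h2⟩ := contMDiffAt_pullbackCotangent_iff.1
    (contMDiffAt_id (I := 𝓘(ℝ, EP).prod 𝓘(ℝ, EQ →L[ℝ] ℝ)) (n := ∞) (x := x))
  have h3 : ContMDiffAt (𝓘(ℝ, EP).prod 𝓘(ℝ, EQ →L[ℝ] ℝ)) 𝓘(ℝ, EQ) ∞
      (fun x : S.TPQ => S.ε x.proj) x := (S.ε.contMDiff _).comp x h1
  exact (h2.comp_infActL S.actQ h3).sub ((S.δ_smooth _).comp x h1)

theorem nonempty_submanifoldStructure_level [FiniteDimensional ℝ EG] [FiniteDimensional ℝ EP]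
    [FiniteDimensional ℝ EQ] [IsManifold 𝓘(ℝ, EP) ∞ P] [IsManifold 𝓘(ℝ, EQ) ∞ Q]
    [IsManifold 𝓘(ℝ, EG) ∞ G]
    (hμ : ∀ x : S.TPQ, S.J x = μ → Function.Surjective
      (mder (𝓘(ℝ, EP).prod 𝓘(ℝ, EQ →L[ℝ] ℝ)) 𝓘(ℝ, EG →L[ℝ] ℝ) S.J x)) :
    Nonempty (SubmanifoldStructure (𝓘(ℝ, EP).prod 𝓘(ℝ, EQ →L[ℝ] ℝ)) (S.level μ)) := by
  have := isManifold_pullbackCotangent S.ε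
  exact nonempty_submanifoldStructure S.contMDiff_J hμ

/-- The form of the orbit relation required by the stabilizer theorem, with a constant κ whose
stabilizer is the whole of G. -/
theorem orbitRel_iff {G Q : Type*} [Group G] [MulAction Gᵐᵒᵖ Q] (y z : Q) : (MulAction.orbitRel Gᵐᵒᵖ Q).r y z ↔
    ∃ k : G, (fun _ : G => (0 : ℝ)) k = (fun _ : G => (0 : ℝ)) 1 ∧ op k • y = z := by
  simp only [true_and]
  constructor
  · rintro ⟨k, hk⟩
    refine ⟨k.unop⁻¹, ?_⟩
    have h1 : k • z = y := hk
    rw [← h1, op_inv, op_unop, inv_smul_smul]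
  · rintro ⟨k, rfl⟩
    exact ⟨(op k)⁻¹, inv_smul_smul (op k) y⟩

theorem isAffineOrbitMap_zero : IsAffineOrbitMap EG (fun _ : G => (0 : ℝ)) where
  smooth := contMDiff_const
  equivariant _ := ⟨ContinuousLinearMap.id ℝ ℝ, 0, Function.injective_id, fun _ => by simp⟩

section

variable [FiniteDimensional ℝ EG] [FiniteDimensional ℝ EQ] [LieGroup 𝓘(ℝ, EG) ∞ G]
  [IsManifold 𝓘(ℝ, EQ) ∞ Q] [T2Space Q]

theorem nonempty_quotientManifold_orbitRel [Nonempty Q] (S : MagneticSystem EG G EP P EQ Q)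
    (hA : IsPrincipalConnection G A) :
    Nonempty (QuotientManifold 𝓘(ℝ, EQ) (MulAction.orbitRel Gᵐᵒᵖ Q)) :=
  S.actQ.nonempty_quotientManifold hA.infActL_injective isAffineOrbitMap_zero orbitRel_iff

end

end MagneticSystem

/-! ### Covectors on Q and on Q/G. -/

section OrbitProjection

theorem mk_smul {G Q : Type*} [Group G] [MulAction Gᵐᵒᵖ Q] (k : G) (q : Q) : Quotient.mk (MulAction.orbitRel Gᵐᵒᵖ Q) (op k • q) =
    Quotient.mk (MulAction.orbitRel Gᵐᵒᵖ Q) q :=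
  Quotient.sound ⟨op k, rfl⟩

variable {EG G EQ Q : Type*}
    [NormedAddCommGroup EG] [NormedSpace ℝ EG] [TopologicalSpace G] [ChartedSpace EG G] [Group G]
    [NormedAddCommGroup EQ] [NormedSpace ℝ EQ] [TopologicalSpace Q] [ChartedSpace EQ Q]
    [MulAction Gᵐᵒᵖ Q] (X : QuotientManifold 𝓘(ℝ, EQ) (MulAction.orbitRel Gᵐᵒᵖ Q))

/-- The derivative of the projection `Q → Q/G`. -/
def orbitProjDeriv (q : Q) : EQ →L[ℝ] EuclideanSpace ℝ (Fin X.dim) :=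
  mder 𝓘(ℝ, EQ) (𝓡 X.dim) (Quotient.mk (MulAction.orbitRel Gᵐᵒᵖ Q)) q

theorem orbitProjDeriv_comp_infActL (hact : IsFreeProperAction EG G EQ Q) (q : Q) :
    (orbitProjDeriv X q).comp (infActL G q : EG →L[ℝ] EQ) = 0 := by
  have h1 := mder_comp (g := Quotient.mk (MulAction.orbitRel Gᵐᵒᵖ Q)) (f := fun g : G => op g • q)
    (x := 1) (I := 𝓘(ℝ, EG)) (I'' := 𝓡 X.dim) ((X.contMDiff_mk _).mdifferentiableAt (by simp))
    (hact.mdiff_orbit 1 q)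
  have h2 : (Quotient.mk (MulAction.orbitRel Gᵐᵒᵖ Q) ∘ fun g : G => op g • q) =
      fun _ => Quotient.mk (MulAction.orbitRel Gᵐᵒᵖ Q) q := funext fun k => mk_smul k q
  rw [h2, mder_const, op_one, one_smul] at h1
  exact h1.symm

theorem orbitProjDeriv_comp_act (hact : IsFreeProperAction EG G EQ Q) (k : G) (q : Q) :
    (orbitProjDeriv X (op k • q)).comp (mder 𝓘(ℝ, EQ) 𝓘(ℝ, EQ) (fun q : Q => op k • q) q) =
      orbitProjDeriv X q := by
  have h1 := mder_comp (g := Quotient.mk (MulAction.orbitRel Gᵐᵒᵖ Q)) (f := fun q : Q => op k • q)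
    (x := q) (I := 𝓘(ℝ, EQ)) (I'' := 𝓡 X.dim) ((X.contMDiff_mk _).mdifferentiableAt (by simp))
    (hact.mdiff_act k q)
  have h2 : (Quotient.mk (MulAction.orbitRel Gᵐᵒᵖ Q) ∘ fun q : Q => op k • q) =
      Quotient.mk (MulAction.orbitRel Gᵐᵒᵖ Q) := funext fun q => mk_smul k q
  rw [h2] at h1
  exact h1.symm

variable [FiniteDimensional ℝ EG] [FiniteDimensional ℝ EQ] [LieGroup 𝓘(ℝ, EG) ∞ G]
  [IsManifold 𝓘(ℝ, EQ) ∞ Q] [T2Space Q]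

/-- A covector that vanishes on the orbit is the pullback of a covector on the quotient. -/
theorem comp_mderMkInv_comp_orbitProjDeriv (hact : IsFreeProperAction EG G EQ Q)
    {A : DiffForm EQ Q 1 EG} (hA : IsPrincipalConnection G A) {q : Q} {α : EQ →L[ℝ] ℝ}
    (hα : α.comp (infActL G q : EG →L[ℝ] EQ) = 0) :
    (α.comp (X.mderMkInv q)).comp (orbitProjDeriv X q) = α := by
  ext v
  -- Lifting the projection of `v` changes `v` only by a vertical vector, which is some ξ_Q and is
  -- annihilated by α.
  have h1 : orbitProjDeriv X q (X.mderMkInv q (orbitProjDeriv X q v) - v) = 0 := by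
    rw [map_sub, sub_eq_zero]
    exact X.mder_mk_mderMkInv q _
  obtain ⟨ξ, -, hξ⟩ := hact.exists_of_mder_mk_eq_zero hA.infActL_injective
    MagneticSystem.isAffineOrbitMap_zero MagneticSystem.orbitRel_iff X q _ h1
  have h2 := congrArg (fun T : EG →L[ℝ] ℝ => T ξ) hα
  have h3 : α (X.mderMkInv q (orbitProjDeriv X q v) - v) = 0 := by
    rw [← hξ]; exact h2
  rw [map_sub] at h3
  exact sub_eq_zero.1 h3

end OrbitProjection

/-! ### The reduction map, its fibres and its sections. -/

namespace MagneticSystem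

variable {EG G EP P EQ Q : Type*}
    [NormedAddCommGroup EG] [NormedSpace ℝ EG] [TopologicalSpace G] [ChartedSpace EG G] [Group G]
    [NormedAddCommGroup EP] [NormedSpace ℝ EP] [TopologicalSpace P] [ChartedSpace EP P]
    [NormedAddCommGroup EQ] [NormedSpace ℝ EQ] [TopologicalSpace Q] [ChartedSpace EQ Q]
    [MulAction Gᵐᵒᵖ P] [MulAction Gᵐᵒᵖ Q] (S : MagneticSystem EG G EP P EQ Q)
    {A : DiffForm EQ Q 1 EG} (μ : EG →L[ℝ] ℝ)

theorem cov_lift (k : G) (x : S.TPQ) : S.cov (S.lift k x) = (S.cov x).comp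
    (mder 𝓘(ℝ, EQ) 𝓘(ℝ, EQ) (fun q : Q => op k⁻¹ • q) (S.ε (op k • x.proj))) := rfl

theorem ext_of_cov {x y : S.TPQ} (h1 : x.proj = y.proj) (h2 : S.cov x = S.cov y) : x = y :=
  PullbackCotangent.mk_congr h1 h2

theorem inv_smul_ε (k : G) (p : P) : op k⁻¹ • S.ε (op k • p) = S.ε p := by
  rw [S.ε_equivariant, op_inv, inv_smul_smul]

variable (X : QuotientManifold 𝓘(ℝ, EQ) (MulAction.orbitRel Gᵐᵒᵖ Q))

theorem orbitProjDeriv_comp_inv (k : G) (p : P) :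
    (orbitProjDeriv X (S.ε p)).comp
      (mder 𝓘(ℝ, EQ) 𝓘(ℝ, EQ) (fun q : Q => op k⁻¹ • q) (S.ε (op k • p))) =
    orbitProjDeriv X (S.ε (op k • p)) := by
  have h := orbitProjDeriv_comp_act X S.actQ k⁻¹ (S.ε (op k • p))
  rwa [inv_smul_ε] at h

variable (A) in
/-- The covector part of the inverse shift. -/
def unshiftCov (p : P) (β : EuclideanSpace ℝ (Fin X.dim) →L[ℝ] ℝ) : EQ →L[ℝ] ℝ :=
  β.comp (orbitProjDeriv X (S.ε p)) + (μ + S.δ p).comp (toCovector A (S.ε p))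

theorem mk_unshiftCov_mem_level (hA : IsPrincipalConnection G A) (p : P)
    (β : EuclideanSpace ℝ (Fin X.dim) →L[ℝ] ℝ) :
    (PullbackCotangent.mk p (S.unshiftCov A μ X p β) : S.TPQ) ∈ S.level μ := by
  change (S.unshiftCov A μ X p β).comp (infActL G (S.ε p)) - S.δ p = μ
  have h1 := orbitProjDeriv_comp_infActL X S.actQ (S.ε p)
  ext ξ
  have h2 := congrArg (fun T : EG →L[ℝ] EuclideanSpace ℝ (Fin X.dim) => T ξ) h1
  simp only [ContinuousLinearMap.comp_apply, zero_apply] at h2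
  simp only [unshiftCov, sub_apply, add_apply, ContinuousLinearMap.comp_apply,
    hA.toCovector_infActL, h2, map_zero, zero_add, add_sub_cancel_right]

section

variable [IsManifold 𝓘(ℝ, EQ) ∞ Q]

variable (A) in
/-- The covector on `Q/G` that corresponds to a point of the level set. -/
def reducedCov (x : S.TPQ) : EuclideanSpace ℝ (Fin X.dim) →L[ℝ] ℝ :=
  (S.shiftCov A μ x).comp (X.mderMkInv (S.ε x.proj))

/-- On the level set the shifted covector annihilates vertical vectors, so the right inverse chosen
in `reducedCov` has no influence. -/
theorem reducedCov_comp_orbitProjDeriv [LieGroup 𝓘(ℝ, EG) ∞ G] [FiniteDimensional ℝ EG]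
    [FiniteDimensional ℝ EQ] [T2Space Q] (hA : IsPrincipalConnection G A) {x : S.TPQ}
    (hx : x ∈ S.level μ) :
    (S.reducedCov A μ X x).comp (orbitProjDeriv X (S.ε x.proj)) = S.shiftCov A μ x :=
  comp_mderMkInv_comp_orbitProjDeriv X S.actQ hA (S.shiftCov_comp_infActL μ hA hx)

end

variable [ConnectedSpace P] [IsManifold 𝓘(ℝ, EP) ∞ P] [LieGroup 𝓘(ℝ, EG) ∞ G]

/-- Moving A by k⁻¹ produces Ad_k, and for k in `G_μ` the coefficient satisfies μ + δ(pk) = Ad*_k(μ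
+ δ(p)); so the subtracted term transforms like the covector itself. -/
theorem shiftCov_lift (hA : IsPrincipalConnection G A) {k : G} (hk : k ∈ S.isotropy μ) (x : S.TPQ) :
    S.shiftCov A μ (S.lift k x) = (S.shiftCov A μ x).comp
      (mder 𝓘(ℝ, EQ) 𝓘(ℝ, EQ) (fun q : Q => op k⁻¹ • q) (S.ε (op k • x.proj))) := by
  have h1 := congrArg (fun η : DiffForm EQ Q 1 EG => toCovector η (S.ε (op k • x.proj)))
    (hA.equivariant k⁻¹)
  change (toCovector A (op k⁻¹ • S.ε (op k • x.proj))).comp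
    (mder 𝓘(ℝ, EQ) 𝓘(ℝ, EQ) (fun q : Q => op k⁻¹ • q) (S.ε (op k • x.proj))) =
    (Ad k⁻¹⁻¹).comp (toCovector A (S.ε (op k • x.proj))) at h1
  rw [inv_smul_ε, inv_inv] at h1
  have h2 : μ + S.δ (op k • x.proj) = coAd k (μ + S.δ x.proj) := (S.affineAct_eq_iff μ k x.proj).1 hk
  rw [shiftCov, shiftCov, ContinuousLinearMap.sub_comp, ContinuousLinearMap.comp_assoc _ (toCovector A _),
    h1, cov_lift]
  congr 1
  change (μ + S.δ (op k • x.proj)).comp (toCovector A (S.ε (op k • x.proj))) = _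
  rw [h2]
  rfl

theorem mk_ε_eq {p : P} {n : Quotient (S.orbitsP μ)} (h : Quotient.mk _ p = n) :
    Quotient.mk (MulAction.orbitRel Gᵐᵒᵖ Q) (S.ε p) = S.reducedε μ n := by
  rw [← h]; rfl

theorem contMDiff_reducedε (Y : QuotientManifold 𝓘(ℝ, EP) (S.orbitsP μ)) :
    ContMDiff (𝓡 Y.dim) (𝓡 X.dim) ∞ (S.reducedε μ) := by
  rintro ⟨p⟩
  obtain ⟨σ, h1, h2, h3⟩ := Y.exists_section p
  refine ((X.contMDiff_mk _).comp _ ((S.ε.contMDiff _).comp (Quotient.mk _ p) h1)).congr_of_eventuallyEq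
    (Filter.Eventually.of_forall fun n => ?_)
  exact (S.mk_ε_eq μ (h3 n)).symm

/-- The covector part of a point of the reduced space, in the dual of the model space. -/
def redCov (t : PullbackCotangent (EuclideanSpace ℝ (Fin X.dim)) (S.reducedε μ)) :
    EuclideanSpace ℝ (Fin X.dim) →L[ℝ] ℝ := t.covector

variable {X} in
theorem ext_of_redCov {t t' : PullbackCotangent (EuclideanSpace ℝ (Fin X.dim)) (S.reducedε μ)}
    (h1 : t.proj = t'.proj) (h2 : S.redCov μ X t = S.redCov μ X t') : t = t' :=
  PullbackCotangent.mk_congr h1 h2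

variable [IsManifold 𝓘(ℝ, EQ) ∞ Q]

variable (A) in
/-- The map from the level set to the reduced space induced by the shift map. -/
def reductionMap (x : S.level μ) :
    PullbackCotangent (EuclideanSpace ℝ (Fin X.dim)) (S.reducedε μ) :=
  PullbackCotangent.mk (Quotient.mk _ x.1.proj) (S.reducedCov A μ X x.1)

/-- The section of the reduction map over a section of `P → P/G_μ`. -/
def reductionSection (hA : IsPrincipalConnection G A) (σ : Quotient (S.orbitsP μ) → P)
    (t : PullbackCotangent (EuclideanSpace ℝ (Fin X.dim)) (S.reducedε μ)) : S.level μ :=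
  ⟨PullbackCotangent.mk (σ t.proj) (S.unshiftCov A μ X (σ t.proj) (S.redCov μ X t)),
    S.mk_unshiftCov_mem_level μ X hA _ _⟩

theorem reductionMap_reductionSection (hA : IsPrincipalConnection G A)
    {σ : Quotient (S.orbitsP μ) → P} (hσ : ∀ n, Quotient.mk _ (σ n) = n)
    (t : PullbackCotangent (EuclideanSpace ℝ (Fin X.dim)) (S.reducedε μ)) :
    S.reductionMap A μ X (S.reductionSection μ X hA σ t) = t := by
  refine S.ext_of_redCov μ (hσ _) ?_
  change (S.unshiftCov A μ X (σ t.proj) (S.redCov μ X t) -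
    (μ + S.δ (σ t.proj)).comp (toCovector A (S.ε (σ t.proj)))).comp (X.mderMkInv (S.ε (σ t.proj))) = _
  rw [unshiftCov, add_sub_cancel_right]
  ext v
  exact congrArg (S.redCov μ X t) (X.mder_mk_mderMkInv (S.ε (σ t.proj)) v)

theorem reductionMap_surjective (hA : IsPrincipalConnection G A) :
    Function.Surjective (S.reductionMap A μ X) := fun t =>
  ⟨_, S.reductionMap_reductionSection μ X hA (σ := Quotient.out) Quotient.out_eq t⟩

variable [FiniteDimensional ℝ EG] [FiniteDimensional ℝ EQ] [T2Space Q]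

theorem reductionSection_reductionMap (hA : IsPrincipalConnection G A)
    {σ : Quotient (S.orbitsP μ) → P} {x : S.level μ} (hσ : σ (Quotient.mk _ x.1.proj) = x.1.proj) :
    S.reductionSection μ X hA σ (S.reductionMap A μ X x) = x := by
  refine Subtype.ext (S.ext_of_cov hσ ?_)
  change S.unshiftCov A μ X (σ (Quotient.mk _ x.1.proj)) (S.reducedCov A μ X x.1) = _
  rw [hσ, unshiftCov, S.reducedCov_comp_orbitProjDeriv μ X hA x.2, shiftCov, sub_add_cancel]

/-- The fibres of the reduction map are the orbits of the isotropy group. -/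
theorem levelOrbits_iff (hA : IsPrincipalConnection G A) (x y : S.level μ) :
    (S.levelOrbits μ).r x y ↔ S.reductionMap A μ X x = S.reductionMap A μ X y := by
  have hcomp : ∀ (k : G), k ∈ S.isotropy μ → S.shiftCov A μ (S.lift k x.1) =
      (S.reducedCov A μ X x.1).comp (orbitProjDeriv X (S.ε (op k • x.1.proj))) := fun k hk => by
    rw [S.shiftCov_lift μ hA hk, ← S.reducedCov_comp_orbitProjDeriv μ X hA x.2,
      ContinuousLinearMap.comp_assoc, S.orbitProjDeriv_comp_inv X]
  constructor
  · rintro ⟨k, hk, h⟩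
    have hp : op k • x.1.proj = y.1.proj := congrArg TotalSpace.proj h
    refine S.ext_of_redCov μ (Quotient.sound ?_) ?_
    · exact (S.orbitsP_iff μ x.1.proj _ _).2 ⟨k, (S.orbitMap_eq_iff μ _ k).2 hk, hp⟩
    · change S.reducedCov A μ X x.1 = S.reducedCov A μ X y.1
      have h1 := hcomp k hk
      rw [h, hp, ← S.reducedCov_comp_orbitProjDeriv μ X hA y.2] at h1
      ext v
      obtain ⟨w, rfl⟩ := X.mder_mk_surjective (S.ε y.1.proj) v
      exact (congrArg (fun T : EQ →L[ℝ] ℝ => T w) h1).symm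
  · intro h
    have h1 : Quotient.mk (S.orbitsP μ) x.1.proj = Quotient.mk (S.orbitsP μ) y.1.proj :=
      congrArg TotalSpace.proj h
    have h2 : S.reducedCov A μ X x.1 = S.reducedCov A μ X y.1 := congrArg (S.redCov μ X) h
    obtain ⟨k, hk, hp⟩ := (S.orbitsP_iff μ x.1.proj _ _).1 (Quotient.exact h1)
    have hk' := (S.orbitMap_eq_iff μ _ k).1 hk
    refine ⟨k, hk', S.ext_of_cov hp ?_⟩
    -- The two shifted covectors are pullbacks of the same reduced covector at the same point; the
    -- connection terms agree there and cancel.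
    have h3 := hcomp k hk'
    rw [h2, hp, S.reducedCov_comp_orbitProjDeriv μ X hA y.2, shiftCov, shiftCov] at h3
    have h4 : (S.lift k x.1).proj = y.1.proj := hp
    rw [h4] at h3
    exact sub_left_injective h3

end MagneticSystem

/-! ### Smoothness of the reduction map and the diffeomorphism. -/

namespace MagneticSystem

variable {EG G EP P EQ Q : Type*}
    [NormedAddCommGroup EG] [NormedSpace ℝ EG] [TopologicalSpace G] [ChartedSpace EG G] [Group G]
    [NormedAddCommGroup EP] [NormedSpace ℝ EP] [TopologicalSpace P] [ChartedSpace EP P]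
    [NormedAddCommGroup EQ] [NormedSpace ℝ EQ] [TopologicalSpace Q] [ChartedSpace EQ Q]
    [MulAction Gᵐᵒᵖ P] [MulAction Gᵐᵒᵖ Q] (S : MagneticSystem EG G EP P EQ Q)
    {A : DiffForm EQ Q 1 EG} (μ : EG →L[ℝ] ℝ)
    [ConnectedSpace P] [IsManifold 𝓘(ℝ, EP) ∞ P] [LieGroup 𝓘(ℝ, EG) ∞ G]
    [IsManifold 𝓘(ℝ, EQ) ∞ Q]
    (N : SubmanifoldStructure (𝓘(ℝ, EP).prod 𝓘(ℝ, EQ →L[ℝ] ℝ)) (S.level μ))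
    (X : QuotientManifold 𝓘(ℝ, EQ) (MulAction.orbitRel Gᵐᵒᵖ Q))
    (Y : QuotientManifold 𝓘(ℝ, EP) (S.orbitsP μ))

theorem contMDiffAt_reductionSection (hA : IsPrincipalConnection G A)
    {σ : Quotient (S.orbitsP μ) → P} (hσ : ∀ n, Quotient.mk _ (σ n) = n)
    {t : PullbackCotangent (EuclideanSpace ℝ (Fin X.dim)) (S.reducedε μ)}
    (h : ContMDiffAt (𝓡 Y.dim) 𝓘(ℝ, EP) ∞ σ t.proj) :
    ContMDiffAt ((𝓡 Y.dim).prod 𝓘(ℝ, EuclideanSpace ℝ (Fin X.dim) →L[ℝ] ℝ)) (𝓡 N.dim) ∞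
      (S.reductionSection μ X hA σ) t := by
  obtain ⟨h1, h2⟩ := contMDiffAt_pullbackCotangent_iff.1 (contMDiffAt_id
    (I := (𝓡 Y.dim).prod 𝓘(ℝ, EuclideanSpace ℝ (Fin X.dim) →L[ℝ] ℝ)) (n := ∞) (x := t))
  have hp : ContMDiffAt ((𝓡 Y.dim).prod 𝓘(ℝ, EuclideanSpace ℝ (Fin X.dim) →L[ℝ] ℝ)) 𝓘(ℝ, EP) ∞
      (fun t : PullbackCotangent (EuclideanSpace ℝ (Fin X.dim)) (S.reducedε μ) => σ t.proj) t :=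
    ContMDiffAt.comp t h h1
  have hq : ContMDiffAt ((𝓡 Y.dim).prod 𝓘(ℝ, EuclideanSpace ℝ (Fin X.dim) →L[ℝ] ℝ)) 𝓘(ℝ, EQ) ∞
      (fun t : PullbackCotangent (EuclideanSpace ℝ (Fin X.dim)) (S.reducedε μ) => S.ε (σ t.proj)) t :=
    (S.ε.contMDiff _).comp t hp
  have hb : (Quotient.mk (MulAction.orbitRel Gᵐᵒᵖ Q) ∘
      fun t : PullbackCotangent (EuclideanSpace ℝ (Fin X.dim)) (S.reducedε μ) => S.ε (σ t.proj)) =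
      fun t => S.reducedε μ t.proj := funext fun t => S.mk_ε_eq μ (hσ t.proj)
  have h3 : CovectorSmoothAt ((𝓡 Y.dim).prod 𝓘(ℝ, EuclideanSpace ℝ (Fin X.dim) →L[ℝ] ℝ))
      (Quotient.mk (MulAction.orbitRel Gᵐᵒᵖ Q) ∘
        fun t : PullbackCotangent (EuclideanSpace ℝ (Fin X.dim)) (S.reducedε μ) => S.ε (σ t.proj))
      (S.redCov μ X) t := by
    rw [hb]; exact h2
  have h4 := (h3.pullback hq (X.contMDiff_mk _)).add (covectorSmoothAt_pairing hA.smooth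
    (contMDiffAt_const.add ((S.δ_smooth _).comp t hp) : ContMDiffAt _ 𝓘(ℝ, EG →L[ℝ] ℝ) ∞
      (fun t : PullbackCotangent (EuclideanSpace ℝ (Fin X.dim)) (S.reducedε μ) =>
        μ + S.δ (σ t.proj)) t) hq)
  have h5 : ContMDiffAt ((𝓡 Y.dim).prod 𝓘(ℝ, EuclideanSpace ℝ (Fin X.dim) →L[ℝ] ℝ))
      (𝓘(ℝ, EP).prod 𝓘(ℝ, EQ →L[ℝ] ℝ)) ∞
      ((Subtype.val : S.level μ → S.TPQ) ∘ S.reductionSection μ X hA σ) t :=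
    contMDiffAt_pullbackCotangent_iff.2 ⟨hp, h4⟩
  have := isManifold_pullbackCotangent S.ε
  -- The section is smooth into the ambient bundle; since the level set is embedded, it is
  -- continuous, and hence smooth, into the level set.
  exact (ContMDiffAt.iff_comp_isImmersionAt (N.isSmoothEmbedding.isImmersion.isImmersionAt _)).2
    ⟨N.isSmoothEmbedding.isEmbedding.continuousAt_iff.2 h5.continuousAt, h5⟩

variable [FiniteDimensional ℝ EG] [FiniteDimensional ℝ EQ] [T2Space Q]

/-- The right inverses in `reducedCov` are chosen pointwise and need not vary smoothly. But the
pullback of the reduced covector to Q is the shifted covector, which is smooth, and smoothness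
passes down along a submersion. -/
theorem contMDiff_reductionMap (hA : IsPrincipalConnection G A) :
    ContMDiff (𝓡 N.dim) ((𝓡 Y.dim).prod 𝓘(ℝ, EuclideanSpace ℝ (Fin X.dim) →L[ℝ] ℝ)) ∞
      (S.reductionMap A μ X) := by
  intro x
  have := isManifold_pullbackCotangent S.ε
  obtain ⟨h1, h2⟩ := contMDiffAt_pullbackCotangent_iff.1 (N.isSmoothEmbedding.contMDiff x)
  have hq : ContMDiffAt (𝓡 N.dim) 𝓘(ℝ, EQ) ∞ (fun x : S.level μ => S.ε x.1.proj) x :=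
    (S.ε.contMDiff _).comp x h1
  have h3 := h2.sub (covectorSmoothAt_pairing hA.smooth
    (contMDiffAt_const.add ((S.δ_smooth _).comp x h1) : ContMDiffAt _ 𝓘(ℝ, EG →L[ℝ] ℝ) ∞
      (fun x : S.level μ => μ + S.δ x.1.proj) x) hq)
  have h4 : CovectorSmoothAt (𝓡 N.dim) (Quotient.mk (MulAction.orbitRel Gᵐᵒᵖ Q) ∘
      fun x : S.level μ => S.ε x.1.proj) (fun x => S.reducedCov A μ X x.1) x := by
    refine .of_pullback hq (X.contMDiff_mk _) (X.mder_mk_surjective _) ?_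
    have h5 : (fun x : S.level μ => (S.reducedCov A μ X x.1).comp
        (mder 𝓘(ℝ, EQ) (𝓡 X.dim) (Quotient.mk (MulAction.orbitRel Gᵐᵒᵖ Q)) (S.ε x.1.proj))) =
        fun x => S.shiftCov A μ x.1 :=
      funext fun x => S.reducedCov_comp_orbitProjDeriv μ X hA x.2
    rw [h5]
    exact h3
  exact contMDiffAt_pullbackCotangent_iff.2 ⟨(Y.contMDiff_mk _).comp x h1, h4⟩

theorem exists_section_reductionMap (hA : IsPrincipalConnection G A) (x : S.level μ) :
    ∃ τ : PullbackCotangent (EuclideanSpace ℝ (Fin X.dim)) (S.reducedε μ) → S.level μ,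
      ContMDiffAt ((𝓡 Y.dim).prod 𝓘(ℝ, EuclideanSpace ℝ (Fin X.dim) →L[ℝ] ℝ)) (𝓡 N.dim) ∞ τ
        (S.reductionMap A μ X x) ∧ τ (S.reductionMap A μ X x) = x ∧
      ∀ t, S.reductionMap A μ X (τ t) = t := by
  obtain ⟨σ, h1, h2, h3⟩ := Y.exists_section x.1.proj
  exact ⟨S.reductionSection μ X hA σ, S.contMDiffAt_reductionSection μ N X Y hA h3 h1,
    S.reductionSection_reductionMap μ X hA h2, S.reductionMap_reductionSection μ X hA h3⟩

/-- The orbits are the fibres of the reduction map, which has smooth local sections; the target is a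
manifold for any auxiliary choice of structures on Q/G and P/G_μ. -/
theorem nonempty_quotientManifold_levelOrbits [FiniteDimensional ℝ EP] [T2Space P]
    (hA : IsPrincipalConnection G A) :
    Nonempty (QuotientManifold (𝓡 N.dim) (S.levelOrbits μ)) := by
  have : Nonempty Q := ⟨S.ε (Classical.arbitrary P)⟩
  obtain ⟨X⟩ := S.nonempty_quotientManifold_orbitRel hA
  obtain ⟨Y⟩ := S.nonempty_quotientManifold_orbitsP μ hA
  have := isManifold_pullbackCotangent_of_contMDiff (S.reducedε μ) (S.contMDiff_reducedε μ X Y)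
  have : Nonempty (S.level μ) :=
    ⟨⟨_, S.mk_unshiftCov_mem_level μ X hA (Classical.arbitrary P) 0⟩⟩
  exact nonempty_quotientManifold_of_localSections (S.contMDiff_reductionMap μ N X Y hA)
    (S.levelOrbits_iff μ X hA) (S.exists_section_reductionMap μ N X Y hA)

/-- The shift map induces a diffeomorphism of the reduced level set with the reduced space. -/
theorem exists_diffeomorph_reducedSpace (hA : IsPrincipalConnection G A)
    (Z : QuotientManifold (𝓡 N.dim) (S.levelOrbits μ)) :
    ∃ Φ : Quotient (S.levelOrbits μ)
        ≃ₘ^∞⟮𝓡 Z.dim, (𝓡 Y.dim).prod 𝓘(ℝ, EuclideanSpace ℝ (Fin X.dim) →L[ℝ] ℝ)⟯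
        PullbackCotangent (EuclideanSpace ℝ (Fin X.dim)) (S.reducedε μ),
      ∀ x : S.level μ, (Φ ⟦x⟧).proj = ⟦x.1.proj⟧ ∧
        ∀ v : TangentSpace 𝓘(ℝ, EQ) (S.ε x.1.proj),
          PullbackCotangent.covector (Φ ⟦x⟧) (mfderiv 𝓘(ℝ, EQ) (𝓡 X.dim)
            (Quotient.mk (MulAction.orbitRel Gᵐᵒᵖ Q)) (S.ε x.1.proj) v) =
          PullbackCotangent.covector (S.shift A μ x) v :=
  (exists_diffeomorph_of_localSections (S.contMDiff_reductionMap μ N X Y hA)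
    (S.levelOrbits_iff μ X hA) (S.reductionMap_surjective μ X hA)
    (S.exists_section_reductionMap μ N X Y hA) Z).imp fun Φ hΦ x => by
  rw [hΦ x]
  exact ⟨rfl, fun v => congrArg (fun T : EQ →L[ℝ] ℝ => T v)
    (S.reducedCov_comp_orbitProjDeriv μ X hA x.2)⟩

end MagneticSystem

end MagneticReduction

end

/-! ### The reduction theorem. -/

theorem proposition5p1 {EG G EP P EQ Q : Type*}
    [NormedAddCommGroup EG] [NormedSpace ℝ EG] [FiniteDimensional ℝ EG]
    [TopologicalSpace G] [ChartedSpace EG G] [Group G] [LieGroup 𝓘(ℝ, EG) ∞ G]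
    [T2Space G] [SecondCountableTopology G]
    [NormedAddCommGroup EP] [NormedSpace ℝ EP] [FiniteDimensional ℝ EP]
    [TopologicalSpace P] [ChartedSpace EP P] [IsManifold 𝓘(ℝ, EP) ∞ P]
    [T2Space P] [SecondCountableTopology P] [ConnectedSpace P]
    [NormedAddCommGroup EQ] [NormedSpace ℝ EQ] [FiniteDimensional ℝ EQ]
    [TopologicalSpace Q] [ChartedSpace EQ Q] [IsManifold 𝓘(ℝ, EQ) ∞ Q]
    [T2Space Q] [SecondCountableTopology Q]
    [MulAction Gᵐᵒᵖ P] [MulAction Gᵐᵒᵖ Q]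
    (S : MagneticSystem EG G EP P EQ Q)
    (A : DiffForm EQ Q 1 EG)
    (hA : IsPrincipalConnection G A)
    (μ : EG →L[ℝ] ℝ)
    (hμ : ∀ x : S.TPQ, S.J x = μ → Function.Surjective
      (mfderiv (𝓘(ℝ, EP).prod 𝓘(ℝ, EQ →L[ℝ] ℝ)) 𝓘(ℝ, EG →L[ℝ] ℝ) S.J x)) :
    -- 1.
    (∀ (g : G) (p : P), g ∈ S.isotropy μ ↔
      μ + S.δ (op g • p) = coAd g (μ + S.δ p)) ∧
    -- 2.
    IsPrincipalConnection G
      (pullbackForm S.ε A : DiffForm EP P 1 EG) ∧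
    -- 3.
    (∀ g ∈ S.isotropy μ, pullbackForm (fun p : P => op g • p)
      (S.potentialForm A μ) = S.potentialForm A μ) ∧
    -- 4.
    ((∀ g ∈ S.isotropy μ, pullbackForm (fun p : P => op g • p)
        (S.B + extD (S.potentialForm A μ)) =
          S.B + extD (S.potentialForm A μ)) ∧
      Nonempty (QuotientManifold 𝓘(ℝ, EP) (S.orbitsP μ)) ∧
      ∀ Y : QuotientManifold 𝓘(ℝ, EP) (S.orbitsP μ),
        ∃! Bred : DiffForm (EuclideanSpace ℝ (Fin Y.dim))
            (Quotient (S.orbitsP μ)) 2 ℝ,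
          IsSmoothForm Bred ∧
          pullbackForm (Quotient.mk (S.orbitsP μ)) Bred =
            S.B + extD (S.potentialForm A μ)) ∧
    -- 5.
    (Nonempty (QuotientManifold 𝓘(ℝ, EQ) (MulAction.orbitRel Gᵐᵒᵖ Q)) ∧
      Nonempty (SubmanifoldStructure (𝓘(ℝ, EP).prod 𝓘(ℝ, EQ →L[ℝ] ℝ))
        (S.level μ)) ∧
      ∀ N : SubmanifoldStructure (𝓘(ℝ, EP).prod 𝓘(ℝ, EQ →L[ℝ] ℝ)) (S.level μ),
        Nonempty (QuotientManifold (𝓡 N.dim) (S.levelOrbits μ)) ∧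
        ∀ (Z : QuotientManifold (𝓡 N.dim) (S.levelOrbits μ))
          (X : QuotientManifold 𝓘(ℝ, EQ) (MulAction.orbitRel Gᵐᵒᵖ Q))
          (Y : QuotientManifold 𝓘(ℝ, EP) (S.orbitsP μ)),
          ∃ Φ : Quotient (S.levelOrbits μ)
              ≃ₘ^∞⟮𝓡 Z.dim, (𝓡 Y.dim).prod 𝓘(ℝ, EuclideanSpace ℝ (Fin X.dim) →L[ℝ] ℝ)⟯
              PullbackCotangent (EuclideanSpace ℝ (Fin X.dim)) (S.reducedε μ),
            ∀ x : S.level μ,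
              (Φ ⟦x⟧).proj = ⟦x.1.proj⟧ ∧
              ∀ v : TangentSpace 𝓘(ℝ, EQ) (S.ε x.1.proj),
                PullbackCotangent.covector (Φ ⟦x⟧)
                    (mfderiv 𝓘(ℝ, EQ) (𝓡 X.dim)
                      (Quotient.mk (MulAction.orbitRel Gᵐᵒᵖ Q)) (S.ε x.1.proj) v) =
                  PullbackCotangent.covector (S.shift A μ x) v) := by
  have : Nonempty Q := ⟨S.ε (Classical.arbitrary P)⟩
  refine ⟨fun g p => S.affineAct_eq_iff μ g p, S.isPrincipalConnection_pullbackForm hA,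
    fun g hg => S.pullbackForm_potentialForm_eq_self μ hA hg, ?_, ?_⟩
  · refine ⟨?_, ?_, ?_⟩
    · exact fun g hg => S.pullbackForm_magnetic_eq_self μ hA hg
    · exact S.nonempty_quotientManifold_orbitsP μ hA
    · exact fun Y => S.existsUnique_reduced_magnetic μ hA Y
  · refine ⟨?_, ?_, fun N => ⟨?_, fun Z X Y => ?_⟩⟩
    · exact S.nonempty_quotientManifold_orbitRel hA
    · exact S.nonempty_submanifoldStructure_level μ hμ
    · exact S.nonempty_quotientManifold_levelOrbits μ N hA
    · exact S.exists_diffeomorph_reducedSpace μ N X Y hA Z
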